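/- **Setting.** Let $\mathbb D$ be the open unit disk. A one-parameter semigroup in $\mathbb D$ is a family $(\phi_t)_{t\ge0}$ of holomorphic self-maps of $\mathbb D$ with $\phi_0=\mathrm{id}$, $\phi_s\circ\phi_t=\phi_{s+t}$ and $\phi_t(z)\to z$ as $t\to0^+$ for all $z\in\mathbb D$; its infinitesimal generator is the holomorphic function $G:\mathbb D\to\mathbb C$ with $\frac{d}{dt}\phi_t(z)=G(\phi_t(z))$ for all $z\in\mathbb D$, $t\ge0$. A point $\sigma\in\partial\mathbb D$ is a boundary regular fixed point (BRFP) of $(\phi_t)$ if, for all $t\ge0$, $\phi_t$ has angular limit $\sigma$ and a finite angular derivative at $\sigma$; the spectral value at $\sigma$ is the angular limit $\angle\lim_{z\to\sigma}G(z)/(\sigma-z)$. If $\tau\in\mathbb D$ is the Denjoy–Wolff point (DW-point) of $(\phi_t)$, the spectral value $\lambda(G)\in\mathbb C$ at $\tau$ is defined by $\phi_t'(\tau)=e^{-\lambda(G)t}$ for all $t\ge0$. Let $n\ge1$, let $\sigma_1,\dots,\sigma_n\in\partial\mathbb D$ be pairwise distinct, $F=\{\sigma_1,\dots,\sigma_n\}$,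 $\Lambda=(\lambda_1,\dots,\lambda_n)\in(-\infty,0)^n$, and let $\tau\in\mathbb D\setminus\{0\}$. Let $\mathrm{Gen}_\tau(F,\Lambda)$ be the class of all infinitesimal generators $G$ that are either $\equiv0$ or have DW-point $\tau$, and whose semigroups have BRFPs $\sigma_1,\dots,\sigma_n$ with spectral values $\lambda_k'$ satisfying $\lambda_k\le\lambda'_k\le0$; let $\mathrm{Gen}'_\tau(F,\Lambda)$ be the subclass with $\lambda'_k=\lambda_k$ for all $k$. Put $$\alpha_k=\frac{|\tau-\sigma_k|^2}{2|\lambda_k|},\quad A=\sum_{k=1}^n\alpha_k,\quad B=\sum_{k=1}^n\frac{\operatorname{Im}(\overline{\sigma_k}\tau)}{|\lambda_k|},\quad p_0(z)=\sum_{k=1}^n\alpha_k\frac{\sigma_k+z}{\sigma_k-z},$$ $$Z=\{\zeta\in\mathbb C:|2\tau^{-1}A\,\zeta-1|\le1\},\qquad \ell_\zeta=\frac{\tau}{\zeta}-A,\qquad a_\zeta=\frac{1+|\tau|^2}{1-|\tau|^2}\operatorname{Re}\ell_\zeta+i\operatorname{Im}\ell_\zeta+p_0(\tau)\quad(\zeta\ne0),$$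 $$\Omega_\zeta=\Big\{\omega\in\mathbb C\setminus\{0\}:\Big|\frac{1-|\tau|^2}{\omega}-a_\zeta\Big|\le\frac{2|\tau|}{1-|\tau|^2}\operatorname{Re}\ell_\zeta\Big\}\ (\zeta\in Z\setminus\{0\}),\qquad\Omega_0=\{0\},$$ $$G_{\zeta,s}(z)=\frac{(\tau-z)(1-\overline\tau z)}{\frac{s+z}{s-z}\operatorname{Re}\ell_\zeta+i\operatorname{Im}\ell_\zeta+p_0(z)}\ (\zeta\in\operatorname{int}Z,\ s\in\partial\mathbb D),\qquad G_\zeta(z)=\frac{(\tau-z)(1-\overline\tau z)}{i\operatorname{Im}\ell_\zeta+p_0(z)}\ (\zeta\in\partial Z\setminus\{0\}).$$ **Theorem.** Every $G\in\mathrm{Gen}_\tau(F,\Lambda)$ has a unique spectral value $\lambda(G)$ at $\tau$ (with $\lambda(0)=0$), and the following hold. 1. The value region $V=\{(G(0),\lambda(G)):G\in\mathrm{Gen}_\tau(F,\Lambda)\}$ equals $\{(\zeta,\omega)\in\mathbb C^2:\zeta\in Z,\ \omega\in\Omega_\zeta\}$. Here $Z$ is the closed disk of centre $\tau/(2A)$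 and radius $|\tau|/(2A)$, and $\Omega_\zeta$ is a closed disk of positive radius if $\zeta\in\operatorname{int}Z$ and a single point if $\zeta\in\partial Z$. 2. Each boundary point of $V$ is delivered by exactly one $G\in\mathrm{Gen}_\tau(F,\Lambda)$, and this $G$ is one of the functions $G_{\zeta,s}$ ($\zeta\in\operatorname{int}Z$, $s\in\partial\mathbb D$), $G_\zeta$ ($\zeta\in\partial Z\setminus\{0\}$), or $0$. Conversely, all these functions belong to $\mathrm{Gen}_\tau(F,\Lambda)$ and deliver boundary points of $V$. Moreover $G_\zeta\in\mathrm{Gen}'_\tau(F,\Lambda)$, and $G_{\zeta,s}\in\mathrm{Gen}'_\tau(F,\Lambda)$ if $s\notin F$. 3. For every $G\in\mathrm{Gen}_\tau(F,\Lambda)$, $G\not\equiv0$, with $\lambda=\lambda(G)$, one has $G(0)\ne0$, $\lambda\ne0$ and the sharp inequalities $$\text{(a)}\quad\operatorname{Re}\frac{\tau}{G(0)}\ge A,$$ $$\text{(b)}\quad\frac{1-|\tau|}{1+|\tau|}\Big[\operatorname{Re}\frac{\tau}{G(0)}-A\Big]\le\operatorname{Re}\frac{1-|\tau|^2}{\lambda}-\frac{1-|\tau|^2}{2}\sum_{k=1}^n\frac1{|\lambda_k|}\le\frac{1+|\tau|}{1-|\tau|}\Big[\operatorname{Re}\frac{\tau}{G(0)}-A\Big],$$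 $$\text{(c)}\quad\Big|\operatorname{Im}\Big(\frac{1-|\tau|^2}{\lambda}-\frac{\tau}{G(0)}\Big)-B\Big|\le\frac{2|\tau|}{1-|\tau|^2}\Big[\operatorname{Re}\frac{\tau}{G(0)}-A\Big].$$ Equality holds in (a) if and only if $G=G_\zeta$ for some $\zeta\in\partial Z\setminus\{0\}$. In each of the other inequalities it holds if and only if $G=G_\zeta$ for some $\zeta\in\partial Z\setminus\{0\}$, or $G=G_{\zeta,s}$ for some $\zeta\in\operatorname{int}Z$ with: $s=-\tau/|\tau|$ for the left inequality in (b); $s=\tau/|\tau|$ for the right inequality in (b); $s=\frac{\tau}{|\tau|}\cdot\frac{2|\tau|\pm i(1-|\tau|^2)}{1+|\tau|^2}$ (either sign) for (c). -/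

import Mathlib

open Set Filter Topology Complex

namespace HolGen

noncomputable section

/-- The open unit disk. Functions on it are represented by functions `ℂ → ℂ`, of which only the
values on the disk matter. -/
abbrev unitDisk : Set ℂ := Metric.ball 0 1

/-! ### Angular limits and boundary fixed points -/

/-- The Stolz region with vertex `σ` and aperture `M`. -/
def stolz (σ : ℂ) (M : ℝ) : Set ℂ := {z | ‖z‖ < 1 ∧ ‖z - σ‖ < M * (1 - ‖z‖)}

/-- `f` has the (finite) angular limit `L` at the boundary point `σ`. -/
def HasAngularLimit (f : ℂ → ℂ) (σ L : ℂ) : Prop :=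
  ∀ M : ℝ, Tendsto f (𝓝[stolz σ M] σ) (𝓝 L)

/-- `σ` is a boundary fixed point of `φ` with finite angular derivative `d`. -/
def HasBoundaryFixedPoint (φ : ℂ → ℂ) (σ d : ℂ) : Prop :=
  ‖σ‖ = 1 ∧ HasAngularLimit φ σ σ ∧ HasAngularLimit (fun z => (φ z - σ) / (z - σ)) σ d

/-- `σ` is a boundary regular fixed point of `φ`. -/
def IsBRFP (φ : ℂ → ℂ) (σ : ℂ) : Prop := ∃ d : ℂ, HasBoundaryFixedPoint φ σ d

/-- `τ` is the Denjoy-Wolff point of the holomorphic self-map `φ ≠ id` of the disk. -/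
def IsDWPoint (φ : ℂ → ℂ) (τ : ℂ) : Prop :=
  (τ ∈ unitDisk ∧ φ τ = τ ∧ ‖deriv φ τ‖ ≤ 1) ∨
  ((∀ z ∈ unitDisk, φ z ≠ z) ∧ ∃ d : ℝ, d ≤ 1 ∧ HasBoundaryFixedPoint φ τ d)

/-! ### One-parameter semigroups and infinitesimal generators -/

/-- `(φ t)`, `t ≥ 0`, is a one-parameter semigroup of holomorphic self-maps of the disk. -/
structure IsOneParamSemigroup (φ : ℝ → ℂ → ℂ) : Prop where
  holo : ∀ t, 0 ≤ t → DifferentiableOn ℂ (φ t) unitDisk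
  mapsTo : ∀ t, 0 ≤ t → MapsTo (φ t) unitDisk unitDisk
  zero : ∀ z ∈ unitDisk, φ 0 z = z
  comp : ∀ s t, 0 ≤ s → 0 ≤ t → ∀ z ∈ unitDisk, φ s (φ t z) = φ (s + t) z
  cont : ∀ z ∈ unitDisk, Tendsto (fun t => φ t z) (𝓝[>] 0) (𝓝 z)

/-- `G` is the infinitesimal generator of the one-parameter semigroup `(φ t)`. -/
structure IsGeneratorOf (G : ℂ → ℂ) (φ : ℝ → ℂ → ℂ) : Prop where
  semigroup : IsOneParamSemigroup φ
  holo : DifferentiableOn ℂ G unitDisk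
  flow : ∀ z ∈ unitDisk, ∀ t, 0 ≤ t →
    HasDerivWithinAt (fun s => φ s z) (G (φ t z)) (Ici 0) t

/-- `τ` is the Denjoy-Wolff point of `(φ t)`: the common one of all the elements other than the
identity. By convention, every point qualifies for the trivial semigroup. -/
def IsSemigroupDWPoint (φ : ℝ → ℂ → ℂ) (τ : ℂ) : Prop :=
  ∀ t, 0 ≤ t → ¬ EqOn (φ t) id unitDisk → IsDWPoint (φ t) τ

/-- `σ` is a boundary regular fixed point of the semigroup `(φ t)` with generator `G`, and `l` is
its spectral value there. -/
def HasBRFPWithSpectralValue (G : ℂ → ℂ) (φ : ℝ → ℂ → ℂ) (σ : ℂ) (l : ℝ) : Prop :=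
  (∀ t, 0 ≤ t → IsBRFP (φ t) σ) ∧ HasAngularLimit (fun z => G z / (σ - z)) σ l

/-- `w` is the spectral value at the Denjoy-Wolff point `τ`, lying inside the disk, of the
semigroup generated by `G`. -/
def HasSpectralValue (G : ℂ → ℂ) (τ w : ℂ) : Prop :=
  ∃ φ : ℝ → ℂ → ℂ, IsGeneratorOf G φ ∧ ∀ t : ℝ, 0 ≤ t → deriv (φ t) τ = exp (-(w * t))

variable {n : ℕ}

/-- The class `Gen_τ(F, Λ)`: generators with Denjoy-Wolff point `τ` and boundary regular fixed
points `σ k`, with spectral values between `lam k` and `0`. -/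
def Gen (τ : ℂ) (σ : Fin n → ℂ) (lam : Fin n → ℝ) : Set (ℂ → ℂ) :=
  {G | ∃ φ : ℝ → ℂ → ℂ, IsGeneratorOf G φ ∧ IsSemigroupDWPoint φ τ ∧
    ∀ k, ∃ l : ℝ, lam k ≤ l ∧ l ≤ 0 ∧ HasBRFPWithSpectralValue G φ (σ k) l}

/-- The class `Gen'_τ(F, Λ)`: the spectral values at `σ k` are exactly `lam k`. -/
def GenExact (τ : ℂ) (σ : Fin n → ℂ) (lam : Fin n → ℝ) : Set (ℂ → ℂ) :=
  {G | ∃ φ : ℝ → ℂ → ℂ, IsGeneratorOf G φ ∧ IsSemigroupDWPoint φ τ ∧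
    ∀ k, HasBRFPWithSpectralValue G φ (σ k) (lam k)}

/-! ### The value region -/

/-- The pair `(G(0), λ(G))` equals `P`. -/
def Delivers (τ : ℂ) (G : ℂ → ℂ) (P : ℂ × ℂ) : Prop :=
  G 0 = P.1 ∧ HasSpectralValue G τ P.2

/-- The value region of `G ↦ (G(0), λ(G))` on `Gen_τ(F, Λ)`. -/
def valueRegion (τ : ℂ) (σ : Fin n → ℂ) (lam : Fin n → ℝ) : Set (ℂ × ℂ) :=
  {P | ∃ G ∈ Gen τ σ lam, Delivers τ G P}

/-- The numbers `α_k`. -/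
def alpha (τ : ℂ) (σ : Fin n → ℂ) (lam : Fin n → ℝ) (k : Fin n) : ℝ :=
  ‖τ - σ k‖ ^ 2 / (2 * |lam k|)

/-- `A = ∑ α_k`. -/
def sumAlpha (τ : ℂ) (σ : Fin n → ℂ) (lam : Fin n → ℝ) : ℝ := ∑ k, alpha τ σ lam k

/-- `B = ∑ Im(conj(σ_k) τ) / |λ_k|`. -/
def sumB (τ : ℂ) (σ : Fin n → ℂ) (lam : Fin n → ℝ) : ℝ :=
  ∑ k, ((starRingEnd ℂ) (σ k) * τ).im / |lam k|

/-- The function `p₀(z; F, Λ)`. -/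
def p₀ (τ : ℂ) (σ : Fin n → ℂ) (lam : Fin n → ℝ) (z : ℂ) : ℂ :=
  ∑ k, (alpha τ σ lam k : ℂ) * ((σ k + z) / (σ k - z))

/-- The set `Z`. -/
def regionZ (τ : ℂ) (σ : Fin n → ℂ) (lam : Fin n → ℝ) : Set ℂ :=
  {ζ | ‖2 * τ⁻¹ * (sumAlpha τ σ lam : ℂ) * ζ - 1‖ ≤ 1}

/-- `ℓ_ζ` (used for `ζ ≠ 0`). -/
def ell (τ : ℂ) (σ : Fin n → ℂ) (lam : Fin n → ℝ) (ζ : ℂ) : ℂ :=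
  τ / ζ - (sumAlpha τ σ lam : ℂ)

/-- `a_ζ` (used for `ζ ≠ 0`). -/
def centerA (τ : ℂ) (σ : Fin n → ℂ) (lam : Fin n → ℝ) (ζ : ℂ) : ℂ :=
  (((1 + ‖τ‖ ^ 2) / (1 - ‖τ‖ ^ 2) * (ell τ σ lam ζ).re : ℝ) : ℂ)
    + I * ((ell τ σ lam ζ).im : ℂ) + p₀ τ σ lam τ

open Classical in
/-- The set `Ω_ζ`. -/
def regionΩ (τ : ℂ) (σ : Fin n → ℂ) (lam : Fin n → ℝ) (ζ : ℂ) : Set ℂ :=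
  if ζ = 0 then {0} else
    {ω | ω ≠ 0 ∧ ‖((1 - ‖τ‖ ^ 2 : ℝ) : ℂ) / ω - centerA τ σ lam ζ‖
      ≤ 2 * ‖τ‖ / (1 - ‖τ‖ ^ 2) * (ell τ σ lam ζ).re}

/-! ### The extremal generators -/

/-- The function `G_{ζ,s}`. -/
def extremalInt (τ : ℂ) (σ : Fin n → ℂ) (lam : Fin n → ℝ) (ζ s z : ℂ) : ℂ :=
  (τ - z) * (1 - (starRingEnd ℂ) τ * z) /
    ((s + z) / (s - z) * ((ell τ σ lam ζ).re : ℂ) + I * ((ell τ σ lam ζ).im : ℂ) + p₀ τ σ lam z)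

/-- The function `G_ζ`. -/
def extremalBdry (τ : ℂ) (σ : Fin n → ℂ) (lam : Fin n → ℝ) (ζ z : ℂ) : ℂ :=
  (τ - z) * (1 - (starRingEnd ℂ) τ * z) /
    (I * ((ell τ σ lam ζ).im : ℂ) + p₀ τ σ lam z)

/-- `G = G_{ζ,s}` on the disk for some interior point `ζ` of `Z`. -/
def IsExtremalInt (τ : ℂ) (σ : Fin n → ℂ) (lam : Fin n → ℝ) (s : ℂ) (G : ℂ → ℂ) : Prop :=
  ∃ ζ ∈ interior (regionZ τ σ lam), EqOn G (extremalInt τ σ lam ζ s) unitDisk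

/-- `G = G_ζ` on the disk for some boundary point `ζ ≠ 0` of `Z`. -/
def IsExtremalBdry (τ : ℂ) (σ : Fin n → ℂ) (lam : Fin n → ℝ) (G : ℂ → ℂ) : Prop :=
  ∃ ζ ∈ frontier (regionZ τ σ lam), ζ ≠ 0 ∧ EqOn G (extremalBdry τ σ lam ζ) unitDisk

/-- `G` is, on the disk, one of the functions `G_{ζ,s}`, `G_ζ`, or `0`. -/
def IsExtremal (τ : ℂ) (σ : Fin n → ℂ) (lam : Fin n → ℝ) (G : ℂ → ℂ) : Prop :=
  (∃ s : ℂ, ‖s‖ = 1 ∧ IsExtremalInt τ σ lam s G) ∨ IsExtremalBdry τ σ lam G ∨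
    EqOn G 0 unitDisk

end

end HolGen

open HolGen

/-! By Berkson and Porta, the generator of a semigroup fixing τ ∈ 𝔻 is G = (τ - z)(1 - conj τ z) p
with Re p ≥ 0. A spectral value l at σ_k says that p(rσ_k)/(1 - r) → -l/|τ - σ_k|², so 1/p carries
at σ_k a boundary mass which, because l ≥ λ_k, is at least the one in p₀. Julia's lemma allows these
masses to be subtracted one after another, so for G ≢ 0 one gets 1/p = f + p₀ with Re f ≥ 0
(`exists_repr`). Then G(0) = τ/(f(0) + A) and λ = (1 - |τ|²)/(f(τ) + p₀(τ)): in the coordinates f(0)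
= ℓ_ζ and f(τ) = (1 - |τ|²)/ω - p₀(τ), everything is a question about the pair (f(0), f(τ)).

That question is answered by the Schwarz lemma for the half-plane. With L = f(0), it gives |f(τ) -
L| ≤ |τ| |f(τ) + conj L| (`norm_sub_zero_le`), a euclidean disk (`norm_sub_le_iff_disk`) whose
inversion is Ω_ζ; for ζ ≠ 0, the condition Re L ≥ 0 is ζ ∈ Z. The functions `herglotz L κ` with |κ|
≤ 1 attain every value of this disk (`exists_herglotz_eq`). Equality forces f = `herglotz L κ` with
|κ| = 1 if Re L > 0 (`exists_eqOn_herglotz`), while f is constant if Re L = 0; hence the uniqueness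
on the boundary. The inequalities are the projections of the disk to the coordinate axes.

For the converse the semigroups must be constructed. Moving τ to 0 turns G into a dissipative vector
field, whose solutions exist for all times; for f = `herglotz L κ`, G has a simple zero at each σ_k.
A single linearization lemma, `tendsto_div_of_linearized`, yields the holomorphy of the flow, the
formula φ_t'(τ) = exp(G'(τ) t) and the angular derivatives at the σ_k. -/

namespace HolGen

/-! ### Automorphisms of the disk -/

/-- The involutive automorphism of the unit disk that swaps `0` and `τ`. -/
noncomputable def mob (τ z : ℂ) : ℂ := (τ - z) / (1 - (starRingEnd ℂ) τ * z)

theorem mem_unitDisk {z : ℂ} : z ∈ unitDisk ↔ ‖z‖ < 1 := mem_ball_zero_iff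

theorem isOpen_unitDisk : IsOpen unitDisk := Metric.isOpen_ball

theorem one_sub_conj_mul_ne_zero {τ z : ℂ} (hτ : ‖τ‖ < 1) (hz : ‖z‖ ≤ 1) :
    1 - (starRingEnd ℂ) τ * z ≠ 0 := by
  intro h
  have h1 : (starRingEnd ℂ) τ * z = 1 := (sub_eq_zero.mp h).symm
  have h2 : ‖(starRingEnd ℂ) τ * z‖ = 1 := by rw [h1]; simp
  rw [norm_mul, RCLike.norm_conj] at h2
  nlinarith [norm_nonneg τ, norm_nonneg z]

theorem norm_sq_one_sub_conj_mul (τ z : ℂ) :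
    ‖1 - (starRingEnd ℂ) τ * z‖ ^ 2 = ‖τ - z‖ ^ 2 + (1 - ‖τ‖ ^ 2) * (1 - ‖z‖ ^ 2) := by
  simp only [← Complex.normSq_eq_norm_sq, Complex.normSq_apply]
  simp
  ring

theorem mob_mem {τ z : ℂ} (hτ : ‖τ‖ < 1) (hz : ‖z‖ < 1) : ‖mob τ z‖ < 1 := by
  have h0 : 0 < ‖1 - (starRingEnd ℂ) τ * z‖ :=
    norm_pos_iff.mpr (one_sub_conj_mul_ne_zero hτ hz.le)
  rw [mob, norm_div, div_lt_one h0]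
  have h1 := norm_sq_one_sub_conj_mul τ z
  have h2 : 0 < (1 - ‖τ‖ ^ 2) * (1 - ‖z‖ ^ 2) := by
    apply mul_pos <;> nlinarith [norm_nonneg τ, norm_nonneg z]
  exact lt_of_pow_lt_pow_left₀ 2 h0.le (by linarith)

theorem mob_mapsTo {τ : ℂ} (hτ : ‖τ‖ < 1) : MapsTo (mob τ) unitDisk unitDisk :=
  fun _ hz => mem_unitDisk.mpr (mob_mem hτ (mem_unitDisk.mp hz))

theorem one_sub_conj_mul_self (τ : ℂ) :
    1 - (starRingEnd ℂ) τ * τ = ((1 - ‖τ‖ ^ 2 : ℝ) : ℂ) := by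
  rw [mul_comm, Complex.mul_conj, Complex.normSq_eq_norm_sq]; push_cast; ring

theorem one_sub_conj_mul_mob {τ z : ℂ} (hτ : ‖τ‖ < 1) (hz : ‖z‖ < 1) :
    1 - (starRingEnd ℂ) τ * mob τ z
      = (1 - (starRingEnd ℂ) τ * τ) / (1 - (starRingEnd ℂ) τ * z) := by
  have h0 := one_sub_conj_mul_ne_zero hτ hz.le
  rw [mob, eq_div_iff h0, sub_mul, mul_assoc, div_mul_cancel₀ _ h0]; ring

theorem mob_mob {τ z : ℂ} (hτ : ‖τ‖ < 1) (hz : ‖z‖ < 1) : mob τ (mob τ z) = z := by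
  have h0 := one_sub_conj_mul_ne_zero hτ hz.le
  have h1 := one_sub_conj_mul_ne_zero hτ hτ.le
  rw [mob, one_sub_conj_mul_mob hτ hz, div_div_eq_mul_div, div_eq_iff h1, mob, sub_mul,
    div_mul_cancel₀ _ h0]
  ring

@[simp] theorem mob_self (τ : ℂ) : mob τ τ = 0 := by simp [mob]

@[simp] theorem mob_zero (τ : ℂ) : mob τ 0 = τ := by simp [mob]

theorem hasDerivAt_mob {τ z : ℂ} (hτ : ‖τ‖ < 1) (hz : ‖z‖ < 1) :
    HasDerivAt (mob τ)
      (-(1 - (starRingEnd ℂ) τ * τ) / (1 - (starRingEnd ℂ) τ * z) ^ 2) z := by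
  have h0 := one_sub_conj_mul_ne_zero hτ hz.le
  have h := ((hasDerivAt_id z).const_sub τ).div
    (((hasDerivAt_id z).const_mul ((starRingEnd ℂ) τ)).const_sub 1) h0
  refine h.congr_deriv ?_
  simp only [id]
  congr 1
  ring

theorem differentiableOn_mob {τ : ℂ} (hτ : ‖τ‖ < 1) : DifferentiableOn ℂ (mob τ) unitDisk :=
  fun _ hz => (hasDerivAt_mob hτ (mem_unitDisk.mp hz)).differentiableAt.differentiableWithinAt

/-! ### Functions with nonnegative real part -/

/-- The half-plane counterpart of `norm_sq_one_sub_conj_mul`: it shows that the Cayley transform (a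
- b)/(a + conj b) has modulus less than 1 when both real parts are positive. -/
theorem norm_sq_add_conj (a b : ℂ) :
    ‖a + (starRingEnd ℂ) b‖ ^ 2 = ‖a - b‖ ^ 2 + 4 * (a.re * b.re) := by
  simp only [← Complex.normSq_eq_norm_sq, Complex.normSq_apply]
  simp
  ring

/-- The Cayley transform of a function with positive real part. -/
theorem cayley_mapsTo {f : ℂ → ℂ} (hre : ∀ z ∈ unitDisk, 0 < (f z).re) :
    ∀ z ∈ unitDisk, f z + (starRingEnd ℂ) (f 0) ≠ 0 ∧
      ‖(f z - f 0) / (f z + (starRingEnd ℂ) (f 0))‖ < 1 := by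
  intro z hz
  have h1 := hre z hz
  have h2 := hre 0 (by simp)
  have h3 : f z + (starRingEnd ℂ) (f 0) ≠ 0 := by
    intro h
    have := congrArg Complex.re h
    simp at this
    linarith
  refine ⟨h3, ?_⟩
  have h4 := norm_pos_iff.mpr h3
  rw [norm_div, div_lt_one h4]
  exact lt_of_pow_lt_pow_left₀ 2 h4.le (by rw [norm_sq_add_conj]; nlinarith [mul_pos h1 h2])

theorem cayley_differentiableOn {f : ℂ → ℂ} (hf : DifferentiableOn ℂ f unitDisk)
    (hre : ∀ z ∈ unitDisk, 0 < (f z).re) :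
    DifferentiableOn ℂ (fun z => (f z - f 0) / (f z + (starRingEnd ℂ) (f 0))) unitDisk :=
  (hf.sub_const _).div (hf.add_const _) fun z hz => (cayley_mapsTo hre z hz).1

theorem norm_sub_zero_le_of_re_pos {f : ℂ → ℂ} (hf : DifferentiableOn ℂ f unitDisk)
    (hre : ∀ z ∈ unitDisk, 0 < (f z).re) {z : ℂ} (hz : z ∈ unitDisk) :
    ‖f z - f 0‖ ≤ ‖z‖ * ‖f z + (starRingEnd ℂ) (f 0)‖ := by
  have hm := cayley_mapsTo hre
  have h := Complex.norm_le_norm_of_mapsTo_ball (cayley_differentiableOn hf hre)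
    (fun w hw => by simpa using (hm w hw).2.le) (by simp) (mem_unitDisk.mp hz)
  rwa [norm_div, div_le_iff₀ (norm_pos_iff.mpr (hm z hz).1)] at h

/-- The strict case applied to f + ε, with ε → 0; the shift enters f(z) and conj f(0), which
explains 2ε. -/
theorem norm_sub_zero_le {f : ℂ → ℂ} (hf : DifferentiableOn ℂ f unitDisk)
    (hre : ∀ z ∈ unitDisk, 0 ≤ (f z).re) {z : ℂ} (hz : z ∈ unitDisk) :
    ‖f z - f 0‖ ≤ ‖z‖ * ‖f z + (starRingEnd ℂ) (f 0)‖ := by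
  have key : ∀ ε : ℝ, 0 < ε →
      ‖f z - f 0‖ ≤ ‖z‖ * ‖f z + (starRingEnd ℂ) (f 0) + 2 * (ε : ℂ)‖ := by
    intro ε hε
    have h := norm_sub_zero_le_of_re_pos (f := fun z => f z + (ε : ℂ)) (hf.add_const _)
      (fun w hw => by have := hre w hw; simp; linarith) hz
    simp only [add_sub_add_right_eq_sub, map_add, Complex.conj_ofReal] at h
    convert h using 3
    ring
  have hc : Tendsto (fun ε : ℝ => ‖z‖ * ‖f z + (starRingEnd ℂ) (f 0) + 2 * (ε : ℂ)‖) (𝓝[>] 0)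
      (𝓝 (‖z‖ * ‖f z + (starRingEnd ℂ) (f 0) + 2 * ((0 : ℝ) : ℂ)‖)) := by
    apply tendsto_nhdsWithin_of_tendsto_nhds
    apply Continuous.tendsto (by fun_prop)
  have := ge_of_tendsto hc (eventually_nhdsWithin_of_forall fun ε hε => key ε hε)
  simpa using this

/-- The Schwarz-Pick inequality for functions with nonnegative real part. -/
theorem schwarzPick {f : ℂ → ℂ} (hf : DifferentiableOn ℂ f unitDisk)
    (hre : ∀ z ∈ unitDisk, 0 ≤ (f z).re) {z w : ℂ} (hz : z ∈ unitDisk) (hw : w ∈ unitDisk) :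
    ‖f z - f w‖ * ‖1 - (starRingEnd ℂ) w * z‖ ≤ ‖w - z‖ * ‖f z + (starRingEnd ℂ) (f w)‖ := by
  rw [mem_unitDisk] at hz hw
  have hz' : mob w z ∈ unitDisk := mem_unitDisk.mpr (mob_mem hw hz)
  have h := norm_sub_zero_le (f := f ∘ mob w)
    (hf.comp (differentiableOn_mob hw) (mob_mapsTo hw))
    (fun u hu => hre _ (mob_mapsTo hw hu)) hz'
  simp only [Function.comp, mob_mob hw hz, mob_zero] at h
  have h0 : 0 < ‖1 - (starRingEnd ℂ) w * z‖ :=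
    norm_pos_iff.mpr (one_sub_conj_mul_ne_zero hw hz.le)
  rw [mob, norm_div, div_mul_eq_mul_div, le_div_iff₀ h0] at h
  exact h

/-- Schwarz–Pick squared, with both differences eliminated through the two norm identities. In this
form it passes to the limit as a point tends to the boundary, and it degenerates when Re f(w) = 0.
-/
theorem harnack_sq {f : ℂ → ℂ} (hf : DifferentiableOn ℂ f unitDisk)
    (hre : ∀ z ∈ unitDisk, 0 ≤ (f z).re) {z w : ℂ} (hz : z ∈ unitDisk) (hw : w ∈ unitDisk) :
    (1 - ‖w‖ ^ 2) * (1 - ‖z‖ ^ 2) * ‖f z + (starRingEnd ℂ) (f w)‖ ^ 2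
      ≤ 4 * ((f z).re * (f w).re) * ‖1 - (starRingEnd ℂ) w * z‖ ^ 2 := by
  have h := pow_le_pow_left₀ (by positivity) (schwarzPick hf hre hz hw) 2
  rw [mul_pow, mul_pow] at h
  have h1 := norm_sq_add_conj (f z) (f w)
  have h2 := norm_sq_one_sub_conj_mul w z
  have h3 : ‖f z - f w‖ ^ 2 = ‖f z + (starRingEnd ℂ) (f w)‖ ^ 2 - 4 * ((f z).re * (f w).re) := by
    linarith
  have h4 : ‖w - z‖ ^ 2
      = ‖1 - (starRingEnd ℂ) w * z‖ ^ 2 - (1 - ‖w‖ ^ 2) * (1 - ‖z‖ ^ 2) := by linarith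
  rw [h3, h4] at h
  nlinarith

theorem eqOn_const_of_re_eq_zero {f : ℂ → ℂ} (hf : DifferentiableOn ℂ f unitDisk)
    (hre : ∀ z ∈ unitDisk, 0 ≤ (f z).re) {w : ℂ} (hw : w ∈ unitDisk) (h0 : (f w).re = 0) :
    ∀ z ∈ unitDisk, f z = f w := by
  intro z hz
  have h := harnack_sq hf hre hz hw
  rw [h0, mul_zero, mul_zero, zero_mul] at h
  rw [mem_unitDisk] at hz hw
  have h1 : 0 < (1 - ‖w‖ ^ 2) * (1 - ‖z‖ ^ 2) := by
    apply mul_pos <;> nlinarith [norm_nonneg w, norm_nonneg z]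
  have h2 : ‖f z + (starRingEnd ℂ) (f w)‖ ^ 2 ≤ 0 := by
    by_contra hc
    push Not at hc
    nlinarith [mul_pos h1 hc]
  have h3 := norm_sq_add_conj (f z) (f w)
  rw [h0] at h3
  have h4 : ‖f z - f w‖ = 0 := by
    have : ‖f z - f w‖ ^ 2 ≤ 0 := by linarith
    exact pow_eq_zero_iff two_ne_zero |>.mp (le_antisymm this (sq_nonneg _))
  exact sub_eq_zero.mp (norm_eq_zero.mp h4)

/-! ### The extremal kernels -/

/-- The function with value `L` at `0` that maps the disk onto a half-plane or a disk, according to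
`κ`. -/
noncomputable def herglotz (L κ z : ℂ) : ℂ :=
  (1 + κ * z) / (1 - κ * z) * (L.re : ℂ) + I * (L.im : ℂ)

/-- The extremal case of the Schwarz lemma for functions with nonnegative real part. -/
theorem exists_eqOn_herglotz {f : ℂ → ℂ} (hf : DifferentiableOn ℂ f unitDisk)
    (hre : ∀ z ∈ unitDisk, 0 ≤ (f z).re) {τ : ℂ} (hτ : τ ∈ unitDisk) (hτ0 : τ ≠ 0)
    (hpos : 0 < (f 0).re)
    (heq : ‖f τ - f 0‖ = ‖τ‖ * ‖f τ + (starRingEnd ℂ) (f 0)‖) :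
    ∃ κ : ℂ, ‖κ‖ = 1 ∧ EqOn f (herglotz (f 0) κ) unitDisk := by
  have hre' : ∀ z ∈ unitDisk, 0 < (f z).re := by
    intro z hz
    refine lt_of_le_of_ne (hre z hz) fun h => ?_
    have := eqOn_const_of_re_eq_zero hf hre hz h.symm 0 (by simp)
    rw [this, ← h] at hpos
    exact lt_irrefl _ hpos
  have hm := cayley_mapsTo hre'
  set g : ℂ → ℂ := fun z => (f z - f 0) / (f z + (starRingEnd ℂ) (f 0)) with hg
  have hg0 : g 0 = 0 := by simp [hg]
  -- The hypothesis says that |g(τ)/τ| = 1 for the Cayley transform g of f, so the rigid case of the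
  -- Schwarz lemma gives g(z) = κz. It remains to solve for f.
  obtain ⟨κ, hκ, hE⟩ := Complex.affine_of_mapsTo_ball_of_exists_norm_dslope_eq_div'
    (f := g) (c := 0) (R₁ := 1) (R₂ := 1)
    (cayley_differentiableOn hf hre') (fun w hw => by rw [hg0, mem_closedBall_zero_iff]; exact (hm w hw).2.le)
    ⟨τ, hτ, by
      rw [dslope_of_ne _ hτ0, slope_def_field, hg0, sub_zero, sub_zero, norm_div, norm_div, heq,
        mul_div_cancel_right₀ _ (norm_ne_zero_iff.mpr (hm τ hτ).1),
        div_self (norm_ne_zero_iff.mpr hτ0), div_one]⟩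
  rw [div_one] at hκ
  refine ⟨κ, hκ, fun z hz => ?_⟩
  have h1 := hE hz
  rw [hg0] at h1
  simp only [hg, sub_zero, zero_add, smul_eq_mul] at h1
  rw [div_eq_iff (hm z hz).1] at h1
  have h2 : 1 - κ * z ≠ 0 := by
    intro h
    have h3 : ‖κ * z‖ = 1 := by rw [(sub_eq_zero.mp h).symm]; simp
    rw [norm_mul, hκ, one_mul] at h3
    exact absurd h3 (mem_unitDisk.mp hz).ne
  have h4 : (starRingEnd ℂ) (f 0) = (f 0).re - I * (f 0).im := by
    apply Complex.ext <;> simp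
  have h5 : f 0 = (f 0).re + I * (f 0).im := by
    apply Complex.ext <;> simp
  rw [herglotz, div_mul_eq_mul_div, div_add' _ _ _ h2, eq_div_iff h2]
  rw [h4] at h1
  linear_combination h1 + h5

/-- A circle of Apollonius: the differences of the squares of the two sides in the two descriptions
are proportional, with factor 1 - r² > 0. So inequality and equality correspond simultaneously. -/
theorem norm_sub_le_iff_disk {x y r : ℝ} (hr0 : 0 ≤ r) (hr : r < 1) (hx : 0 ≤ x) (L u : ℂ)
    (hLx : L.re = x) (hLy : L.im = y) :
    (‖u - L‖ ≤ r * ‖u + (starRingEnd ℂ) L‖ ↔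
      ‖u - (((1 + r ^ 2) / (1 - r ^ 2) * x : ℝ) + I * (y : ℂ))‖ ≤ 2 * r / (1 - r ^ 2) * x) ∧
    (‖u - L‖ = r * ‖u + (starRingEnd ℂ) L‖ ↔
      ‖u - (((1 + r ^ 2) / (1 - r ^ 2) * x : ℝ) + I * (y : ℂ))‖ = 2 * r / (1 - r ^ 2) * x) := by
  have hD : 0 < 1 - r ^ 2 := by nlinarith
  have e : (1 - r ^ 2) * (‖u - (((1 + r ^ 2) / (1 - r ^ 2) * x : ℝ) + I * (y : ℂ))‖ ^ 2
      - (2 * r / (1 - r ^ 2) * x) ^ 2) = ‖u - L‖ ^ 2 - (r * ‖u + (starRingEnd ℂ) L‖) ^ 2 := by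
    rw [mul_pow r]
    simp only [← Complex.normSq_eq_norm_sq, Complex.normSq_apply]
    simp only [sub_re, sub_im, add_re, add_im, conj_re, conj_im, ofReal_re, ofReal_im, mul_re,
      mul_im, I_re, I_im, hLx, hLy]
    field_simp
    ring
  have p1 : 0 ≤ 2 * r / (1 - r ^ 2) * x := by positivity
  have p2 : 0 ≤ r * ‖u + (starRingEnd ℂ) L‖ := by positivity
  constructor
  · rw [← pow_le_pow_iff_left₀ (norm_nonneg _) p2 two_ne_zero,
      ← pow_le_pow_iff_left₀ (norm_nonneg _) p1 two_ne_zero, ← sub_nonpos, ← e,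
      ← sub_nonpos (b := _ ^ 2)]
    constructor
    · intro h; by_contra hc; push Not at hc; nlinarith [mul_pos hD hc]
    · intro h; exact mul_nonpos_of_nonneg_of_nonpos hD.le h
  · rw [← pow_left_inj₀ (norm_nonneg _) p2 two_ne_zero,
      ← pow_left_inj₀ (norm_nonneg _) p1 two_ne_zero, ← sub_eq_zero, ← e,
      ← sub_eq_zero (b := (2 * r / (1 - r ^ 2) * x) ^ 2), mul_eq_zero]
    simp [hD.ne']

theorem one_sub_mul_ne_zero {κ z : ℂ} (hκ : ‖κ‖ ≤ 1) (hz : z ∈ unitDisk) : 1 - κ * z ≠ 0 := by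
  intro h
  have h3 : ‖κ * z‖ = 1 := by rw [(sub_eq_zero.mp h).symm]; simp
  rw [norm_mul] at h3
  have := mem_unitDisk.mp hz
  nlinarith [norm_nonneg κ, norm_nonneg z]

theorem cayley_re (u : ℂ) :
    ((1 + u) / (1 - u)).re = (1 - ‖u‖ ^ 2) / ‖1 - u‖ ^ 2 := by
  simp only [← Complex.normSq_eq_norm_sq, Complex.div_re]
  rw [← add_div]
  congr 1
  simp [Complex.normSq_apply]
  ring

theorem herglotz_re (L κ z : ℂ) :
    (herglotz L κ z).re = (1 - ‖κ * z‖ ^ 2) / ‖1 - κ * z‖ ^ 2 * L.re := by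
  rw [herglotz, add_re, re_mul_ofReal, cayley_re]
  simp

theorem herglotz_re_nonneg {L κ z : ℂ} (hL : 0 ≤ L.re) (hκ : ‖κ‖ ≤ 1) (hz : z ∈ unitDisk) :
    0 ≤ (herglotz L κ z).re := by
  rw [herglotz_re]
  have h1 : ‖κ * z‖ ≤ 1 := by
    rw [norm_mul]
    have := mem_unitDisk.mp hz
    nlinarith [norm_nonneg κ, norm_nonneg z]
  have : 0 ≤ 1 - ‖κ * z‖ ^ 2 := by nlinarith [norm_nonneg (κ * z)]
  positivity

theorem differentiableOn_herglotz (L : ℂ) {κ : ℂ} (hκ : ‖κ‖ ≤ 1) :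
    DifferentiableOn ℂ (herglotz L κ) unitDisk := by
  unfold herglotz
  refine DifferentiableOn.add_const _ (DifferentiableOn.mul_const ?_ _)
  exact DifferentiableOn.div (by fun_prop) (by fun_prop) fun z hz => one_sub_mul_ne_zero hκ hz

@[simp] theorem herglotz_zero (L κ : ℂ) : herglotz L κ 0 = L := by
  apply Complex.ext <;> simp [herglotz]

/-- The Cayley transform of `herglotz L κ` based at L is z ↦ κz, here freed of its denominator. -/
theorem herglotz_sub {L κ z : ℂ} (h : 1 - κ * z ≠ 0) :
    herglotz L κ z - L = κ * z * (herglotz L κ z + (starRingEnd ℂ) L) := by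
  have h4 : (starRingEnd ℂ) L = L.re - I * L.im := by apply Complex.ext <;> simp
  have h5 : L = L.re + I * L.im := by apply Complex.ext <;> simp
  have h6 : (1 - κ * z) * herglotz L κ z = (1 + κ * z) * L.re + (1 - κ * z) * (I * L.im) := by
    rw [herglotz, mul_add, ← mul_assoc, mul_div_cancel₀ _ h]
  rw [h4]
  linear_combination h6 - h5

/-- Every value permitted by the Schwarz lemma is attained by a function `herglotz L κ`. -/
theorem exists_herglotz_eq {L u τ : ℂ} (hL : 0 ≤ L.re) (hτ : τ ∈ unitDisk) (hτ0 : τ ≠ 0)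
    (hu : ‖u - L‖ ≤ ‖τ‖ * ‖u + (starRingEnd ℂ) L‖) :
    ∃ κ : ℂ, ‖κ‖ ≤ 1 ∧ herglotz L κ τ = u := by
  have hτ1 := mem_unitDisk.mp hτ
  -- In the degenerate case u = L and Re L = 0, so any κ would do. Otherwise κ is read off from κτ =
  -- (u - L)/(u + conj L).
  by_cases h0 : u + (starRingEnd ℂ) L = 0
  · rw [h0, norm_zero, mul_zero, norm_le_zero_iff, sub_eq_zero] at hu
    refine ⟨0, by simp, ?_⟩
    rw [hu] at h0 ⊢
    have := congrArg Complex.re h0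
    simp at this
    apply Complex.ext <;> simp [herglotz]
  · have hκ : ‖(u - L) / (τ * (u + (starRingEnd ℂ) L))‖ ≤ 1 := by
      rw [norm_div, norm_mul]
      exact div_le_one_of_le₀ hu (by positivity)
    refine ⟨_, hκ, ?_⟩
    have h1 := herglotz_sub (L := L) (one_sub_mul_ne_zero hκ hτ)
    have h2 : (u - L) / (τ * (u + (starRingEnd ℂ) L)) * τ = (u - L) / (u + (starRingEnd ℂ) L) := by
      field_simp
    rw [h2] at h1
    set v := herglotz L ((u - L) / (τ * (u + (starRingEnd ℂ) L))) τ
    have h3 : (v - L) * (u + (starRingEnd ℂ) L) = (u - L) * (v + (starRingEnd ℂ) L) := by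
      rw [h1]; field_simp
    -- Equal Cayley transforms give v = u unless Re L = 0; but then conj L = -L, and the hypothesis
    -- becomes |u - L| ≤ |τ| |u - L| with u ≠ L, contradicting |τ| < 1.
    have h4 : (v - u) * ((2 * L.re : ℝ) : ℂ) = 0 := by
      have h5 : ((2 * L.re : ℝ) : ℂ) = L + (starRingEnd ℂ) L := by rw [Complex.add_conj]
      rw [h5]
      linear_combination h3
    rcases mul_eq_zero.mp h4 with h | h
    · exact sub_eq_zero.mp h
    · have hre : L.re = 0 := by
        have : 2 * L.re = 0 := by exact_mod_cast h
        linarith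
      exfalso
      have h6 : (starRingEnd ℂ) L = -L := by apply Complex.ext <;> simp [hre]
      rw [h6, ← sub_eq_add_neg] at hu h0
      have := norm_pos_iff.mpr h0
      nlinarith

/-! ### The Poisson kernel and Julia's lemma -/

theorem norm_one_sub_conj_mul_of_norm_one {σ : ℂ} (hσ : ‖σ‖ = 1) (z : ℂ) :
    ‖1 - (starRingEnd ℂ) σ * z‖ = ‖σ - z‖ := by
  have := norm_sq_one_sub_conj_mul σ z
  rw [hσ] at this
  exact (pow_left_inj₀ (norm_nonneg _) (norm_nonneg _) two_ne_zero).mp (by linarith)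

theorem ne_of_norm_one {σ z : ℂ} (hσ : ‖σ‖ = 1) (hz : z ∈ unitDisk) : σ - z ≠ 0 := by
  intro h
  rw [sub_eq_zero] at h
  rw [← h, mem_unitDisk, hσ] at hz
  exact lt_irrefl _ hz

theorem conj_mul_self_of_norm_one {σ : ℂ} (hσ : ‖σ‖ = 1) : (starRingEnd ℂ) σ * σ = 1 := by
  rw [mul_comm, Complex.mul_conj, Complex.normSq_eq_norm_sq, hσ]; simp

theorem poisson_eq {σ : ℂ} (hσ : ‖σ‖ = 1) (z : ℂ) :
    (σ + z) / (σ - z) = (1 + (starRingEnd ℂ) σ * z) / (1 - (starRingEnd ℂ) σ * z) := by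
  have h := conj_mul_self_of_norm_one hσ
  have hc : (starRingEnd ℂ) σ ≠ 0 := left_ne_zero_of_mul_eq_one h
  rw [← mul_div_mul_left _ _ hc, mul_add, mul_sub, h]

theorem poisson_re {σ : ℂ} (hσ : ‖σ‖ = 1) (z : ℂ) :
    ((σ + z) / (σ - z)).re = (1 - ‖z‖ ^ 2) / ‖σ - z‖ ^ 2 := by
  rw [poisson_eq hσ, cayley_re, norm_one_sub_conj_mul_of_norm_one hσ, norm_mul, RCLike.norm_conj,
    hσ, one_mul]

theorem poisson_re_pos {σ z : ℂ} (hσ : ‖σ‖ = 1) (hz : z ∈ unitDisk) :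
    0 < ((σ + z) / (σ - z)).re := by
  rw [poisson_re hσ]
  have := norm_pos_iff.mpr (ne_of_norm_one hσ hz)
  have := mem_unitDisk.mp hz
  have : 0 < 1 - ‖z‖ ^ 2 := by nlinarith [norm_nonneg z]
  positivity

/-- Julia's lemma for functions with nonnegative real part. -/
theorem julia {f : ℂ → ℂ} (hf : DifferentiableOn ℂ f unitDisk)
    (hre : ∀ z ∈ unitDisk, 0 ≤ (f z).re) {σ : ℂ} (hσ : ‖σ‖ = 1) {β : ℝ} (hβ : 0 < β)
    (hlim : Tendsto (fun r : ℝ => ((1 - r : ℝ) : ℂ) * f (r * σ)) (𝓝[<] 1) (𝓝 (β : ℂ)))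
    {z : ℂ} (hz : z ∈ unitDisk) :
    0 ≤ (f z - ((β / 2 : ℝ) : ℂ) * ((σ + z) / (σ - z))).re := by
  have hev : ∀ᶠ r : ℝ in 𝓝[<] 1, r ∈ Ioo (0 : ℝ) 1 := Ioo_mem_nhdsLT one_pos
  have hid : Tendsto (fun r : ℝ => r) (𝓝[<] 1) (𝓝 1) := tendsto_nhdsWithin_of_tendsto_nhds tendsto_id
  have hz1 := mem_unitDisk.mp hz
  -- This is `harnack_sq` at w = rσ multiplied by 1 - r, so that f(rσ) occurs only with the factor 1
  -- - r. The limit reads 2(1 - |z|²)β² ≤ 4β Re f(z) |σ - z|², whence the mass β/2.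
  have key : ∀ᶠ r : ℝ in 𝓝[<] 1,
      (1 + r) * (1 - ‖z‖ ^ 2) *
        ‖((1 - r : ℝ) : ℂ) * f z + (starRingEnd ℂ) (((1 - r : ℝ) : ℂ) * f (r * σ))‖ ^ 2 ≤
      4 * ((f z).re * (((1 - r : ℝ) : ℂ) * f (r * σ)).re) *
        ‖1 - (starRingEnd ℂ) (r * σ) * z‖ ^ 2 := by
    filter_upwards [hev] with r hr
    have hn : ‖(r : ℂ) * σ‖ = r := by rw [norm_mul, hσ, mul_one, Complex.norm_of_nonneg hr.1.le]
    have hw : (r : ℂ) * σ ∈ unitDisk := by rw [mem_unitDisk, hn]; exact hr.2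
    have h := harnack_sq hf hre hz hw
    rw [hn] at h
    have h1 : 0 < 1 - r := by linarith [hr.2]
    rw [map_mul, Complex.conj_ofReal, ← mul_add, norm_mul, Complex.norm_of_nonneg h1.le,
      re_ofReal_mul]
    have := mul_le_mul_of_nonneg_left h h1.le
    nlinarith
  have l1 : Tendsto (fun r : ℝ => (1 + r) * (1 - ‖z‖ ^ 2) *
        ‖((1 - r : ℝ) : ℂ) * f z + (starRingEnd ℂ) (((1 - r : ℝ) : ℂ) * f (r * σ))‖ ^ 2) (𝓝[<] 1)
      (𝓝 ((1 + 1) * (1 - ‖z‖ ^ 2) *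
        ‖((1 - 1 : ℝ) : ℂ) * f z + (starRingEnd ℂ) (β : ℂ)‖ ^ 2)) := by
    refine ((hid.const_add 1).mul_const _).mul ((Tendsto.norm ?_).pow 2)
    refine Tendsto.add (Tendsto.mul_const _ ?_) ?_
    · exact (Complex.continuous_ofReal.tendsto _).comp (hid.const_sub 1)
    · exact (Complex.continuous_conj.tendsto _).comp hlim
  have l2 : Tendsto (fun r : ℝ => 4 * ((f z).re * (((1 - r : ℝ) : ℂ) * f (r * σ)).re) *
        ‖1 - (starRingEnd ℂ) (r * σ) * z‖ ^ 2) (𝓝[<] 1)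
      (𝓝 (4 * ((f z).re * (β : ℂ).re) * ‖1 - (starRingEnd ℂ) (((1 : ℝ) : ℂ) * σ) * z‖ ^ 2)) := by
    refine Tendsto.mul (Tendsto.const_mul _ (Tendsto.const_mul _ ?_)) ?_
    · exact (Complex.continuous_re.tendsto _).comp hlim
    · refine tendsto_nhdsWithin_of_tendsto_nhds (Continuous.tendsto ?_ (1 : ℝ))
      fun_prop
  have h := le_of_tendsto_of_tendsto l1 l2 key
  simp only [sub_self, ofReal_zero, zero_mul, zero_add, conj_ofReal, ofReal_one, one_mul,
    ofReal_re, norm_one_sub_conj_mul_of_norm_one hσ, Complex.norm_of_nonneg hβ.le] at h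
  have hp : 0 < ‖σ - z‖ := norm_pos_iff.mpr (ne_of_norm_one hσ hz)
  rw [sub_re, re_ofReal_mul, poisson_re hσ, sub_nonneg, mul_div_assoc', div_le_iff₀ (by positivity)]
  have h' : β * ((1 - ‖z‖ ^ 2) * β) ≤ β * (2 * ((f z).re * ‖σ - z‖ ^ 2)) := by nlinarith
  have := le_of_mul_le_mul_left h' hβ
  linarith

/-! ### Linearization along solutions of differential equations -/

/-- A barrier argument. Where the curve touches the majorant, `h1` makes the linearization
applicable and `h2` gives C|v| < 1, so |v'| < (M + 1)|v| and the majorant is not crossed. The 1 in M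
+ 1 absorbs the quadratic error. -/
theorem norm_le_mul_exp_of_linearized {v v' a : ℝ → ℂ} {T M C δ : ℝ} (hC : 0 ≤ C)
    (hM : ∀ t ∈ Icc 0 T, ‖a t‖ ≤ M)
    (hv : ∀ t ∈ Icc 0 T, HasDerivWithinAt v (v' t) (Icc 0 T) t)
    (hlin : ∀ t ∈ Icc 0 T, ‖v t‖ ≤ δ → ‖v' t - a t * v t‖ ≤ C * ‖v t‖ ^ 2)
    (hpos : 0 < ‖v 0‖) (hM0 : 0 ≤ M)
    (h1 : ‖v 0‖ * Real.exp ((M + 1) * T) ≤ δ)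
    (h2 : C * (‖v 0‖ * Real.exp ((M + 1) * T)) < 1) :
    ∀ t ∈ Icc 0 T, ‖v t‖ ≤ ‖v 0‖ * Real.exp ((M + 1) * t) := by
  have hB : ∀ x : ℝ, HasDerivAt (fun t : ℝ => ‖v 0‖ * Real.exp ((M + 1) * t))
      ((M + 1) * (‖v 0‖ * Real.exp ((M + 1) * x))) x := by
    intro x
    have := (((hasDerivAt_id x).const_mul (M + 1)).exp).const_mul ‖v 0‖
    refine this.congr_deriv ?_
    simp only [id]
    ring
  refine image_norm_le_of_norm_deriv_right_lt_deriv_boundary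
    (fun t ht => (hv t ht).continuousWithinAt)
    (fun t ht => (hv t (Ico_subset_Icc_self ht)).mono_of_mem_nhdsWithin (Icc_mem_nhdsGE_of_mem ht))
    (by simp) hB ?_
  intro t ht heq
  have ht' := Ico_subset_Icc_self ht
  have hle : ‖v t‖ ≤ ‖v 0‖ * Real.exp ((M + 1) * T) := by
    rw [heq]
    gcongr
    exact ht'.2
  have hvpos : 0 < ‖v t‖ := by rw [heq]; positivity
  have h3 := hlin t ht' (hle.trans h1)
  have h4 : ‖v' t‖ ≤ ‖v' t - a t * v t‖ + ‖a t‖ * ‖v t‖ := by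
    rw [← norm_mul]; exact norm_le_norm_sub_add _ _
  have h5 : ‖a t‖ * ‖v t‖ ≤ M * ‖v t‖ := by gcongr; exact hM t ht'
  have h6 : C * ‖v t‖ < 1 := lt_of_le_of_lt (by gcongr) h2
  rw [← heq]
  nlinarith

/-- With the integrating factor exp(-A), the derivative of exp(-A) v is exp(-A)(v' - av), quadratic
in v(0); dividing by v(0) leaves a linear error. -/
theorem norm_div_sub_exp_le {v v' a A : ℝ → ℂ} {T M C δ : ℝ} (hT : 0 ≤ T) (hC : 0 ≤ C)
    (hA : ∀ t ∈ Icc 0 T, HasDerivWithinAt A (a t) (Icc 0 T) t) (hA0 : A 0 = 0)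
    (hM : ∀ t ∈ Icc 0 T, ‖a t‖ ≤ M)
    (hv : ∀ t ∈ Icc 0 T, HasDerivWithinAt v (v' t) (Icc 0 T) t)
    (hlin : ∀ t ∈ Icc 0 T, ‖v t‖ ≤ δ → ‖v' t - a t * v t‖ ≤ C * ‖v t‖ ^ 2)
    (hne : v 0 ≠ 0) (hM0 : 0 ≤ M)
    (h1 : ‖v 0‖ * Real.exp ((M + 1) * T) ≤ δ)
    (h2 : C * (‖v 0‖ * Real.exp ((M + 1) * T)) < 1) :
    ‖v T / v 0 - exp (A T)‖ ≤
      (Real.exp (M * T) ^ 2 * C * Real.exp ((M + 1) * T) ^ 2 * T) * ‖v 0‖ := by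
  have hpos := norm_pos_iff.mpr hne
  have hb := norm_le_mul_exp_of_linearized hC hM hv hlin hpos hM0 h1 h2
  have hb' : ∀ t ∈ Icc 0 T, ‖v t‖ ≤ ‖v 0‖ * Real.exp ((M + 1) * T) := by
    intro t ht
    refine (hb t ht).trans ?_
    gcongr
    exact ht.2
  have hAn : ∀ t ∈ Icc 0 T, ‖A t‖ ≤ M * T := by
    intro t ht
    have := norm_image_sub_le_of_norm_deriv_le_segment' hA
      (fun x hx => hM x (Ico_subset_Icc_self hx)) t ht
    rw [hA0, sub_zero, sub_zero] at this
    exact this.trans (by gcongr; exact ht.2)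
  have hE : ∀ t ∈ Icc 0 T, HasDerivWithinAt (fun s => exp (-A s) * v s)
      (exp (-A t) * (v' t - a t * v t)) (Icc 0 T) t := by
    intro t ht
    have := ((hA t ht).neg.cexp).mul (hv t ht)
    refine this.congr_deriv ?_
    simp only [Pi.neg_apply]
    ring
  have hEb : ∀ t ∈ Ico 0 T, ‖exp (-A t) * (v' t - a t * v t)‖ ≤
      Real.exp (M * T) * (C * (‖v 0‖ * Real.exp ((M + 1) * T)) ^ 2) := by
    intro t ht
    have ht' := Ico_subset_Icc_self ht
    rw [norm_mul]
    gcongr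
    · exact (Complex.norm_exp_le_exp_norm _).trans
        (Real.exp_le_exp.mpr (by rw [norm_neg]; exact hAn t ht'))
    · refine (hlin t ht' ((hb' t ht').trans h1)).trans ?_
      gcongr
      exact hb' t ht'
  have hfin := norm_image_sub_le_of_norm_deriv_le_segment' hE hEb T (right_mem_Icc.mpr hT)
  simp only [hA0, neg_zero, exp_zero, one_mul, sub_zero] at hfin
  have hid : v T / v 0 - exp (A T) = exp (A T) * (exp (-A T) * v T - v 0) / v 0 := by
    rw [mul_sub, ← mul_assoc, ← exp_add, add_neg_cancel, exp_zero, one_mul, sub_div,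
      mul_div_cancel_right₀ _ hne]
  rw [hid, norm_div, norm_mul, div_le_iff₀ hpos]
  have hA' : ‖exp (A T)‖ ≤ Real.exp (M * T) :=
    (Complex.norm_exp_le_exp_norm _).trans (Real.exp_le_exp.mpr (hAn T (right_mem_Icc.mpr hT)))
  calc _ ≤ Real.exp (M * T) *
      (Real.exp (M * T) * (C * (‖v 0‖ * Real.exp ((M + 1) * T)) ^ 2) * T) := by gcongr
    _ = _ := by ring

/-- If the curves `v i` satisfy `v' = a v + O(v²)` and `v i 0 → 0`, then `v i T / v i 0` tends to the
value at time `T` of the solution of the linearized equation. -/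
theorem tendsto_div_of_linearized {ι : Type*} {l : Filter ι} {v v' : ι → ℝ → ℂ} {a A : ℝ → ℂ}
    {T M C δ : ℝ} (hT : 0 ≤ T) (hδ : 0 < δ)
    (hA : ∀ t ∈ Icc 0 T, HasDerivWithinAt A (a t) (Icc 0 T) t) (hA0 : A 0 = 0)
    (hM : ∀ t ∈ Icc 0 T, ‖a t‖ ≤ M)
    (hv : ∀ᶠ i in l, v i 0 ≠ 0 ∧ ∀ t ∈ Icc 0 T, HasDerivWithinAt (v i) (v' i t) (Icc 0 T) t ∧
      (‖v i t‖ ≤ δ → ‖v' i t - a t * v i t‖ ≤ C * ‖v i t‖ ^ 2))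
    (h0 : Tendsto (fun i => v i 0) l (𝓝 0)) :
    Tendsto (fun i => v i T / v i 0) l (𝓝 (exp (A T))) := by
  have hM0 : 0 ≤ M := (norm_nonneg _).trans (hM 0 (left_mem_Icc.mpr hT))
  have hn : Tendsto (fun i => ‖v i 0‖) l (𝓝 0) := by simpa using h0.norm
  have e1 : ∀ᶠ i in l, ‖v i 0‖ * Real.exp ((M + 1) * T) < δ := by
    have := hn.mul_const (Real.exp ((M + 1) * T))
    rw [zero_mul] at this
    exact this.eventually_lt_const hδ
  have e2 : ∀ᶠ i in l, |C| * (‖v i 0‖ * Real.exp ((M + 1) * T)) < 1 := by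
    have := (hn.mul_const (Real.exp ((M + 1) * T))).const_mul |C|
    rw [zero_mul, mul_zero] at this
    exact this.eventually_lt_const one_pos
  rw [tendsto_iff_norm_sub_tendsto_zero]
  have hlim := hn.const_mul (Real.exp (M * T) ^ 2 * |C| * Real.exp ((M + 1) * T) ^ 2 * T)
  rw [mul_zero] at hlim
  refine squeeze_zero' (Eventually.of_forall fun i => norm_nonneg _) ?_ hlim
  filter_upwards [hv, e1, e2] with i hi h1 h2
  refine norm_div_sub_exp_le hT (abs_nonneg C) hA hA0 hM (fun t ht => (hi.2 t ht).1)
    (fun t ht hle => ((hi.2 t ht).2 hle).trans ?_) hi.1 hM0 h1.le h2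
  gcongr
  exact le_abs_self C

/-! ### The flow of a dissipative holomorphic vector field -/

theorem norm_le_of_dissipative {F : ℂ → ℂ} {x : ℝ → ℂ} {T : ℝ}
    (hF : ∀ w, ((starRingEnd ℂ) w * F w).re ≤ 0)
    (hx : ∀ t ∈ Icc 0 T, HasDerivWithinAt x (F (x t)) (Icc 0 T) t) :
    ∀ t ∈ Icc 0 T, ‖x t‖ ≤ ‖x 0‖ := by
  intro t ht
  have hT : 0 ≤ T := ht.1.trans ht.2
  have hd : ∀ s ∈ Icc 0 T, HasDerivWithinAt (fun s => ‖x s‖ ^ 2)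
      (2 * ((starRingEnd ℂ) (x s) * F (x s)).re) (Icc 0 T) s := by
    intro s hs
    have := (hx s hs).norm_sq
    refine this.congr_deriv ?_
    rw [Complex.inner, mul_comm (F (x s))]
  have hanti : AntitoneOn (fun s => ‖x s‖ ^ 2) (Icc 0 T) := by
    refine antitoneOn_of_deriv_nonpos (convex_Icc 0 T) (fun s hs => (hd s hs).continuousWithinAt)
      (fun s hs => ?_) fun s hs => ?_
    · exact ((hd s (interior_subset hs)).mono interior_subset).differentiableWithinAt
    · rw [interior_Icc] at hs
      rw [((hd s (Ioo_subset_Icc_self hs)).hasDerivAt (Icc_mem_nhds hs.1 hs.2)).deriv]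
      linarith [hF (x s)]
  have := hanti (left_mem_Icc.mpr hT) ht ht.1
  exact (pow_le_pow_iff_left₀ (norm_nonneg _) (norm_nonneg _) two_ne_zero).mp this

/-- The field is multiplied by a bump function, which makes it globally Lipschitz and, being
nonnegative, keeps it dissipative. The solution therefore stays in |x| ≤ |w₀|, where the bump is 1,
and solves the original equation. -/
theorem exists_solution_Icc {F : ℂ → ℂ} (hF : DifferentiableOn ℂ F unitDisk)
    (hdis : ∀ w ∈ unitDisk, ((starRingEnd ℂ) w * F w).re ≤ 0) {w₀ : ℂ} (hw : w₀ ∈ unitDisk)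
    {T : ℝ} (hT : 0 ≤ T) :
    ∃ x : ℝ → ℂ, x 0 = w₀ ∧ ∀ t ∈ Icc 0 T, ‖x t‖ ≤ ‖w₀‖ ∧
      HasDerivWithinAt x (F (x t)) (Icc 0 T) t := by
  have hr := mem_unitDisk.mp hw
  have hr0 := norm_nonneg w₀
  -- The two radii divide the interval from |w₀| to 1 into thirds.
  let f : ContDiffBump (0 : ℂ) := ⟨(2 * ‖w₀‖ + 1) / 3, (‖w₀‖ + 2) / 3, by positivity, by linarith⟩
  let H : ℂ → ℂ := fun w => f w • F w
  have hts : tsupport (f : ℂ → ℝ) ⊆ unitDisk := by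
    rw [f.tsupport_eq]
    exact Metric.closedBall_subset_ball (by change (‖w₀‖ + 2) / 3 < 1; linarith)
  have hHs : tsupport H ⊆ unitDisk := (tsupport_smul_subset_left _ _).trans hts
  have hHc : HasCompactSupport H := f.hasCompactSupport.smul_right
  have hH1 : ContDiff ℝ 1 H := by
    refine contDiff_iff_contDiffAt.mpr fun w => ?_
    by_cases hw : w ∈ tsupport H
    swap
    · exact contDiffAt_const.congr_of_eventuallyEq (notMem_tsupport_iff_eventuallyEq.mp hw)
    have h1 : ContDiffAt ℂ 1 F w :=
      (hF.analyticAt (isOpen_unitDisk.mem_nhds (hHs hw))).contDiffAt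
    exact f.contDiff.contDiffAt.smul (h1.restrict_scalars ℝ)
  obtain ⟨K, hK⟩ := hH1.lipschitzWith_of_hasCompactSupport hHc one_ne_zero
  obtain ⟨L, hL⟩ := hHc.exists_bound_of_continuous hH1.continuous
  have hL0 : 0 ≤ L := (norm_nonneg _).trans (hL 0)
  have hpl : IsPicardLindelof (fun _ => H) (tmin := 0) (tmax := T) ⟨0, left_mem_Icc.mpr hT⟩ w₀
      ⟨L * T, by positivity⟩ 0 ⟨L, hL0⟩ K := by
    refine IsPicardLindelof.of_time_independent (fun x _ => hL x) hK.lipschitzOnWith ?_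
    change L * max (T - 0) (0 - 0) ≤ L * T - 0
    simp [hT]
  obtain ⟨x, hx0, hx⟩ := hpl.exists_eq_forall_mem_Icc_hasDerivWithinAt₀
  have hHdis : ∀ w, ((starRingEnd ℂ) w * H w).re ≤ 0 := by
    intro w
    simp only [H]
    by_cases hw : w ∈ unitDisk
    · rw [mul_smul_comm, Complex.smul_re]
      exact mul_nonpos_of_nonneg_of_nonpos f.nonneg (hdis w hw)
    · have : f w = 0 := by
        by_contra h
        exact hw (hts (subset_tsupport _ h))
      simp [this]
  have hb := norm_le_of_dissipative hHdis hx
  simp only at hx0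
  rw [hx0] at hb
  refine ⟨x, hx0, fun t ht => ⟨hb t ht, ?_⟩⟩
  have h1 : f (x t) = 1 := by
    apply f.one_of_mem_closedBall
    rw [mem_closedBall_zero_iff]
    change ‖x t‖ ≤ (2 * ‖w₀‖ + 1) / 3
    linarith [hb t ht]
  have := hx t ht
  simp only [H, h1, one_smul] at this
  exact this

theorem exists_lipschitzOnWith {F : ℂ → ℂ} (hF : DifferentiableOn ℂ F unitDisk) {r : ℝ}
    (hr : r < 1) : ∃ K : NNReal, LipschitzOnWith K F (Metric.closedBall 0 r) := by
  have hsub : Metric.closedBall (0 : ℂ) r ⊆ unitDisk := Metric.closedBall_subset_ball hr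
  obtain ⟨K, hK⟩ := (isCompact_closedBall (0 : ℂ) r).exists_bound_of_continuousOn
    ((hF.deriv isOpen_unitDisk).continuousOn.mono hsub)
  refine ⟨K.toNNReal, Convex.lipschitzOnWith_of_nnnorm_deriv_le
    (fun w hw => hF.differentiableAt (isOpen_unitDisk.mem_nhds (hsub hw))) (fun w hw => ?_)
    (convex_closedBall 0 r)⟩
  rw [← NNReal.coe_le_coe, coe_nnnorm]
  exact (hK w hw).trans (Real.le_coe_toNNReal K)

theorem solution_unique {F : ℂ → ℂ} (hF : DifferentiableOn ℂ F unitDisk) {x y : ℝ → ℂ} {T r : ℝ}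
    (hr : r < 1)
    (hx : ∀ t ∈ Icc 0 T, ‖x t‖ ≤ r ∧ HasDerivWithinAt x (F (x t)) (Icc 0 T) t)
    (hy : ∀ t ∈ Icc 0 T, ‖y t‖ ≤ r ∧ HasDerivWithinAt y (F (y t)) (Icc 0 T) t)
    (h0 : x 0 = y 0) : EqOn x y (Icc 0 T) := by
  obtain ⟨K, hK⟩ := exists_lipschitzOnWith hF hr
  have key : ∀ z : ℝ → ℂ,
      (∀ t ∈ Icc 0 T, ‖z t‖ ≤ r ∧ HasDerivWithinAt z (F (z t)) (Icc 0 T) t) →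
      ∀ t ∈ Ico 0 T, HasDerivWithinAt z (F (z t)) (Ici t) t := fun z hz t ht =>
    (hz t (Ico_subset_Icc_self ht)).2.mono_of_mem_nhdsWithin (Icc_mem_nhdsGE_of_mem ht)
  exact ODE_solution_unique_of_mem_Icc_right (v := fun _ => F)
    (s := fun _ => Metric.closedBall 0 r) (fun _ _ => hK)
    (fun t ht => (hx t ht).2.continuousWithinAt) (key x hx)
    (fun t ht => mem_closedBall_zero_iff.mpr (hx t (Ico_subset_Icc_self ht)).1)
    (fun t ht => (hy t ht).2.continuousWithinAt) (key y hy)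
    (fun t ht => mem_closedBall_zero_iff.mpr (hy t (Ico_subset_Icc_self ht)).1) h0

theorem exists_solution_Ici {F : ℂ → ℂ} (hF : DifferentiableOn ℂ F unitDisk)
    (hdis : ∀ w ∈ unitDisk, ((starRingEnd ℂ) w * F w).re ≤ 0) {w₀ : ℂ} (hw : w₀ ∈ unitDisk) :
    ∃ x : ℝ → ℂ, x 0 = w₀ ∧ ∀ t, 0 ≤ t → ‖x t‖ ≤ ‖w₀‖ ∧
      HasDerivWithinAt x (F (x t)) (Ici 0) t := by
  have hex := fun T : ℝ => fun hT : 0 ≤ T => exists_solution_Icc hF hdis hw hT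
  choose! X hX0 hX using hex
  have hr := mem_unitDisk.mp hw
  have huniq : ∀ S T, 0 ≤ S → S ≤ T → EqOn (X S) (X T) (Icc 0 S) := by
    intro S T hS hST
    refine solution_unique hF hr (hX S hS) (fun t ht => ?_)
      ((hX0 S hS).trans (hX0 T (hS.trans hST)).symm)
    have := hX T (hS.trans hST) t ⟨ht.1, ht.2.trans hST⟩
    exact ⟨this.1, this.2.mono (Icc_subset_Icc_right hST)⟩
  have heq : ∀ T s, 0 ≤ s → s ≤ T → X s s = X T s := fun T s hs hsT =>
    huniq s T hs hsT ⟨hs, le_rfl⟩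
  -- The diagonal of the family of solutions on [0, T]; near t it agrees with the single solution `X
  -- (t + 1)`, which provides the derivative.
  refine ⟨fun t => X t t, hX0 0 le_rfl, fun t ht => ?_⟩
  have h1 := hX (t + 1) (by linarith) t ⟨ht, by linarith⟩
  have h2 : X t t = X (t + 1) t := heq _ _ ht (by linarith)
  refine ⟨(congrArg norm h2).trans_le h1.1, ?_⟩
  have hmem : Icc 0 (t + 1) ∈ 𝓝[Ici 0] t := by
    have : Iic (t + 1) ∈ 𝓝 t := Iic_mem_nhds (by linarith)
    filter_upwards [mem_nhdsWithin_of_mem_nhds this, self_mem_nhdsWithin] with s hs1 hs2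
    exact ⟨hs2, hs1⟩
  have h3 := h1.2.mono_of_mem_nhdsWithin hmem
  rw [← h2] at h3
  refine h3.congr_of_eventuallyEq ?_ h2
  filter_upwards [hmem] with s hs
  exact heq _ _ hs.1 hs.2

theorem exists_norm_sub_sub_le {F : ℂ → ℂ} (hF : DifferentiableOn ℂ F unitDisk) {r : ℝ}
    (hr : r < 1) : ∃ C : ℝ, ∀ a ∈ Metric.closedBall (0 : ℂ) r, ∀ b ∈ Metric.closedBall (0 : ℂ) r,
      ‖F b - F a - deriv F a * (b - a)‖ ≤ C * ‖b - a‖ ^ 2 := by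
  have hsub : Metric.closedBall (0 : ℂ) r ⊆ unitDisk := Metric.closedBall_subset_ball hr
  obtain ⟨K, hK⟩ := exists_lipschitzOnWith (hF.deriv isOpen_unitDisk) hr
  refine ⟨K, fun a ha b hb => ?_⟩
  -- Intersecting with the ball about a of radius |b - a| bounds |F' - F'(a)| by K|b - a|; the mean
  -- value inequality then gives the second factor |b - a|.
  have hconv : Convex ℝ (Metric.closedBall (0 : ℂ) r ∩ Metric.closedBall a ‖b - a‖) :=
    (convex_closedBall _ _).inter (convex_closedBall _ _)
  have h := hconv.norm_image_sub_le_of_norm_hasDerivWithin_le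
    (f := fun w => F w - deriv F a * w) (f' := fun w => deriv F w - deriv F a)
    (C := K * ‖b - a‖) (x := a) (y := b) (fun w hw => ?_) (fun w hw => ?_) ⟨ha, by simp⟩
    ⟨hb, by simp [dist_eq_norm]⟩
  · rw [sq, ← mul_assoc]
    refine le_of_eq_of_le (congrArg norm ?_) h
    ring
  · have h1 := (hF.differentiableAt (isOpen_unitDisk.mem_nhds (hsub hw.1))).hasDerivAt
    have h2 := h1.sub ((hasDerivAt_id w).const_mul (deriv F a))
    simp only [mul_one] at h2
    exact h2.hasDerivWithinAt
  · have := hK.norm_sub_le hw.1 ha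
    refine this.trans ?_
    gcongr
    exact mem_closedBall_iff_norm.mp hw.2

/-- The semigroup law is uniqueness of solutions. For holomorphy, the difference v of two solutions
satisfies v' = F'(x(t)) v + O(v²), so the difference quotients of the time-T map converge to exp ∫
F'(x). -/
theorem exists_isGeneratorOf_of_dissipative {F : ℂ → ℂ} (hF : DifferentiableOn ℂ F unitDisk)
    (hdis : ∀ w ∈ unitDisk, ((starRingEnd ℂ) w * F w).re ≤ 0) :
    ∃ ψ : ℝ → ℂ → ℂ, IsGeneratorOf F ψ := by
  have hex := fun w : ℂ => fun hw : w ∈ unitDisk => exists_solution_Ici hF hdis hw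
  choose! X hX0 hX using hex
  have hmem : ∀ w ∈ unitDisk, ∀ t, 0 ≤ t → X w t ∈ unitDisk := fun w hw t ht =>
    mem_unitDisk.mpr ((hX w hw t ht).1.trans_lt (mem_unitDisk.mp hw))
  have hIcc : ∀ w ∈ unitDisk, ∀ T, ∀ t ∈ Icc 0 T,
      HasDerivWithinAt (X w) (F (X w t)) (Icc 0 T) t := fun w hw T t ht =>
    (hX w hw t ht.1).2.mono Icc_subset_Ici_self
  refine ⟨fun t w => X w t, ⟨⟨?_, fun t ht w hw => hmem w hw t ht, hX0, ?_, ?_⟩, hF,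
    fun w hw t ht => (hX w hw t ht).2⟩⟩
  · intro T hT w hw
    apply DifferentiableAt.differentiableWithinAt
    have hw1 := mem_unitDisk.mp hw
    set r := (1 + ‖w‖) / 2 with hr
    have hr1 : r < 1 := by linarith
    have hwr : ‖w‖ < r := by linarith
    have hsub : Metric.closedBall (0 : ℂ) r ⊆ unitDisk := Metric.closedBall_subset_ball hr1
    have hdc : ContinuousOn (deriv F) unitDisk := (hF.deriv isOpen_unitDisk).continuousOn
    obtain ⟨M, hM⟩ := (isCompact_closedBall (0 : ℂ) r).exists_bound_of_continuousOn (hdc.mono hsub)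
    obtain ⟨C, hC⟩ := exists_norm_sub_sub_le hF hr1
    -- Replacing s by max s 0 extends the coefficient continuously to the whole line, so its
    -- integral is differentiable also at the endpoint 0.
    have hcont : Continuous fun s : ℝ => deriv F (X w (max s 0)) := by
      have h1 : ContinuousOn (X w) (Ici 0) := fun t ht => (hX w hw t ht).2.continuousWithinAt
      have h2 : Continuous fun s : ℝ => X w (max s 0) :=
        h1.comp_continuous (by fun_prop) fun s => mem_Ici.mpr (le_max_right _ _)
      exact hdc.comp_continuous h2 fun s => hmem w hw _ (le_max_right _ _)
    have hA : ∀ t ∈ Icc 0 T, HasDerivWithinAt (fun u => ∫ s in (0 : ℝ)..u, deriv F (X w (max s 0)))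
        (deriv F (X w (max t 0))) (Icc 0 T) t := fun t _ =>
      (hcont.integral_hasStrictDerivAt 0 t).hasDerivAt.hasDerivWithinAt
    have hin : ∀ i ∈ Metric.closedBall (0 : ℂ) r, ∀ t, 0 ≤ t → X i t ∈ Metric.closedBall (0 : ℂ) r :=
      fun i hi t ht => mem_closedBall_zero_iff.mpr
        ((hX i (hsub hi) t ht).1.trans (mem_closedBall_zero_iff.mp hi))
    have hwr' : w ∈ Metric.closedBall (0 : ℂ) r := mem_closedBall_zero_iff.mpr hwr.le
    have hlim := tendsto_div_of_linearized (l := 𝓝[≠] w) (v := fun i t => X i t - X w t)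
      (v' := fun i t => F (X i t) - F (X w t)) (M := M) (C := C) (δ := 1) hT one_pos hA
      intervalIntegral.integral_same (fun t ht => hM _ (hin w hwr' _ (le_max_right _ _))) ?_ ?_
    · refine (hasDerivAt_iff_tendsto_slope.mpr (hlim.congr' ?_)).differentiableAt
      have hnb : Metric.closedBall (0 : ℂ) r ∈ 𝓝[≠] w := mem_nhdsWithin_of_mem_nhds
        (mem_of_superset (Metric.isOpen_ball.mem_nhds (mem_ball_zero_iff.mpr hwr))
          Metric.ball_subset_closedBall)
      filter_upwards [hnb] with i hi
      rw [slope_def_field, hX0 w hw, hX0 i (hsub hi)]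
    · have hnb : Metric.closedBall (0 : ℂ) r ∈ 𝓝[≠] w := mem_nhdsWithin_of_mem_nhds
        (mem_of_superset (Metric.isOpen_ball.mem_nhds (mem_ball_zero_iff.mpr hwr))
          Metric.ball_subset_closedBall)
      filter_upwards [hnb, self_mem_nhdsWithin] with i hi hne
      refine ⟨by rw [hX0 w hw, hX0 i (hsub hi)]; exact sub_ne_zero.mpr hne, fun t ht => ⟨?_, ?_⟩⟩
      · exact (hIcc i (hsub hi) T t ht).sub (hIcc w hw T t ht)
      · intro _
        rw [max_eq_left ht.1]
        exact hC _ (hin w hwr' t ht.1) _ (hin i hi t ht.1)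
    · have h1 : Tendsto (fun i : ℂ => i - w) (𝓝[≠] w) (𝓝 0) := by
        have : Tendsto (fun i : ℂ => i - w) (𝓝 w) (𝓝 (w - w)) :=
          (continuous_id.sub continuous_const).tendsto w
        rw [sub_self] at this
        exact tendsto_nhdsWithin_of_tendsto_nhds this
      refine h1.congr' ?_
      filter_upwards [mem_nhdsWithin_of_mem_nhds (isOpen_unitDisk.mem_nhds hw)] with i hi
      rw [hX0 w hw, hX0 i hi]
  · intro s t hs ht w hw
    have hwt := hmem w hw t ht
    have h := solution_unique hF (x := X (X w t)) (y := fun u => X w (u + t)) (T := s)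
      (mem_unitDisk.mp hw)
      (fun u hu => ⟨(hX _ hwt u hu.1).1.trans (hX w hw t ht).1, hIcc _ hwt s u hu⟩)
      (fun u hu => ⟨(hX w hw (u + t) (by linarith [hu.1])).1, ?_⟩) (by simp [hX0 _ hwt])
    · exact h ⟨hs, le_rfl⟩
    · have h1 := (hX w hw (u + t) (by linarith [hu.1])).2
      have h2 : HasDerivWithinAt (fun u : ℝ => u + t) 1 (Icc 0 s) u :=
        ((hasDerivAt_id u).add_const t).hasDerivWithinAt
      have h3 := h1.scomp u h2 (fun x hx => by simp only [mem_Ici]; linarith [hx.1])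
      rw [one_smul] at h3
      exact h3
  · intro w hw
    have h := (hX w hw 0 le_rfl).2.continuousWithinAt.tendsto
    rw [hX0 w hw] at h
    exact h.mono_left (nhdsWithin_mono _ Ioi_subset_Ici_self)

/-! ### Generators of Berkson–Porta form and their fixed points -/

theorem sub_mob {τ w : ℂ} (hτ : ‖τ‖ < 1) (hw : ‖w‖ < 1) :
    τ - mob τ w = w * (1 - (starRingEnd ℂ) τ * mob τ w) := by
  have h := mob_mob hτ hw
  have h0 := one_sub_conj_mul_ne_zero hτ (mob_mem hτ hw).le
  rw [mob, div_eq_iff h0] at h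
  exact h

/-- Functions of the Berkson-Porta form are infinitesimal generators. -/
theorem exists_isGeneratorOf {τ : ℂ} (hτ : ‖τ‖ < 1) {p G : ℂ → ℂ}
    (hp : DifferentiableOn ℂ p unitDisk) (hre : ∀ z ∈ unitDisk, 0 ≤ (p z).re)
    (hG : ∀ z ∈ unitDisk, G z = (τ - z) * (1 - (starRingEnd ℂ) τ * z) * p z) :
    ∃ φ : ℝ → ℂ → ℂ, IsGeneratorOf G φ := by
  have hD0 : 1 - (starRingEnd ℂ) τ * τ ≠ 0 := one_sub_conj_mul_ne_zero hτ hτ.le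
  have hD : 0 < 1 - ‖τ‖ ^ 2 := by nlinarith [norm_nonneg τ]
  -- This is G transported by `mob τ`. Its zero is now at 0, and Re(conj w F(w)) = -(1 - |τ|²)|w|²
  -- Re p(mob τ w) ≤ 0.
  set F : ℂ → ℂ := fun w => -((1 - (starRingEnd ℂ) τ * τ) * (w * p (mob τ w))) with hFdef
  have hpm : DifferentiableOn ℂ (fun w => p (mob τ w)) unitDisk :=
    hp.comp (differentiableOn_mob hτ) (mob_mapsTo hτ)
  have hF : DifferentiableOn ℂ F unitDisk :=
    ((differentiableOn_id.mul hpm).const_mul _).neg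
  obtain ⟨ψ, hψ⟩ := exists_isGeneratorOf_of_dissipative hF (fun w hw => by
    have h1 := hre _ (mob_mapsTo hτ hw)
    have h2 : (starRingEnd ℂ) w * F w = ((-((1 - ‖τ‖ ^ 2) * ‖w‖ ^ 2) : ℝ) : ℂ) * p (mob τ w) := by
      simp only [hFdef]
      rw [one_sub_conj_mul_self]
      have h3 : (starRingEnd ℂ) w * w = ((‖w‖ ^ 2 : ℝ) : ℂ) := by
        rw [mul_comm, Complex.mul_conj, Complex.normSq_eq_norm_sq]
      push_cast at h3 ⊢
      linear_combination -(1 - (‖τ‖ : ℂ) ^ 2) * p (mob τ w) * h3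
    rw [h2, re_ofReal_mul]
    exact mul_nonpos_of_nonpos_of_nonneg (neg_nonpos.mpr (by positivity)) h1)
  have hmT := mob_mapsTo hτ
  have hmm : ∀ z ∈ unitDisk, mob τ (mob τ z) = z := fun z hz => mob_mob hτ (mem_unitDisk.mp hz)
  refine ⟨fun t z => mob τ (ψ t (mob τ z)), ⟨⟨?_, ?_, ?_, ?_, ?_⟩, ?_, ?_⟩⟩
  · intro t ht
    exact (differentiableOn_mob hτ).comp ((hψ.semigroup.holo t ht).comp (differentiableOn_mob hτ)
      hmT) ((hψ.semigroup.mapsTo t ht).comp hmT)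
  · intro t ht
    exact hmT.comp ((hψ.semigroup.mapsTo t ht).comp hmT)
  · intro z hz
    rw [hψ.semigroup.zero _ (hmT hz), hmm z hz]
  · intro s t hs ht z hz
    rw [hmm _ (hψ.semigroup.mapsTo t ht (hmT hz)), hψ.semigroup.comp s t hs ht _ (hmT hz)]
  · intro z hz
    have h1 := (hasDerivAt_mob hτ (mem_unitDisk.mp (hmT hz))).continuousAt.tendsto.comp
      (hψ.semigroup.cont _ (hmT hz))
    rw [hmm z hz] at h1
    exact h1
  · refine DifferentiableOn.congr (f := fun z => (τ - z) * (1 - (starRingEnd ℂ) τ * z) * p z) ?_ hG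
    exact DifferentiableOn.mul (by fun_prop) hp
  · intro z hz t ht
    have hw : ψ t (mob τ z) ∈ unitDisk := hψ.semigroup.mapsTo t ht (hmT hz)
    have hw1 := mem_unitDisk.mp hw
    have h1 := (hasDerivAt_mob hτ hw1).comp_hasDerivWithinAt t (hψ.flow _ (hmT hz) t ht)
    refine h1.congr_deriv ?_
    rw [hG _ (hmT hw), sub_mob hτ hw1, one_sub_conj_mul_mob hτ hw1]
    have h0 := one_sub_conj_mul_ne_zero hτ hw1.le
    simp only [hFdef]
    field_simp

/-- The behaviour of a semigroup near a zero of its generator in the closed disk. -/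
theorem IsGeneratorOf.tendsto_div_of_zero {G : ℂ → ℂ} {φ : ℝ → ℂ → ℂ} (hg : IsGeneratorOf G φ)
    {q g₀ : ℂ} {C δ : ℝ} (hδ : 0 < δ)
    (hquad : ∀ z ∈ unitDisk, ‖z - q‖ ≤ δ → ‖G z - g₀ * (z - q)‖ ≤ C * ‖z - q‖ ^ 2)
    {T : ℝ} (hT : 0 ≤ T) :
    Tendsto (fun z => (φ T z - q) / (z - q)) (𝓝[unitDisk \ {q}] q) (𝓝 (exp (g₀ * T))) := by
  have hA : ∀ t ∈ Icc 0 T, HasDerivWithinAt (fun t : ℝ => g₀ * (t : ℂ)) g₀ (Icc 0 T) t := by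
    intro t _
    have := (Complex.ofRealCLM.hasDerivAt (x := t)).const_mul g₀
    simp only [Complex.ofRealCLM_apply, ofReal_one, mul_one] at this
    exact this.hasDerivWithinAt
  have hlim := tendsto_div_of_linearized (l := 𝓝[unitDisk \ {q}] q) (v := fun z t => φ t z - q)
    (v' := fun z t => G (φ t z)) (a := fun _ => g₀) (M := ‖g₀‖) (C := C) hT hδ hA (by simp)
    (fun _ _ => le_rfl) ?_ ?_
  · refine hlim.congr' ?_
    filter_upwards [self_mem_nhdsWithin] with z hz
    rw [hg.semigroup.zero z hz.1]
  · filter_upwards [self_mem_nhdsWithin] with z hz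
    refine ⟨by rw [hg.semigroup.zero z hz.1]; exact sub_ne_zero.mpr hz.2, fun t ht => ⟨?_, ?_⟩⟩
    · exact ((hg.flow z hz.1 t ht.1).mono Icc_subset_Ici_self).sub_const q
    · exact hquad _ (hg.semigroup.mapsTo t ht.1 hz.1)
  · have h1 : Tendsto (fun z : ℂ => z - q) (𝓝[unitDisk \ {q}] q) (𝓝 0) := by
      have : Tendsto (fun z : ℂ => z - q) (𝓝 q) (𝓝 (q - q)) :=
        (continuous_id.sub continuous_const).tendsto q
      rw [sub_self] at this
      exact tendsto_nhdsWithin_of_tendsto_nhds this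
    refine h1.congr' ?_
    filter_upwards [self_mem_nhdsWithin] with z hz
    rw [hg.semigroup.zero z hz.1]

theorem IsGeneratorOf.apply_eq_self {G : ℂ → ℂ} {φ : ℝ → ℂ → ℂ} (hg : IsGeneratorOf G φ)
    {τ : ℂ} (hτ : τ ∈ unitDisk) (h0 : G τ = 0) {T : ℝ} (hT : 0 ≤ T) : φ T τ = τ := by
  have hd : ∀ t ∈ Icc 0 T, HasDerivWithinAt (fun s => φ s τ) (G (φ t τ)) (Icc 0 T) t :=
    fun t ht => (hg.flow τ hτ t ht.1).mono Icc_subset_Ici_self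
  -- Uniqueness needs one closed disk of radius less than 1 containing both curves; the maximum of
  -- |φ_t(τ)| over the compact time interval supplies it.
  obtain ⟨s, hs, hmax⟩ := isCompact_Icc.exists_isMaxOn (nonempty_Icc.mpr hT)
    (f := fun t => ‖φ t τ‖) (fun t ht => (hd t ht).continuousWithinAt.norm)
  have hr : ‖φ s τ‖ < 1 := mem_unitDisk.mp (hg.semigroup.mapsTo s hs.1 hτ)
  have hτs : ‖τ‖ ≤ ‖φ s τ‖ := by
    have := hmax (left_mem_Icc.mpr hT)
    simpa [hg.semigroup.zero τ hτ] using this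
  exact solution_unique hg.holo hr (x := fun t => φ t τ) (y := fun _ => τ)
    (fun t ht => ⟨hmax ht, hd t ht⟩)
    (fun t _ => ⟨hτs, by rw [h0]; exact hasDerivWithinAt_const _ _ _⟩)
    (hg.semigroup.zero τ hτ) (right_mem_Icc.mpr hT)

theorem IsGeneratorOf.hasDerivAt_of_zero {G : ℂ → ℂ} {φ : ℝ → ℂ → ℂ} (hg : IsGeneratorOf G φ)
    {τ : ℂ} (hτ : τ ∈ unitDisk) (h0 : G τ = 0) {T : ℝ} (hT : 0 ≤ T) :
    HasDerivAt (φ T) (exp (deriv G τ * T)) τ := by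
  have hτ1 := mem_unitDisk.mp hτ
  -- With radius (1 + |τ|)/2 and δ = (1 - |τ|)/2, the δ-ball about τ lies in the disk where the
  -- Taylor bound holds.
  obtain ⟨C, hC⟩ := exists_norm_sub_sub_le hg.holo (r := (1 + ‖τ‖) / 2) (by linarith)
  have h := hg.tendsto_div_of_zero (q := τ) (g₀ := deriv G τ) (C := C) (δ := (1 - ‖τ‖) / 2)
    (by linarith) (fun z _ hz => by
      have := hC τ (mem_closedBall_zero_iff.mpr (by linarith)) z
        (mem_closedBall_zero_iff.mpr (by
          have : ‖z‖ ≤ ‖z - τ‖ + ‖τ‖ := norm_le_norm_sub_add _ _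
          linarith))
      rwa [h0, sub_zero] at this) hT
  rw [hasDerivAt_iff_tendsto_slope]
  have hnb : 𝓝[unitDisk \ {τ}] τ = 𝓝[≠] τ := by
    rw [sdiff_eq, inter_comm]
    exact nhdsWithin_inter_of_mem' (mem_nhdsWithin_of_mem_nhds (isOpen_unitDisk.mem_nhds hτ))
  rw [hnb] at h
  refine h.congr' (Eventually.of_forall fun z => ?_)
  rw [slope_def_field, hg.apply_eq_self hτ h0 hT]

/-- Comparing right derivatives at 0 avoids the ambiguity of the logarithm. -/
theorem eq_of_exp_mul_eq {a b : ℂ} (h : ∀ t : ℝ, 0 ≤ t → exp (a * t) = exp (b * t)) : a = b := by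
  have key : ∀ c : ℂ, HasDerivWithinAt (fun t : ℝ => exp (c * t)) c (Ici 0) 0 := by
    intro c
    have := ((Complex.ofRealCLM.hasDerivAt (x := 0)).const_mul c).cexp
    simp only [Complex.ofRealCLM_apply, ofReal_one, mul_one, ofReal_zero, mul_zero, exp_zero,
      one_mul] at this
    exact this.hasDerivWithinAt
  have h1 : HasDerivWithinAt (fun t : ℝ => exp (a * t)) b (Ici 0) 0 :=
    (key b).congr (fun t ht => h t ht) (h 0 le_rfl)
  exact (uniqueDiffOn_Ici (0 : ℝ) 0 self_mem_Ici).eq_deriv _ (key a) h1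

/-- The spectral value is -G'(τ), so it depends neither on the semigroup chosen nor on t. -/
theorem hasSpectralValue_iff {G : ℂ → ℂ} {φ : ℝ → ℂ → ℂ} (hg : IsGeneratorOf G φ)
    {τ : ℂ} (hτ : τ ∈ unitDisk) (h0 : G τ = 0) (w : ℂ) :
    HasSpectralValue G τ w ↔ w = -deriv G τ := by
  constructor
  · rintro ⟨φ', hg', hw⟩
    have : -w = deriv G τ := eq_of_exp_mul_eq fun t ht => by
      rw [← (hg'.hasDerivAt_of_zero hτ h0 ht).deriv, hw t ht, neg_mul]
    rw [← this, neg_neg]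
  · rintro rfl
    refine ⟨φ, hg, fun t ht => ?_⟩
    rw [(hg.hasDerivAt_of_zero hτ h0 ht).deriv, neg_mul, neg_neg]

/-! ### The Berkson-Porta representation -/

theorem hasDerivAt_berksonPorta {τ : ℂ} (hτ : τ ∈ unitDisk) {p G : ℂ → ℂ}
    (hp : DifferentiableOn ℂ p unitDisk)
    (hG : ∀ z ∈ unitDisk, G z = (τ - z) * (1 - (starRingEnd ℂ) τ * z) * p z) :
    HasDerivAt G (-(((1 - ‖τ‖ ^ 2 : ℝ) : ℂ) * p τ)) τ := by
  have h1 := (hp.differentiableAt (isOpen_unitDisk.mem_nhds hτ)).hasDerivAt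
  have h2 := (((hasDerivAt_id τ).const_sub τ).mul
    (((hasDerivAt_id τ).const_mul ((starRingEnd ℂ) τ)).const_sub 1)).mul h1
  refine (h2.congr_deriv ?_).congr_of_eventuallyEq ?_
  · simp only [id, sub_self, Pi.mul_apply, zero_mul, mul_one, add_zero]
    rw [← one_sub_conj_mul_self]
    ring
  · filter_upwards [isOpen_unitDisk.mem_nhds hτ] with z hz
    rw [hG z hz]
    rfl

theorem deriv_nonpos_of_le_left {h : ℝ → ℝ} {h' : ℝ} (hd : HasDerivWithinAt h h' (Ici 0) 0)
    (hle : ∀ t, 0 ≤ t → h t ≤ h 0) : h' ≤ 0 := by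
  have h1 := hasDerivWithinAt_iff_tendsto_slope.mp hd
  rw [Ici_sdiff_left] at h1
  refine le_of_tendsto h1 ?_
  filter_upwards [self_mem_nhdsWithin] with t ht
  have ht' : 0 < t := ht
  rw [slope_def_field]
  exact div_nonpos_of_nonpos_of_nonneg (by linarith [hle t ht'.le]) (by linarith)

/-- The Schwarz lemma for φ_t conjugated by `mob τ`, which fixes 0: the pseudohyperbolic distance to
τ does not grow. -/
theorem IsGeneratorOf.norm_mob_le {G : ℂ → ℂ} {φ : ℝ → ℂ → ℂ} (hg : IsGeneratorOf G φ)
    {τ : ℂ} (hτ : τ ∈ unitDisk) (hfix : ∀ t, 0 ≤ t → φ t τ = τ) {z : ℂ} (hz : z ∈ unitDisk)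
    {t : ℝ} (ht : 0 ≤ t) : ‖mob τ (φ t z)‖ ≤ ‖mob τ z‖ := by
  have hτ1 := mem_unitDisk.mp hτ
  have hmT := mob_mapsTo hτ1
  have hd : DifferentiableOn ℂ (fun w => mob τ (φ t (mob τ w))) unitDisk :=
    (differentiableOn_mob hτ1).comp ((hg.semigroup.holo t ht).comp (differentiableOn_mob hτ1)
      hmT) ((hg.semigroup.mapsTo t ht).comp hmT)
  have h := Complex.norm_le_norm_of_mapsTo_ball hd
    (fun w hw => Metric.ball_subset_closedBall (hmT (hg.semigroup.mapsTo t ht (hmT hw))))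
    (by rw [mob_zero, hfix t ht, mob_self]) (mob_mem hτ1 (mem_unitDisk.mp hz))
  rwa [mob_mob hτ1 (mem_unitDisk.mp hz)] at h

theorem IsGeneratorOf.apply_eq_zero {G : ℂ → ℂ} {φ : ℝ → ℂ → ℂ} (hg : IsGeneratorOf G φ)
    {τ : ℂ} (hτ : τ ∈ unitDisk) (hfix : ∀ t, 0 ≤ t → φ t τ = τ) : G τ = 0 := by
  have h1 := hg.flow τ hτ 0 le_rfl
  rw [hfix 0 le_rfl] at h1
  have h2 : HasDerivWithinAt (fun s => φ s τ) 0 (Ici 0) 0 :=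
    (hasDerivWithinAt_const (0 : ℝ) (Ici 0) τ).congr (fun t ht => hfix t ht) (hfix 0 le_rfl)
  exact (uniqueDiffOn_Ici (0 : ℝ) 0 self_mem_Ici).eq_deriv _ h1 h2

/-- The zero of G at τ is divided out with `dslope`. The right derivative at t = 0 of |mob τ (φ_t
z)|² is -2(1 - |τ|²)|mob τ z|² Re p(z), and it is nonpositive by `norm_mob_le`; the point z = τ
follows by continuity. -/
theorem IsGeneratorOf.exists_berksonPorta {G : ℂ → ℂ} {φ : ℝ → ℂ → ℂ} (hg : IsGeneratorOf G φ)
    {τ : ℂ} (hτ : τ ∈ unitDisk) (hfix : ∀ t, 0 ≤ t → φ t τ = τ) :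
    ∃ p : ℂ → ℂ, DifferentiableOn ℂ p unitDisk ∧ (∀ z ∈ unitDisk, 0 ≤ (p z).re) ∧
      ∀ z ∈ unitDisk, G z = (τ - z) * (1 - (starRingEnd ℂ) τ * z) * p z := by
  have hτ1 := mem_unitDisk.mp hτ
  have hD : 0 < 1 - ‖τ‖ ^ 2 := by nlinarith [norm_nonneg τ]
  have h0 : G τ = 0 := hg.apply_eq_zero hτ hfix
  have hne : ∀ z ∈ unitDisk, 1 - (starRingEnd ℂ) τ * z ≠ 0 := fun z hz =>
    one_sub_conj_mul_ne_zero hτ1 (mem_unitDisk.mp hz).le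
  set p : ℂ → ℂ := fun z => -dslope G τ z / (1 - (starRingEnd ℂ) τ * z) with hpdef
  have hp : DifferentiableOn ℂ p unitDisk := by
    refine DifferentiableOn.div ?_ (by fun_prop) hne
    exact ((Complex.differentiableOn_dslope (isOpen_unitDisk.mem_nhds hτ)).mpr hg.holo).neg
  have hG : ∀ z ∈ unitDisk, G z = (τ - z) * (1 - (starRingEnd ℂ) τ * z) * p z := by
    intro z hz
    rw [mul_assoc, hpdef, mul_div_cancel₀ _ (hne z hz)]
    have := sub_smul_dslope G τ z
    rw [h0, sub_zero, smul_eq_mul] at this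
    rw [← this]
    ring
  have hre : ∀ z ∈ unitDisk, z ≠ τ → 0 ≤ (p z).re := by
    intro z hz hzτ
    have hz1 := mem_unitDisk.mp hz
    have hφ0 := hg.semigroup.zero z hz
    have h1 := hg.flow z hz 0 le_rfl
    have h2 : HasDerivWithinAt (fun t => mob τ (φ t z)) _ (Ici 0) 0 :=
      HasDerivAt.comp_hasDerivWithinAt (0 : ℝ) (h₂ := mob τ) (h := fun t => φ t z)
        (by rw [hφ0]; exact hasDerivAt_mob hτ1 hz1) h1
    have h3 := deriv_nonpos_of_le_left h2.norm_sq (fun t ht => by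
      rw [hφ0]
      exact pow_le_pow_left₀ (norm_nonneg _) (hg.norm_mob_le hτ hfix hz ht) 2)
    rw [hφ0, Complex.inner] at h3
    have hm : τ - z ≠ 0 := sub_ne_zero.mpr hzτ.symm
    have hmne : mob τ z ≠ 0 := div_ne_zero hm (hne z hz)
    have h4 : -(1 - (starRingEnd ℂ) τ * τ) / (1 - (starRingEnd ℂ) τ * z) ^ 2 * G z *
        (starRingEnd ℂ) (mob τ z) = ((-((1 - ‖τ‖ ^ 2) * ‖mob τ z‖ ^ 2) : ℝ) : ℂ) * p z := by
      have h5 : mob τ z * (starRingEnd ℂ) (mob τ z) = ((‖mob τ z‖ ^ 2 : ℝ) : ℂ) := by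
        rw [Complex.mul_conj, Complex.normSq_eq_norm_sq]
      have h6 : -(1 - (starRingEnd ℂ) τ * τ) / (1 - (starRingEnd ℂ) τ * z) ^ 2 * G z
          = -(1 - (starRingEnd ℂ) τ * τ) * mob τ z * p z := by
        rw [hG z hz, mob]
        have := hne z hz
        field_simp
      rw [h6, ofReal_neg, ofReal_mul, ← h5, ← one_sub_conj_mul_self]
      ring
    rw [h4, re_ofReal_mul] at h3
    have h7 : 0 < (1 - ‖τ‖ ^ 2) * ‖mob τ z‖ ^ 2 := by
      have := norm_pos_iff.mpr hmne
      positivity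
    nlinarith
  refine ⟨p, hp, fun z hz => ?_, hG⟩
  by_cases hzτ : z = τ
  · subst hzτ
    have hc : Tendsto (fun w => (p w).re) (𝓝[≠] z) (𝓝 (p z).re) :=
      (Complex.continuous_re.tendsto _).comp
        ((hp.differentiableAt (isOpen_unitDisk.mem_nhds hz)).continuousAt.tendsto.mono_left
          nhdsWithin_le_nhds)
    refine ge_of_tendsto hc ?_
    filter_upwards [self_mem_nhdsWithin,
      mem_nhdsWithin_of_mem_nhds (isOpen_unitDisk.mem_nhds hz)] with w hw1 hw2
    exact hre w hw2 hw1
  · exact hre z hz hzτ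

theorem IsSemigroupDWPoint.fix {φ : ℝ → ℂ → ℂ} {τ : ℂ} (h : IsSemigroupDWPoint φ τ)
    (hτ : τ ∈ unitDisk) {t : ℝ} (ht : 0 ≤ t) : φ t τ = τ := by
  by_cases hid : EqOn (φ t) id unitDisk
  · exact hid hτ
  · rcases h t ht hid with h | ⟨-, d, -, h, -⟩
    · exact h.2.1
    · exact absurd h (mem_unitDisk.mp hτ).ne

/-- On the radius |rσ - σ| = 1 - r, so any aperture above 1 contains it. Only this radial part of
the angular limits is used for the representation. -/
theorem tendsto_radial_stolz {σ : ℂ} (hσ : ‖σ‖ = 1) :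
    Tendsto (fun r : ℝ => (r : ℂ) * σ) (𝓝[<] 1) (𝓝[stolz σ 2] σ) := by
  refine tendsto_nhdsWithin_iff.mpr ⟨?_, ?_⟩
  · have : Tendsto (fun r : ℝ => (r : ℂ) * σ) (𝓝 1) (𝓝 (((1 : ℝ) : ℂ) * σ)) :=
      Continuous.tendsto (by fun_prop) 1
    rw [ofReal_one, one_mul] at this
    exact tendsto_nhdsWithin_of_tendsto_nhds this
  · filter_upwards [Ioo_mem_nhdsLT (zero_lt_one (α := ℝ))] with r hr
    have hn : ‖(r : ℂ) * σ‖ = r := by rw [norm_mul, hσ, mul_one, Complex.norm_of_nonneg hr.1.le]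
    refine ⟨by rw [hn]; exact hr.2, ?_⟩
    have : (r : ℂ) * σ - σ = ((r - 1 : ℝ) : ℂ) * σ := by push_cast; ring
    rw [hn, this, norm_mul, hσ, mul_one, Complex.norm_real, Real.norm_eq_abs, abs_sub_comm,
      abs_of_pos (by linarith [hr.2])]
    linarith [hr.2]

theorem berksonPorta_factor_boundary {σ : ℂ} (hσ : ‖σ‖ = 1) (τ : ℂ) :
    (τ - σ) * (1 - (starRingEnd ℂ) τ * σ) = -(σ * ((‖τ - σ‖ ^ 2 : ℝ) : ℂ)) := by
  rw [← Complex.normSq_eq_norm_sq, ← Complex.mul_conj, map_sub]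
  have := conj_mul_self_of_norm_one hσ
  linear_combination (-(τ - σ)) * this

/-- The radial behaviour at a boundary regular fixed point of the function `p` in the Berkson-Porta
representation. -/
theorem tendsto_radial_of_hasAngularLimit {τ σ : ℂ} (hτ : τ ∈ unitDisk) (hσ : ‖σ‖ = 1)
    {p G : ℂ → ℂ} (hG : ∀ z ∈ unitDisk, G z = (τ - z) * (1 - (starRingEnd ℂ) τ * z) * p z) {l : ℝ}
    (hl : HasAngularLimit (fun z => G z / (σ - z)) σ l) :
    Tendsto (fun r : ℝ => p (r * σ) / ((1 - r : ℝ) : ℂ)) (𝓝[<] 1)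
      (𝓝 ((-l / ‖τ - σ‖ ^ 2 : ℝ) : ℂ)) := by
  have hτσ : 0 < ‖τ - σ‖ := by
    rw [norm_sub_rev]; exact norm_pos_iff.mpr (ne_of_norm_one hσ hτ)
  have hσ0 : σ ≠ 0 := by rintro rfl; simp at hσ
  have h1 := (hl 2).comp (tendsto_radial_stolz hσ)
  have h2 : Tendsto (fun r : ℝ => (τ - r * σ) * (1 - (starRingEnd ℂ) τ * (r * σ))) (𝓝[<] 1)
      (𝓝 (-(σ * ((‖τ - σ‖ ^ 2 : ℝ) : ℂ)))) := by
    rw [← berksonPorta_factor_boundary hσ]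
    have : Tendsto (fun r : ℝ => (τ - r * σ) * (1 - (starRingEnd ℂ) τ * (r * σ))) (𝓝 1)
      (𝓝 ((τ - (1 : ℝ) * σ) * (1 - (starRingEnd ℂ) τ * ((1 : ℝ) * σ)))) :=
        Continuous.tendsto (by fun_prop) 1
    rw [ofReal_one, one_mul] at this
    exact tendsto_nhdsWithin_of_tendsto_nhds this
  have hne : -(σ * ((‖τ - σ‖ ^ 2 : ℝ) : ℂ)) ≠ 0 := by
    refine neg_ne_zero.mpr (mul_ne_zero hσ0 ?_)
    exact_mod_cast (by positivity : ‖τ - σ‖ ^ 2 ≠ 0)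
  have h3 := ((h1.div h2 hne).mul_const σ)
  have hev : ∀ᶠ r : ℝ in 𝓝[<] 1, (τ - r * σ) * (1 - (starRingEnd ℂ) τ * (r * σ)) ≠ 0 :=
    h2.eventually_ne hne
  have hval : (l : ℂ) / -(σ * ((‖τ - σ‖ ^ 2 : ℝ) : ℂ)) * σ = ((-l / ‖τ - σ‖ ^ 2 : ℝ) : ℂ) := by
    have : ((‖τ - σ‖ ^ 2 : ℝ) : ℂ) ≠ 0 := by
      exact_mod_cast (by positivity : ‖τ - σ‖ ^ 2 ≠ 0)
    push_cast at this ⊢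
    field_simp
  rw [hval] at h3
  refine h3.congr' ?_
  filter_upwards [hev, Ioo_mem_nhdsLT (zero_lt_one (α := ℝ))] with r hr hr1
  have hn : ‖(r : ℂ) * σ‖ = r := by rw [norm_mul, hσ, mul_one, Complex.norm_of_nonneg hr1.1.le]
  have hw : (r : ℂ) * σ ∈ unitDisk := by rw [mem_unitDisk, hn]; exact hr1.2
  have h1r : ((1 - r : ℝ) : ℂ) ≠ 0 := by exact_mod_cast (by linarith [hr1.2] : 1 - r ≠ 0)
  have e1 : σ - r * σ = ((1 - r : ℝ) : ℂ) * σ := by push_cast; ring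
  simp only [Function.comp, Pi.div_apply]
  rw [hG _ hw, e1]
  generalize (τ - r * σ) * (1 - (starRingEnd ℂ) τ * (r * σ)) = N at hr
  field_simp

/-! ### The structure of the class `Gen` -/

theorem radial_mem_unitDisk {σ : ℂ} (hσ : ‖σ‖ = 1) :
    ∀ᶠ r : ℝ in 𝓝[<] 1, (r : ℂ) * σ ∈ unitDisk ∧ ‖(r : ℂ) * σ‖ = r ∧ r < 1 := by
  filter_upwards [Ioo_mem_nhdsLT (zero_lt_one (α := ℝ))] with r hr
  have hn : ‖(r : ℂ) * σ‖ = r := by rw [norm_mul, hσ, mul_one, Complex.norm_of_nonneg hr.1.le]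
  exact ⟨by rw [mem_unitDisk, hn]; exact hr.2, hn, hr.2⟩

theorem tendsto_one_sub_ofReal :
    Tendsto (fun r : ℝ => ((1 - r : ℝ) : ℂ)) (𝓝[<] 1) (𝓝 0) := by
  have : Tendsto (fun r : ℝ => ((1 - r : ℝ) : ℂ)) (𝓝 1) (𝓝 ((1 - 1 : ℝ) : ℂ)) :=
    Continuous.tendsto (by fun_prop) 1
  rw [sub_self, ofReal_zero] at this
  exact tendsto_nhdsWithin_of_tendsto_nhds this

/-- A function with positive real part decays at most linearly along a radius. -/
theorem radial_limit_pos {p : ℂ → ℂ} (hp : DifferentiableOn ℂ p unitDisk)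
    (hre : ∀ z ∈ unitDisk, 0 ≤ (p z).re) (hpos : 0 < (p 0).re) {σ : ℂ} (hσ : ‖σ‖ = 1) {b : ℝ}
    (hlim : Tendsto (fun r : ℝ => p (r * σ) / ((1 - r : ℝ) : ℂ)) (𝓝[<] 1) (𝓝 (b : ℂ))) :
    0 < b := by
  have hp0 : Tendsto (fun r : ℝ => p (r * σ)) (𝓝[<] 1) (𝓝 0) := by
    have := hlim.mul tendsto_one_sub_ofReal
    rw [mul_zero] at this
    refine this.congr' ?_
    filter_upwards [radial_mem_unitDisk hσ] with r hr
    have h1r : ((1 - r : ℝ) : ℂ) ≠ 0 := by exact_mod_cast (by linarith [hr.2.2] : 1 - r ≠ 0)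
    exact div_mul_cancel₀ _ h1r
  -- `harnack_sq` between 0 and rσ, divided by 1 - r; since p(rσ) → 0, the limit is 2|p(0)|² ≤ 4b Re
  -- p(0).
  have key : ∀ᶠ r : ℝ in 𝓝[<] 1, (1 + r) * ‖p 0 + (starRingEnd ℂ) (p (r * σ))‖ ^ 2 ≤
      4 * ((p 0).re * (p (r * σ) / ((1 - r : ℝ) : ℂ)).re) := by
    filter_upwards [radial_mem_unitDisk hσ] with r hr
    have h := harnack_sq hp hre (z := 0) (by simp) hr.1
    rw [hr.2.1] at h
    simp only [norm_zero, mul_zero, sub_zero, norm_one, one_pow, mul_one, ne_eq,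
      OfNat.ofNat_ne_zero, not_false_eq_true, zero_pow] at h
    have h1 : 0 < 1 - r := by linarith [hr.2.2]
    rw [Complex.div_ofReal_re, mul_div_assoc', mul_div_assoc', le_div_iff₀ h1]
    nlinarith
  have hid : Tendsto (fun r : ℝ => r) (𝓝[<] 1) (𝓝 1) := tendsto_nhdsWithin_of_tendsto_nhds tendsto_id
  have l1 : Tendsto (fun r : ℝ => (1 + r) * ‖p 0 + (starRingEnd ℂ) (p (r * σ))‖ ^ 2) (𝓝[<] 1)
      (𝓝 ((1 + 1) * ‖p 0 + (starRingEnd ℂ) 0‖ ^ 2)) :=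
    (hid.const_add 1).mul
      ((((Complex.continuous_conj.tendsto _).comp hp0).const_add (p 0)).norm.pow 2)
  have l2 := (((Complex.continuous_re.tendsto _).comp hlim).const_mul (p 0).re).const_mul 4
  have h := le_of_tendsto_of_tendsto l1 l2 key
  rw [map_zero, add_zero, ofReal_re] at h
  have h0 : 0 < ‖p 0‖ := norm_pos_iff.mpr fun h0 => by simp [h0] at hpos
  by_contra hb
  push Not at hb
  nlinarith [mul_nonneg hpos.le (neg_nonneg.mpr hb), pow_pos h0 2]

/-- Removing finitely many boundary point masses from a function with nonnegative real part. -/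
theorem re_sub_sum_nonneg {ι : Type*} {q : ℂ → ℂ} (hq : DifferentiableOn ℂ q unitDisk)
    (hre : ∀ z ∈ unitDisk, 0 ≤ (q z).re) {σ : ι → ℂ} (hσ : ∀ k, ‖σ k‖ = 1)
    (hinj : Function.Injective σ) {β : ι → ℝ} (hβ : ∀ k, 0 < β k)
    (hlim : ∀ k, Tendsto (fun r : ℝ => ((1 - r : ℝ) : ℂ) * q (r * σ k)) (𝓝[<] 1)
      (𝓝 (β k : ℂ))) (s : Finset ι) :
    ∀ z ∈ unitDisk, 0 ≤ (q z - ∑ k ∈ s, ((β k / 2 : ℝ) : ℂ) * ((σ k + z) / (σ k - z))).re := by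
  classical
  have hdiff : ∀ s : Finset ι, DifferentiableOn ℂ
      (fun z => q z - ∑ k ∈ s, ((β k / 2 : ℝ) : ℂ) * ((σ k + z) / (σ k - z))) unitDisk := by
    intro s
    refine hq.sub (DifferentiableOn.fun_sum fun k _ => DifferentiableOn.const_mul ?_ _)
    exact DifferentiableOn.div (by fun_prop) (by fun_prop) fun z hz => ne_of_norm_one (hσ k) hz
  induction s using Finset.induction_on with
  | empty => simpa using hre
  | insert k s hk ih =>
    intro z hz
    have hj := julia (hdiff s) ih (hσ k) (hβ k) ?_ hz
    · rw [Finset.sum_insert hk, add_comm, ← sub_sub]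
      exact hj
    -- The terms already subtracted are regular at σ_k since the points are distinct; the factor 1 -
    -- r kills them and the mass at σ_k is unchanged.
    · have h1 : Tendsto (fun r : ℝ => ∑ j ∈ s, ((β j / 2 : ℝ) : ℂ) *
          ((σ j + r * σ k) / (σ j - r * σ k))) (𝓝[<] 1)
          (𝓝 (∑ j ∈ s, ((β j / 2 : ℝ) : ℂ) *
          ((σ j + (1 : ℝ) * σ k) / (σ j - (1 : ℝ) * σ k)))) := by
        refine tendsto_nhdsWithin_of_tendsto_nhds (tendsto_finsetSum _ fun j hj =>
          Tendsto.const_mul _ (Tendsto.div (Continuous.tendsto (by fun_prop) 1)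
          (Continuous.tendsto (by fun_prop) 1) ?_))
        rw [ofReal_one, one_mul]
        refine sub_ne_zero.mpr fun h => ?_
        rw [hinj h] at hj
        exact hk hj
      have h2 := (hlim k).sub (tendsto_one_sub_ofReal.mul h1)
      rw [zero_mul, sub_zero] at h2
      refine h2.congr fun r => ?_
      rw [mul_sub]

variable {n : ℕ} {τ : ℂ} {σ : Fin n → ℂ} {lam : Fin n → ℝ}

theorem alpha_pos (hτ : τ ∈ unitDisk) (hσ : ∀ k, ‖σ k‖ = 1) (hlam : ∀ k, lam k < 0) (k : Fin n) :
    0 < alpha τ σ lam k := by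
  have h1 : 0 < ‖τ - σ k‖ := by
    rw [norm_sub_rev]; exact norm_pos_iff.mpr (ne_of_norm_one (hσ k) hτ)
  have h2 := abs_pos.mpr (hlam k).ne
  unfold alpha
  positivity

theorem differentiableOn_p₀ (hσ : ∀ k, ‖σ k‖ = 1) : DifferentiableOn ℂ (p₀ τ σ lam) unitDisk :=
  DifferentiableOn.fun_sum fun k _ => DifferentiableOn.const_mul
    (DifferentiableOn.div (by fun_prop) (by fun_prop) fun _ hz => ne_of_norm_one (hσ k) hz) _

theorem p₀_re_pos (hn : 0 < n) (hτ : τ ∈ unitDisk) (hσ : ∀ k, ‖σ k‖ = 1) (hlam : ∀ k, lam k < 0)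
    {z : ℂ} (hz : z ∈ unitDisk) : 0 < (p₀ τ σ lam z).re := by
  have : Nonempty (Fin n) := ⟨⟨0, hn⟩⟩
  rw [p₀, Complex.re_sum]
  refine Finset.sum_pos (fun k _ => ?_) Finset.univ_nonempty
  rw [re_ofReal_mul]
  exact mul_pos (alpha_pos hτ hσ hlam k) (poisson_re_pos (hσ k) hz)

/-- Every nontrivial element of the class is `(τ - z)(1 - conj τ z) / (f z + p₀ z)` for a function
`f` with nonnegative real part. -/
theorem exists_repr (hn : 0 < n) (hτ : τ ∈ unitDisk) (hσ : ∀ k, ‖σ k‖ = 1)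
    (hinj : Function.Injective σ) (hlam : ∀ k, lam k < 0) {G : ℂ → ℂ} (hG : G ∈ Gen τ σ lam)
    (hG0 : ¬ EqOn G 0 unitDisk) :
    ∃ f : ℂ → ℂ, DifferentiableOn ℂ f unitDisk ∧ (∀ z ∈ unitDisk, 0 ≤ (f z).re) ∧
      ∀ z ∈ unitDisk, G z =
        (τ - z) * (1 - (starRingEnd ℂ) τ * z) / (f z + p₀ τ σ lam z) := by
  obtain ⟨φ, hg, hdw, hbr⟩ := hG
  obtain ⟨p, hp, hre, hGp⟩ := hg.exists_berksonPorta hτ fun t ht => hdw.fix hτ ht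
  choose l hl1 hl2 hbr using hbr
  have hrad := fun k => tendsto_radial_of_hasAngularLimit hτ (hσ k) hGp (hbr k).2
  have hpos : ∀ z ∈ unitDisk, 0 < (p z).re := by
    intro z hz
    refine lt_of_le_of_ne (hre z hz) fun h => hG0 ?_
    have hc := eqOn_const_of_re_eq_zero hp hre hz h.symm
    -- A constant p with a finite limit of p(rσ)/(1 - r) must vanish; here at least one boundary
    -- point is needed.
    have hz0 : p z = 0 := by
      have h1 := (hrad ⟨0, hn⟩).mul tendsto_one_sub_ofReal
      rw [mul_zero] at h1
      refine tendsto_nhds_unique (Tendsto.congr' ?_ tendsto_const_nhds) h1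
      filter_upwards [radial_mem_unitDisk (hσ ⟨0, hn⟩)] with r hr
      have h1r : ((1 - r : ℝ) : ℂ) ≠ 0 := by exact_mod_cast (by linarith [hr.2.2] : 1 - r ≠ 0)
      rw [div_mul_cancel₀ _ h1r, hc _ hr.1]
    intro w hw
    rw [hGp w hw, hc w hw, hz0]
    simp
  have hne : ∀ z ∈ unitDisk, p z ≠ 0 := fun z hz h => by
    have := hpos z hz
    simp [h] at this
  have hτσ : ∀ k, 0 < ‖τ - σ k‖ := fun k => by
    rw [norm_sub_rev]; exact norm_pos_iff.mpr (ne_of_norm_one (hσ k) hτ)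
  have hb : ∀ k, 0 < -l k / ‖τ - σ k‖ ^ 2 := fun k =>
    radial_limit_pos hp hre (hpos 0 (by simp)) (hσ k) (hrad k)
  have hlneg : ∀ k, l k < 0 := fun k => by
    have h2 : 0 < ‖τ - σ k‖ ^ 2 := pow_pos (hτσ k) 2
    have h1 := mul_pos (hb k) h2
    rw [div_mul_cancel₀ _ h2.ne'] at h1
    linarith
  have hq : DifferentiableOn ℂ (fun z => (p z)⁻¹) unitDisk := hp.inv hne
  have hqre : ∀ z ∈ unitDisk, 0 ≤ ((p z)⁻¹).re := fun z hz => by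
    rw [Complex.inv_re]
    exact div_nonneg (hre z hz) (Complex.normSq_nonneg _)
  -- The mass of 1/p at σ_k is |τ - σ_k|²/(2|l_k|), which is at least α_k because |l_k| ≤ |λ_k|.
  -- Subtracting only α_k therefore preserves the sign of the real part.
  have hsub := re_sub_sum_nonneg hq hqre hσ hinj (β := fun k => (-l k / ‖τ - σ k‖ ^ 2)⁻¹)
    (fun k => inv_pos.mpr (hb k)) (fun k => by
      have h1 := (hrad k).inv₀ (by exact_mod_cast (hb k).ne')
      rw [← ofReal_inv] at h1
      refine h1.congr fun r => ?_
      rw [inv_div, div_eq_mul_inv]) Finset.univ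
  refine ⟨fun z => (p z)⁻¹ - p₀ τ σ lam z, hq.sub (differentiableOn_p₀ hσ), fun z hz => ?_,
    fun z hz => ?_⟩
  · refine (hsub z hz).trans ?_
    rw [sub_re, sub_re]
    refine sub_le_sub_left ?_ _
    rw [p₀, Complex.re_sum, Complex.re_sum]
    refine Finset.sum_le_sum fun k _ => ?_
    rw [re_ofReal_mul, re_ofReal_mul]
    refine mul_le_mul_of_nonneg_right ?_ (poisson_re_pos (hσ k) hz).le
    rw [alpha, inv_div, div_div, abs_of_neg (hlam k), mul_comm (-l k)]
    refine div_le_div_of_nonneg_left (by positivity) (by linarith [hlneg k]) ?_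
    linarith [hl1 k]
  · rw [sub_add_cancel, div_inv_eq_mul, hGp z hz]

/-! ### Generators given by explicit formulas -/

theorem stolz_subset_unitDisk (σ : ℂ) (M : ℝ) : stolz σ M ⊆ unitDisk :=
  fun _ hz => mem_unitDisk.mpr hz.1

theorem hasAngularLimit_of_tendsto {f : ℂ → ℂ} {σ L : ℂ}
    (h : Tendsto f (𝓝[unitDisk] σ) (𝓝 L)) : HasAngularLimit f σ L :=
  fun M => h.mono_left (nhdsWithin_mono _ (stolz_subset_unitDisk σ M))

/-- The simple pole of the denominator makes G = (σ - z)M(z) with M differentiable at σ and M(σ) =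
l. Thus G + l(z - σ) = O(|z - σ|²), and linearization gives the angular derivative exp(-lt). -/
theorem hasBRFPWithSpectralValue_of_pole {G : ℂ → ℂ} {φ : ℝ → ℂ → ℂ} (hg : IsGeneratorOf G φ)
    {τ σ : ℂ} (hσ : ‖σ‖ = 1) {c : ℝ} (hc : 0 < c) {r : ℂ → ℂ} (hr : DifferentiableAt ℂ r σ)
    (hG : ∀ z ∈ unitDisk, G z =
      (τ - z) * (1 - (starRingEnd ℂ) τ * z) / ((c : ℂ) * ((σ + z) / (σ - z)) + r z)) :
    HasBRFPWithSpectralValue G φ σ (-(‖τ - σ‖ ^ 2 / (2 * c))) := by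
  have hσ0 : σ ≠ 0 := by rintro rfl; simp at hσ
  have hc0 : (c : ℂ) ≠ 0 := by exact_mod_cast hc.ne'
  set l : ℝ := -(‖τ - σ‖ ^ 2 / (2 * c)) with hl
  set M : ℂ → ℂ := fun z =>
    (τ - z) * (1 - (starRingEnd ℂ) τ * z) / (c * (σ + z) + r z * (σ - z)) with hM
  have hMd : DifferentiableAt ℂ M σ := by
    refine DifferentiableAt.div (by fun_prop) (by fun_prop) ?_
    rw [sub_self, mul_zero, add_zero, ← two_mul]
    exact mul_ne_zero hc0 (mul_ne_zero two_ne_zero hσ0)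
  have hMσ : M σ = l := by
    simp only [hM]
    rw [berksonPorta_factor_boundary hσ, sub_self, mul_zero, add_zero, hl]
    push_cast
    field_simp
    ring
  have hGM : ∀ z ∈ unitDisk, G z = (σ - z) * M z := by
    intro z hz
    have h0 := ne_of_norm_one hσ hz
    rw [hG z hz, ← mul_div_assoc, div_add' _ _ _ h0, div_div_eq_mul_div, hM]
    ring
  have hMt : Tendsto M (𝓝[unitDisk] σ) (𝓝 (l : ℂ)) := by
    rw [← hMσ]
    exact tendsto_nhdsWithin_of_tendsto_nhds hMd.continuousAt
  obtain ⟨C, hC⟩ := hMd.isBigO_sub.bound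
  obtain ⟨δ, hδ, hball⟩ := Metric.eventually_nhds_iff_ball.mp hC
  have hid : Tendsto (fun z : ℂ => z - σ) (𝓝[unitDisk] σ) (𝓝 0) := by
    have : Tendsto (fun z : ℂ => z - σ) (𝓝 σ) (𝓝 (σ - σ)) :=
      (continuous_id.sub continuous_const).tendsto σ
    rw [sub_self] at this
    exact tendsto_nhdsWithin_of_tendsto_nhds this
  refine ⟨fun t ht => ?_, hasAngularLimit_of_tendsto (hMt.congr' ?_)⟩
  · have h := hg.tendsto_div_of_zero (q := σ) (g₀ := -(l : ℂ)) (C := C) (δ := δ / 2) (by linarith)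
      (fun z hz hzδ => by
        have h1 := hball z (by rw [Metric.mem_ball, dist_eq_norm]; linarith)
        rw [hMσ] at h1
        have h2 : G z - -(l : ℂ) * (z - σ) = -((z - σ) * (M z - l)) := by rw [hGM z hz]; ring
        rw [h2, norm_neg, norm_mul]
        nlinarith [norm_nonneg (z - σ)]) ht
    have hset : unitDisk \ {σ} = unitDisk := sdiff_singleton_eq_self fun h => by
      rw [mem_unitDisk, hσ] at h
      exact lt_irrefl _ h
    rw [hset] at h
    refine ⟨_, hσ, hasAngularLimit_of_tendsto ?_, hasAngularLimit_of_tendsto h⟩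
    have h1 := (h.mul hid).add_const σ
    rw [mul_zero, zero_add] at h1
    refine h1.congr' ?_
    filter_upwards [self_mem_nhdsWithin] with z hz
    have h0 : z - σ ≠ 0 := by rw [← neg_sub]; exact neg_ne_zero.mpr (ne_of_norm_one hσ hz)
    rw [div_mul_cancel₀ _ h0, sub_add_cancel]
  · filter_upwards [self_mem_nhdsWithin] with z hz
    rw [hGM z hz, mul_div_cancel_left₀ _ (ne_of_norm_one hσ hz)]

theorem p₀_zero (hσ : ∀ k, ‖σ k‖ = 1) : p₀ τ σ lam 0 = (sumAlpha τ σ lam : ℂ) := by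
  rw [p₀, sumAlpha, ofReal_sum]
  refine Finset.sum_congr rfl fun k _ => ?_
  have : σ k ≠ 0 := by intro h; have := hσ k; simp [h] at this
  rw [add_zero, sub_zero, div_self this, mul_one]

theorem sumAlpha_pos (hn : 0 < n) (hτ : τ ∈ unitDisk) (hσ : ∀ k, ‖σ k‖ = 1)
    (hlam : ∀ k, lam k < 0) : 0 < sumAlpha τ σ lam := by
  have : Nonempty (Fin n) := ⟨⟨0, hn⟩⟩
  exact Finset.sum_pos (fun k _ => alpha_pos hτ hσ hlam k) Finset.univ_nonempty

theorem add_p₀_re_pos (hn : 0 < n) (hτ : τ ∈ unitDisk) (hσ : ∀ k, ‖σ k‖ = 1)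
    (hlam : ∀ k, lam k < 0) {f : ℂ → ℂ} (hre : ∀ z ∈ unitDisk, 0 ≤ (f z).re) {z : ℂ}
    (hz : z ∈ unitDisk) : 0 < (f z + p₀ τ σ lam z).re := by
  rw [add_re]
  exact add_pos_of_nonneg_of_pos (hre z hz) (p₀_re_pos hn hτ hσ hlam hz)

theorem ne_zero_of_re_pos {w : ℂ} (h : 0 < w.re) : w ≠ 0 := by
  rintro rfl
  simp at h

/-- Functions of the form `(τ - z)(1 - conj τ z) / (f z + p₀ z)` generate semigroups, with known
data at `0` and at `τ`. -/
theorem exists_generator_of_repr (hn : 0 < n) (hτ : τ ∈ unitDisk) (hσ : ∀ k, ‖σ k‖ = 1)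
    (hlam : ∀ k, lam k < 0) {f G : ℂ → ℂ} (hf : DifferentiableOn ℂ f unitDisk)
    (hre : ∀ z ∈ unitDisk, 0 ≤ (f z).re)
    (hG : ∀ z ∈ unitDisk, G z =
        (τ - z) * (1 - (starRingEnd ℂ) τ * z) / (f z + p₀ τ σ lam z)) :
    G 0 = τ / (f 0 + sumAlpha τ σ lam) ∧
    (∀ w, HasSpectralValue G τ w ↔ w = ((1 - ‖τ‖ ^ 2 : ℝ) : ℂ) / (f τ + p₀ τ σ lam τ)) ∧
    ∃ φ, IsGeneratorOf G φ ∧ IsSemigroupDWPoint φ τ := by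
  have hτ1 := mem_unitDisk.mp hτ
  have hpos := fun z (hz : z ∈ unitDisk) => add_p₀_re_pos hn hτ hσ hlam hre hz
  have hp : DifferentiableOn ℂ (fun z => (f z + p₀ τ σ lam z)⁻¹) unitDisk :=
    (hf.add (differentiableOn_p₀ hσ)).inv fun z hz => ne_zero_of_re_pos (hpos z hz)
  have hpre : ∀ z ∈ unitDisk, 0 ≤ ((f z + p₀ τ σ lam z)⁻¹).re := fun z hz => by
    rw [Complex.inv_re]
    exact div_nonneg (hpos z hz).le (Complex.normSq_nonneg _)
  have hG' : ∀ z ∈ unitDisk, G z =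
      (τ - z) * (1 - (starRingEnd ℂ) τ * z) * (f z + p₀ τ σ lam z)⁻¹ := fun z hz => by
    rw [hG z hz, div_eq_mul_inv]
  obtain ⟨φ, hg⟩ := exists_isGeneratorOf hτ1 hp hpre hG'
  have h0 : G τ = 0 := by rw [hG τ hτ]; simp
  have hd := hasDerivAt_berksonPorta hτ hp hG'
  refine ⟨?_, fun w => ?_, φ, hg, fun t ht _ => Or.inl ⟨hτ, hg.apply_eq_self hτ h0 ht, ?_⟩⟩
  · rw [hG 0 (by simp), p₀_zero hσ]
    simp
  · rw [hasSpectralValue_iff hg hτ h0, hd.deriv, neg_neg, div_eq_mul_inv]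
  · rw [(hg.hasDerivAt_of_zero hτ h0 ht).deriv, hd.deriv, Complex.norm_exp, Real.exp_le_one_iff,
      re_mul_ofReal, neg_re, re_ofReal_mul]
    have hD : 0 ≤ 1 - ‖τ‖ ^ 2 := by nlinarith [norm_nonneg τ]
    have := mul_nonneg (mul_nonneg hD (hpre τ hτ)) ht
    linarith

/-- The boundary pole of the kernel is where κz = 1. If this is σ_k, its mass increases from α_k to
α_k + Re L and the spectral value moves towards 0; otherwise the kernel is regular at σ_k and the
value is exactly λ_k. -/
theorem exists_spectral_data (hn : 0 < n) (hτ : τ ∈ unitDisk) (hσ : ∀ k, ‖σ k‖ = 1)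
    (hinj : Function.Injective σ) (hlam : ∀ k, lam k < 0) {L κ : ℂ} (hL : 0 ≤ L.re)
    (hκ : ‖κ‖ ≤ 1) {G : ℂ → ℂ}
    (hG : ∀ z ∈ unitDisk, G z =
        (τ - z) * (1 - (starRingEnd ℂ) τ * z) / (herglotz L κ z + p₀ τ σ lam z)) :
    ∃ φ, IsGeneratorOf G φ ∧ IsSemigroupDWPoint φ τ ∧ ∀ k, ∃ l : ℝ, lam k ≤ l ∧ l ≤ 0 ∧
      (κ * σ k ≠ 1 ∨ L.re = 0 → l = lam k) ∧ HasBRFPWithSpectralValue G φ (σ k) l := by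
  classical
  obtain ⟨-, -, φ, hg, hdw⟩ := exists_generator_of_repr hn hτ hσ hlam
    (differentiableOn_herglotz L hκ) (fun z hz => herglotz_re_nonneg hL hκ hz) hG
  refine ⟨φ, hg, hdw, fun k => ?_⟩
  have hα := alpha_pos hτ hσ hlam k
  have hτσ : 0 < ‖τ - σ k‖ := by
    rw [norm_sub_rev]; exact norm_pos_iff.mpr (ne_of_norm_one (hσ k) hτ)
  have hlα : lam k = -(‖τ - σ k‖ ^ 2 / (2 * alpha τ σ lam k)) := by
    rw [alpha, abs_of_neg (hlam k)]
    have := (hlam k).ne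
    field_simp
  set R : ℂ → ℂ := fun z => ∑ j ∈ Finset.univ.erase k,
    (alpha τ σ lam j : ℂ) * ((σ j + z) / (σ j - z)) with hR
  have hRd : DifferentiableAt ℂ R (σ k) := by
    refine DifferentiableAt.fun_sum fun j hj => DifferentiableAt.const_mul ?_ _
    refine DifferentiableAt.div (by fun_prop) (by fun_prop) (sub_ne_zero.mpr fun h => ?_)
    exact (Finset.ne_of_mem_erase hj) (hinj h)
  have hp : ∀ z, p₀ τ σ lam z = (alpha τ σ lam k : ℂ) * ((σ k + z) / (σ k - z)) + R z := by
    intro z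
    rw [hR, p₀, Finset.add_sum_erase _ (fun j => (alpha τ σ lam j : ℂ) * ((σ j + z) / (σ j - z)))
      (Finset.mem_univ k)]
  by_cases hκσ : κ * σ k = 1
  · have hκc : κ = (starRingEnd ℂ) (σ k) := by
      have h1 := conj_mul_self_of_norm_one (hσ k)
      exact mul_right_cancel₀ (right_ne_zero_of_mul_eq_one h1) (hκσ.trans h1.symm)
    refine ⟨-(‖τ - σ k‖ ^ 2 / (2 * (alpha τ σ lam k + L.re))), ?_, ?_, ?_,
      hasBRFPWithSpectralValue_of_pole hg (hσ k) (by positivity)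
        (r := fun z => I * (L.im : ℂ) + R z) (by fun_prop) fun z hz => ?_⟩
    · rw [hlα, neg_le_neg_iff]
      exact div_le_div_of_nonneg_left (by positivity) (by positivity) (by linarith)
    · rw [neg_nonpos]
      positivity
    · rintro (h | h)
      · exact absurd hκσ h
      · rw [h, add_zero, hlα]
    · rw [hG z hz, hp, herglotz, hκc, ← poisson_eq (hσ k)]
      congr 1
      push_cast
      ring
  · refine ⟨lam k, le_rfl, (hlam k).le, fun _ => rfl, ?_⟩
    rw [hlα]
    refine hasBRFPWithSpectralValue_of_pole hg (hσ k) hα (r := fun z => herglotz L κ z + R z) ?_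
      fun z hz => ?_
    · refine DifferentiableAt.add ?_ hRd
      unfold herglotz
      refine DifferentiableAt.add_const _ (DifferentiableAt.mul_const ?_ _)
      exact DifferentiableAt.div (by fun_prop) (by fun_prop)
        (sub_ne_zero.mpr fun h => hκσ h.symm)
    · rw [hG z hz, hp]
      congr 1
      ring

theorem mem_gen_of_herglotz (hn : 0 < n) (hτ : τ ∈ unitDisk) (hσ : ∀ k, ‖σ k‖ = 1)
    (hinj : Function.Injective σ) (hlam : ∀ k, lam k < 0) {L κ : ℂ} (hL : 0 ≤ L.re)
    (hκ : ‖κ‖ ≤ 1) {G : ℂ → ℂ}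
    (hG : ∀ z ∈ unitDisk, G z =
        (τ - z) * (1 - (starRingEnd ℂ) τ * z) / (herglotz L κ z + p₀ τ σ lam z)) :
    G ∈ Gen τ σ lam := by
  obtain ⟨φ, hg, hdw, h⟩ := exists_spectral_data hn hτ hσ hinj hlam hL hκ hG
  exact ⟨φ, hg, hdw, fun k => let ⟨l, h1, h2, _, h3⟩ := h k; ⟨l, h1, h2, h3⟩⟩

theorem mem_genExact_of_herglotz (hn : 0 < n) (hτ : τ ∈ unitDisk) (hσ : ∀ k, ‖σ k‖ = 1)
    (hinj : Function.Injective σ) (hlam : ∀ k, lam k < 0) {L κ : ℂ} (hL : 0 ≤ L.re)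
    (hκ : ‖κ‖ ≤ 1) (hex : ∀ k, κ * σ k ≠ 1 ∨ L.re = 0) {G : ℂ → ℂ}
    (hG : ∀ z ∈ unitDisk, G z =
        (τ - z) * (1 - (starRingEnd ℂ) τ * z) / (herglotz L κ z + p₀ τ σ lam z)) :
    G ∈ GenExact τ σ lam := by
  obtain ⟨φ, hg, hdw, h⟩ := exists_spectral_data hn hτ hσ hinj hlam hL hκ hG
  exact ⟨φ, hg, hdw, fun k => let ⟨_, _, _, h2, h3⟩ := h k; h2 (hex k) ▸ h3⟩

/-- The trivial generator. -/
theorem zero_mem_gen (hτ : τ ∈ unitDisk) (hσ : ∀ k, ‖σ k‖ = 1) (hlam : ∀ k, lam k < 0)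
    {G : ℂ → ℂ} (hG : EqOn G 0 unitDisk) :
    G ∈ Gen τ σ lam ∧ ∀ w, HasSpectralValue G τ w ↔ w = 0 := by
  have hg : IsGeneratorOf G fun _ => id := by
    refine ⟨⟨fun _ _ => differentiableOn_id, fun _ _ => mapsTo_id _, fun _ _ => rfl,
      fun _ _ _ _ _ _ => rfl, fun z _ => tendsto_const_nhds⟩,
      (differentiableOn_const 0).congr hG, fun z hz t _ => ?_⟩
    have h0 : G (id z) = 0 := hG hz
    rw [h0]
    exact hasDerivWithinAt_const _ _ _
  refine ⟨⟨fun _ => id, hg, fun t _ h => absurd (eqOn_refl _ _) h, fun k => ⟨0, (hlam k).le, le_rfl,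
    fun t _ => ⟨1, hσ k, ?_, ?_⟩, ?_⟩⟩, fun w => ?_⟩
  · exact hasAngularLimit_of_tendsto (tendsto_nhdsWithin_of_tendsto_nhds tendsto_id)
  · refine hasAngularLimit_of_tendsto (Tendsto.congr' ?_ tendsto_const_nhds)
    filter_upwards [self_mem_nhdsWithin] with z hz
    have h0 : z - σ k ≠ 0 := by rw [← neg_sub]; exact neg_ne_zero.mpr (ne_of_norm_one (hσ k) hz)
    exact (div_self h0).symm
  · refine hasAngularLimit_of_tendsto (Tendsto.congr' ?_ tendsto_const_nhds)
    filter_upwards [self_mem_nhdsWithin] with z hz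
    rw [hG hz]
    simp
  · have hd : HasDerivAt G 0 τ := (hasDerivAt_const τ (0 : ℂ)).congr_of_eventuallyEq
      (mem_of_superset (isOpen_unitDisk.mem_nhds hτ) hG)
    rw [hasSpectralValue_iff hg hτ (hG hτ), hd.deriv, neg_zero]

/-! ### The sets `Z` and `Ω_ζ` -/

theorem regionZ_eq_closedBall (hτ0 : τ ≠ 0) (hA : 0 < sumAlpha τ σ lam) :
    regionZ τ σ lam =
      Metric.closedBall (τ / (2 * sumAlpha τ σ lam : ℝ)) (‖τ‖ / (2 * sumAlpha τ σ lam)) := by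
  ext ζ
  have hA' : (sumAlpha τ σ lam : ℂ) ≠ 0 := by exact_mod_cast hA.ne'
  have h1 : ζ - τ / (2 * sumAlpha τ σ lam : ℝ) = τ / (2 * sumAlpha τ σ lam : ℝ) *
      (2 * τ⁻¹ * (sumAlpha τ σ lam : ℂ) * ζ - 1) := by
    push_cast
    field_simp
  have h2 : 0 < ‖τ‖ / (2 * sumAlpha τ σ lam) := by
    have := norm_pos_iff.mpr hτ0
    positivity
  rw [mem_closedBall_iff_norm, h1, norm_mul, norm_div, Complex.norm_of_nonneg (by positivity),
    mul_le_iff_le_one_right h2]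
  rfl

theorem mem_interior_regionZ_iff_norm (hτ0 : τ ≠ 0) (hA : 0 < sumAlpha τ σ lam) (ζ : ℂ) :
    ζ ∈ interior (regionZ τ σ lam) ↔ ‖2 * τ⁻¹ * (sumAlpha τ σ lam : ℂ) * ζ - 1‖ < 1 := by
  have hA' : (sumAlpha τ σ lam : ℂ) ≠ 0 := by exact_mod_cast hA.ne'
  have h1 : ζ - τ / (2 * sumAlpha τ σ lam : ℝ) = τ / (2 * sumAlpha τ σ lam : ℝ) *
      (2 * τ⁻¹ * (sumAlpha τ σ lam : ℂ) * ζ - 1) := by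
    push_cast
    field_simp
  have h2 : 0 < ‖τ‖ / (2 * sumAlpha τ σ lam) := by
    have := norm_pos_iff.mpr hτ0
    positivity
  rw [regionZ_eq_closedBall hτ0 hA, interior_closedBall _ h2.ne', mem_ball_iff_norm, h1, norm_mul,
    norm_div, Complex.norm_of_nonneg (by positivity), mul_lt_iff_lt_one_right h2]

/-- For u = 2Aζ/τ one has ℓ_ζ = A(2/u - 1) and |u|² Re(2/u - 1) = 1 - |u - 1|²: inversion takes a
disk with 0 on its boundary to a half-plane. This identifies Z, its interior and its frontier by the
sign of Re ℓ_ζ. -/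
theorem ell_re_mul (hτ0 : τ ≠ 0) (hA : 0 < sumAlpha τ σ lam) {ζ : ℂ} (hζ : ζ ≠ 0) :
    (ell τ σ lam ζ).re * ‖2 * τ⁻¹ * (sumAlpha τ σ lam : ℂ) * ζ‖ ^ 2 =
      sumAlpha τ σ lam * (1 - ‖2 * τ⁻¹ * (sumAlpha τ σ lam : ℂ) * ζ - 1‖ ^ 2) := by
  have hA' : (sumAlpha τ σ lam : ℂ) ≠ 0 := by exact_mod_cast hA.ne'
  set u := 2 * τ⁻¹ * (sumAlpha τ σ lam : ℂ) * ζ with hu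
  have hu0 : u ≠ 0 :=
    mul_ne_zero (mul_ne_zero (mul_ne_zero two_ne_zero (inv_ne_zero hτ0)) hA') hζ
  have h1 : ell τ σ lam ζ = ((2 * sumAlpha τ σ lam : ℝ) : ℂ) * u⁻¹ - (sumAlpha τ σ lam : ℂ) := by
    rw [ell, hu]
    push_cast
    field_simp
  have h3 : Complex.normSq u ≠ 0 := by simpa using hu0
  rw [h1, sub_re, re_ofReal_mul, inv_re, ofReal_re, ← Complex.normSq_eq_norm_sq,
    ← Complex.normSq_eq_norm_sq]
  rw [sub_mul, mul_assoc, div_mul_cancel₀ _ h3]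
  simp only [Complex.normSq_apply, sub_re, sub_im, one_re, one_im]
  ring

theorem zero_mem_regionZ : (0 : ℂ) ∈ regionZ τ σ lam := by
  simp [regionZ]

theorem mem_regionZ_iff (hτ0 : τ ≠ 0) (hA : 0 < sumAlpha τ σ lam) {ζ : ℂ} (hζ : ζ ≠ 0) :
    ζ ∈ regionZ τ σ lam ↔ 0 ≤ (ell τ σ lam ζ).re := by
  have h := ell_re_mul hτ0 hA hζ
  have hA' : (sumAlpha τ σ lam : ℂ) ≠ 0 := by exact_mod_cast hA.ne'
  have hu0 : 0 < ‖2 * τ⁻¹ * (sumAlpha τ σ lam : ℂ) * ζ‖ ^ 2 := pow_pos (norm_pos_iff.mpr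
    (mul_ne_zero (mul_ne_zero (mul_ne_zero two_ne_zero (inv_ne_zero hτ0)) hA') hζ)) 2
  rw [← mul_nonneg_iff_of_pos_right hu0, h, mul_nonneg_iff_of_pos_left hA, sub_nonneg,
    sq_le_one_iff₀ (norm_nonneg _)]
  rfl

theorem mem_interior_regionZ_iff (hτ0 : τ ≠ 0) (hA : 0 < sumAlpha τ σ lam) {ζ : ℂ} :
    ζ ∈ interior (regionZ τ σ lam) ↔ ζ ≠ 0 ∧ 0 < (ell τ σ lam ζ).re := by
  rw [mem_interior_regionZ_iff_norm hτ0 hA]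
  by_cases hζ : ζ = 0
  · simp [hζ]
  have h := ell_re_mul hτ0 hA hζ
  have hA' : (sumAlpha τ σ lam : ℂ) ≠ 0 := by exact_mod_cast hA.ne'
  have hu0 : 0 < ‖2 * τ⁻¹ * (sumAlpha τ σ lam : ℂ) * ζ‖ ^ 2 := pow_pos (norm_pos_iff.mpr
    (mul_ne_zero (mul_ne_zero (mul_ne_zero two_ne_zero (inv_ne_zero hτ0)) hA') hζ)) 2
  rw [← mul_pos_iff_of_pos_right hu0, h, mul_pos_iff_of_pos_left hA, sub_pos,
    sq_lt_one_iff₀ (norm_nonneg _)]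
  simp [hζ]

theorem isClosed_regionZ : IsClosed (regionZ τ σ lam) :=
  isClosed_le (by fun_prop) continuous_const

theorem mem_frontier_regionZ_iff (hτ0 : τ ≠ 0) (hA : 0 < sumAlpha τ σ lam) {ζ : ℂ} :
    ζ ∈ frontier (regionZ τ σ lam) ↔ ζ = 0 ∨ (ζ ≠ 0 ∧ (ell τ σ lam ζ).re = 0) := by
  rw [isClosed_regionZ.frontier_eq, Set.mem_sdiff, mem_interior_regionZ_iff hτ0 hA]
  by_cases hζ : ζ = 0
  · simp [hζ, zero_mem_regionZ]
  · rw [mem_regionZ_iff hτ0 hA hζ]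
    simp only [hζ, ne_eq, not_false_eq_true, true_and, not_lt, false_or]
    exact ⟨fun h => le_antisymm h.2 h.1, fun h => ⟨h.ge, h.le⟩⟩

/-- The image of a disk not containing `0` under `u ↦ K / u`. -/
theorem inversion_closedBall {K R : ℝ} (hK : 0 < K) (hR : 0 ≤ R) {a : ℂ} (ha : R < ‖a‖) :
    {ω : ℂ | ω ≠ 0 ∧ ‖(K : ℂ) / ω - a‖ ≤ R} =
      Metric.closedBall (((K / (‖a‖ ^ 2 - R ^ 2) : ℝ) : ℂ) * (starRingEnd ℂ) a)
        (K / (‖a‖ ^ 2 - R ^ 2) * R) := by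
  have hd : 0 < ‖a‖ ^ 2 - R ^ 2 := by nlinarith
  set t := K / (‖a‖ ^ 2 - R ^ 2) with ht
  have ht0 : 0 < t := by positivity
  have hKt : K = t * (‖a‖ ^ 2 - R ^ 2) := by rw [ht, div_mul_cancel₀ _ hd.ne']
  -- The choice of t makes the squared disk inequality for ω proportional to that for K/ω once the
  -- denominator is cleared.
  have key : ∀ ω : ℂ, (‖a‖ ^ 2 - R ^ 2) * (‖ω - (t : ℂ) * (starRingEnd ℂ) a‖ ^ 2 - (t * R) ^ 2) =
      ‖(K : ℂ) - a * ω‖ ^ 2 - (R * ‖ω‖) ^ 2 := by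
    intro ω
    rw [hKt, mul_pow R]
    simp only [← Complex.normSq_eq_norm_sq, Complex.normSq_apply, sub_re, sub_im, mul_re, mul_im,
      ofReal_re, ofReal_im, conj_re, conj_im]
    ring
  have hiff : ∀ ω : ℂ, ‖ω - (t : ℂ) * (starRingEnd ℂ) a‖ ≤ t * R ↔
      ‖(K : ℂ) - a * ω‖ ≤ R * ‖ω‖ := by
    intro ω
    rw [← pow_le_pow_iff_left₀ (norm_nonneg _) (by positivity) two_ne_zero,
      ← pow_le_pow_iff_left₀ (norm_nonneg ((K : ℂ) - a * ω)) (by positivity) two_ne_zero,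
      ← sub_nonpos, ← sub_nonpos (a := ‖(K : ℂ) - a * ω‖ ^ 2), ← key ω]
    constructor
    · intro h; exact mul_nonpos_of_nonneg_of_nonpos hd.le h
    · intro h; by_contra hc; push Not at hc; nlinarith [mul_pos hd hc]
  ext ω
  rw [mem_closedBall_iff_norm, hiff, mem_ofPred_eq]
  constructor
  · rintro ⟨h0, h⟩
    have : (K : ℂ) - a * ω = (K / ω - a) * ω := by field_simp
    rw [this, norm_mul]
    gcongr
  · intro h
    have h0 : ω ≠ 0 := by
      rintro rfl
      simp [hK.ne'] at h
    refine ⟨h0, ?_⟩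
    have : (K : ℂ) - a * ω = (K / ω - a) * ω := by field_simp
    rw [this, norm_mul] at h
    exact le_of_mul_le_mul_right h (norm_pos_iff.mpr h0)

/-- The disk to be inverted misses 0: its centre has real part larger than its radius, since 1 +
|τ|² ≥ 2|τ| and Re p₀(τ) > 0. The factored radius shows that it degenerates exactly when Re ℓ_ζ = 0.
-/
theorem regionΩ_eq (hn : 0 < n) (hτ : τ ∈ unitDisk) (hσ : ∀ k, ‖σ k‖ = 1)
    (hlam : ∀ k, lam k < 0) {ζ : ℂ} (hζ : ζ ≠ 0) (hre : 0 ≤ (ell τ σ lam ζ).re) :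
    ∃ c : ℂ, ∃ t : ℝ, 0 < t ∧ regionΩ τ σ lam ζ =
      Metric.closedBall c (t * (2 * ‖τ‖ / (1 - ‖τ‖ ^ 2) * (ell τ σ lam ζ).re)) := by
  have hτ1 := mem_unitDisk.mp hτ
  have hD : 0 < 1 - ‖τ‖ ^ 2 := by nlinarith [norm_nonneg τ]
  have hlt : 2 * ‖τ‖ / (1 - ‖τ‖ ^ 2) * (ell τ σ lam ζ).re < ‖centerA τ σ lam ζ‖ := by
    refine lt_of_lt_of_le ?_ (Complex.re_le_norm _)
    have h1 := p₀_re_pos hn hτ hσ hlam hτ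
    have h2 : 2 * ‖τ‖ / (1 - ‖τ‖ ^ 2) * (ell τ σ lam ζ).re ≤
        (1 + ‖τ‖ ^ 2) / (1 - ‖τ‖ ^ 2) * (ell τ σ lam ζ).re := by
      gcongr
      nlinarith [sq_nonneg (1 - ‖τ‖)]
    have h3 : (centerA τ σ lam ζ).re =
        (1 + ‖τ‖ ^ 2) / (1 - ‖τ‖ ^ 2) * (ell τ σ lam ζ).re + (p₀ τ σ lam τ).re := by
      rw [centerA, add_re, add_re, ofReal_re]
      simp
    linarith
  have hR : 0 ≤ 2 * ‖τ‖ / (1 - ‖τ‖ ^ 2) * (ell τ σ lam ζ).re := by positivity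
  have hd : 0 < ‖centerA τ σ lam ζ‖ ^ 2 -
      (2 * ‖τ‖ / (1 - ‖τ‖ ^ 2) * (ell τ σ lam ζ).re) ^ 2 := by nlinarith
  have h := inversion_closedBall hD hR hlt
  refine ⟨_, _, div_pos hD hd, Eq.trans ?_ h⟩
  rw [regionΩ, if_neg hζ]

/-- This returns from Ω_ζ to the Schwarz inequality for u = (1 - |τ|²)/ω - p₀(τ), the value taken by
f at τ. -/
theorem mem_regionΩ_iff (hτ : τ ∈ unitDisk) {ζ : ℂ} (hζ : ζ ≠ 0)
    (hre : 0 ≤ (ell τ σ lam ζ).re) (ω : ℂ) :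
    ω ∈ regionΩ τ σ lam ζ ↔ ω ≠ 0 ∧
      ‖((1 - ‖τ‖ ^ 2 : ℝ) : ℂ) / ω - p₀ τ σ lam τ - ell τ σ lam ζ‖ ≤
        ‖τ‖ * ‖((1 - ‖τ‖ ^ 2 : ℝ) : ℂ) / ω - p₀ τ σ lam τ
          + (starRingEnd ℂ) (ell τ σ lam ζ)‖ := by
  rw [(norm_sub_le_iff_disk (norm_nonneg τ) (mem_unitDisk.mp hτ) hre _ _ rfl rfl).1, regionΩ,
    if_neg hζ, mem_ofPred_eq, centerA, sub_sub _ (p₀ τ σ lam τ), add_comm (p₀ τ σ lam τ)]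

theorem p₀_re (hτ : τ ∈ unitDisk) (hσ : ∀ k, ‖σ k‖ = 1) :
    (p₀ τ σ lam τ).re = (1 - ‖τ‖ ^ 2) / 2 * ∑ k, 1 / |lam k| := by
  rw [p₀, Complex.re_sum, Finset.mul_sum]
  refine Finset.sum_congr rfl fun k _ => ?_
  rw [re_ofReal_mul, poisson_re (hσ k), alpha, norm_sub_rev]
  have := norm_pos_iff.mpr (ne_of_norm_one (hσ k) hτ)
  by_cases h : lam k = 0
  · simp [h]
  · have := abs_pos.mpr h
    field_simp

theorem p₀_im (hτ : τ ∈ unitDisk) (hσ : ∀ k, ‖σ k‖ = 1) :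
    (p₀ τ σ lam τ).im = sumB τ σ lam := by
  rw [p₀, Complex.im_sum, sumB]
  refine Finset.sum_congr rfl fun k _ => ?_
  have h0 := norm_pos_iff.mpr (ne_of_norm_one (hσ k) hτ)
  have h1 : ((σ k + τ) / (σ k - τ)).im =
      2 * ((starRingEnd ℂ) (σ k) * τ).im / ‖σ k - τ‖ ^ 2 := by
    rw [← Complex.normSq_eq_norm_sq, Complex.div_im, ← sub_div]
    congr 1
    simp
    ring
  rw [im_ofReal_mul, h1, alpha, norm_sub_rev]
  by_cases h : lam k = 0
  · simp [h]
  · have := abs_pos.mpr h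
    field_simp

/-! ### The value region -/

/-- The standing assumptions on the data `τ`, `σ`, `lam`. -/
structure IsAdmissible {n : ℕ} (τ : ℂ) (σ : Fin n → ℂ) (lam : Fin n → ℝ) : Prop where
  pos : 0 < n
  mem : τ ∈ unitDisk
  ne_zero : τ ≠ 0
  norm_eq : ∀ k, ‖σ k‖ = 1
  inj : Function.Injective σ
  neg : ∀ k, lam k < 0

/-- The generator attached to the function `herglotz L κ`. -/
noncomputable def kernelGen {n : ℕ} (τ : ℂ) (σ : Fin n → ℂ) (lam : Fin n → ℝ) (L κ z : ℂ) : ℂ :=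
  (τ - z) * (1 - (starRingEnd ℂ) τ * z) / (herglotz L κ z + p₀ τ σ lam z)

theorem IsAdmissible.sumAlpha_pos (h : IsAdmissible τ σ lam) : 0 < sumAlpha τ σ lam :=
  HolGen.sumAlpha_pos h.pos h.mem h.norm_eq h.neg

theorem IsAdmissible.one_sub_pos (h : IsAdmissible τ σ lam) : 0 < 1 - ‖τ‖ ^ 2 := by
  have := mem_unitDisk.mp h.mem
  nlinarith [norm_nonneg τ]

theorem extremalInt_eq {s : ℂ} (hs : ‖s‖ = 1) (ζ : ℂ) :
    extremalInt τ σ lam ζ s = kernelGen τ σ lam (ell τ σ lam ζ) ((starRingEnd ℂ) s) := by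
  funext z
  rw [extremalInt, kernelGen, herglotz, poisson_eq hs]

/-- When Re ℓ_ζ = 0 the kernel has weight zero, so κ is arbitrary. -/
theorem extremalBdry_eq {ζ : ℂ} (h : (ell τ σ lam ζ).re = 0) (κ : ℂ) :
    extremalBdry τ σ lam ζ = kernelGen τ σ lam (ell τ σ lam ζ) κ := by
  funext z
  rw [extremalBdry, kernelGen, herglotz, h]
  simp

theorem ell_add (ζ : ℂ) : ell τ σ lam ζ + sumAlpha τ σ lam = τ / ζ := by
  rw [ell, sub_add_cancel]

/-- The data of a nontrivial element of the class in terms of its representation. -/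
theorem IsAdmissible.exists_data (h : IsAdmissible τ σ lam) {G : ℂ → ℂ} (hG : G ∈ Gen τ σ lam)
    (hG0 : ¬ EqOn G 0 unitDisk) :
    ∃ f : ℂ → ℂ, DifferentiableOn ℂ f unitDisk ∧ (∀ z ∈ unitDisk, 0 ≤ (f z).re) ∧
      (∀ z ∈ unitDisk, G z = (τ - z) * (1 - (starRingEnd ℂ) τ * z) / (f z + p₀ τ σ lam z)) ∧
      G 0 ≠ 0 ∧ ell τ σ lam (G 0) = f 0 ∧
      ∀ w, HasSpectralValue G τ w ↔ w ≠ 0 ∧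
        ((1 - ‖τ‖ ^ 2 : ℝ) : ℂ) / w = f τ + p₀ τ σ lam τ := by
  obtain ⟨f, hf, hre, hrep⟩ := exists_repr h.pos h.mem h.norm_eq h.inj h.neg hG hG0
  obtain ⟨h0, hw, -⟩ := exists_generator_of_repr h.pos h.mem h.norm_eq h.neg hf hre hrep
  have hA : f 0 + sumAlpha τ σ lam ≠ 0 := by
    have := add_p₀_re_pos h.pos h.mem h.norm_eq h.neg hre (z := 0) (by simp)
    rw [p₀_zero h.norm_eq] at this
    exact ne_zero_of_re_pos this
  have hq := ne_zero_of_re_pos (add_p₀_re_pos h.pos h.mem h.norm_eq h.neg hre h.mem)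
  have hD : ((1 - ‖τ‖ ^ 2 : ℝ) : ℂ) ≠ 0 := by exact_mod_cast h.one_sub_pos.ne'
  refine ⟨f, hf, hre, hrep, ?_, ?_, fun w => ?_⟩
  · rw [h0]
    exact div_ne_zero h.ne_zero hA
  · rw [ell, h0, div_div_cancel₀ h.ne_zero, add_sub_cancel_right]
  · rw [hw]
    constructor
    · rintro rfl
      exact ⟨div_ne_zero hD hq, div_div_cancel₀ hD⟩
    · rintro ⟨hw0, hw1⟩
      rw [← hw1, div_div_cancel₀ hD]

theorem IsAdmissible.kernel_data (h : IsAdmissible τ σ lam) {ζ κ : ℂ}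
    (hre : 0 ≤ (ell τ σ lam ζ).re) (hκ : ‖κ‖ ≤ 1) {G : ℂ → ℂ}
    (hG : EqOn G (kernelGen τ σ lam (ell τ σ lam ζ) κ) unitDisk) :
    G ∈ Gen τ σ lam ∧ G 0 = ζ ∧ ∀ w, HasSpectralValue G τ w ↔
      w = ((1 - ‖τ‖ ^ 2 : ℝ) : ℂ) / (herglotz (ell τ σ lam ζ) κ τ + p₀ τ σ lam τ) := by
  obtain ⟨h0, hw, -⟩ := exists_generator_of_repr h.pos h.mem h.norm_eq h.neg
    (differentiableOn_herglotz (ell τ σ lam ζ) hκ) (fun z hz => herglotz_re_nonneg hre hκ hz) hG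
  refine ⟨mem_gen_of_herglotz h.pos h.mem h.norm_eq h.inj h.neg hre hκ hG, ?_, hw⟩
  rw [h0, herglotz_zero, ell_add, div_div_cancel₀ h.ne_zero]

/-- Away from ζ = 0 the two inclusions are the Schwarz lemma and its sharpness for f; the point (0,
0) comes from the trivial generator alone. -/
theorem IsAdmissible.valueRegion_eq (h : IsAdmissible τ σ lam) :
    valueRegion τ σ lam = {P | P.1 ∈ regionZ τ σ lam ∧ P.2 ∈ regionΩ τ σ lam P.1} := by
  have hD : ((1 - ‖τ‖ ^ 2 : ℝ) : ℂ) ≠ 0 := by exact_mod_cast h.one_sub_pos.ne'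
  ext ⟨ζ, ω⟩
  simp only [valueRegion, Delivers, mem_ofPred_eq]
  constructor
  · rintro ⟨G, hG, rfl, hω⟩
    by_cases hG0 : EqOn G 0 unitDisk
    · have h1 : G 0 = 0 := hG0 (by simp)
      have h2 := ((zero_mem_gen h.mem h.norm_eq h.neg hG0).2 ω).mp hω
      rw [h1, h2]
      exact ⟨zero_mem_regionZ, by simp [regionΩ]⟩
    · obtain ⟨f, hf, hre, -, hne, hell, hw⟩ := h.exists_data hG hG0
      obtain ⟨hω0, hω1⟩ := (hw ω).mp hω
      have hre0 : 0 ≤ (ell τ σ lam (G 0)).re := by rw [hell]; exact hre 0 (by simp)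
      refine ⟨(mem_regionZ_iff h.ne_zero h.sumAlpha_pos hne).mpr hre0,
        (mem_regionΩ_iff h.mem hne hre0 ω).mpr ⟨hω0, ?_⟩⟩
      rw [hω1, add_sub_cancel_right, hell]
      exact norm_sub_zero_le hf hre h.mem
  · rintro ⟨hζ, hω⟩
    by_cases hζ0 : ζ = 0
    · subst hζ0
      have h2 : ω = 0 := by simpa [regionΩ] using hω
      subst h2
      obtain ⟨h3, h4⟩ := zero_mem_gen h.mem h.norm_eq h.neg (G := 0) (eqOn_refl _ _)
      exact ⟨0, h3, rfl, (h4 0).mpr rfl⟩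
    · have hre := (mem_regionZ_iff h.ne_zero h.sumAlpha_pos hζ0).mp hζ
      obtain ⟨hω0, hle⟩ := (mem_regionΩ_iff h.mem hζ0 hre ω).mp hω
      obtain ⟨κ, hκ, hv⟩ := exists_herglotz_eq hre h.mem h.ne_zero hle
      obtain ⟨h1, h2, h3⟩ := h.kernel_data hre hκ (eqOn_refl _ _)
      refine ⟨_, h1, h2, (h3 ω).mpr ?_⟩
      rw [hv, sub_add_cancel, div_div_cancel₀ hD]

theorem herglotz_inj {L κ κ' τ : ℂ} (hL : 0 < L.re) (hκ : ‖κ‖ ≤ 1) (hκ' : ‖κ'‖ ≤ 1)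
    (hτ : τ ∈ unitDisk) (hτ0 : τ ≠ 0) (h : herglotz L κ τ = herglotz L κ' τ) : κ = κ' := by
  have h1 := herglotz_sub (L := L) (one_sub_mul_ne_zero hκ hτ)
  have h2 := herglotz_sub (L := L) (one_sub_mul_ne_zero hκ' hτ)
  have h3 := herglotz_re_nonneg hL.le hκ hτ
  have h4 : herglotz L κ τ + (starRingEnd ℂ) L ≠ 0 := ne_zero_of_re_pos (by
    rw [add_re, conj_re]; linarith)
  rw [← h, h1] at h2
  exact mul_right_cancel₀ hτ0 (mul_right_cancel₀ h4 h2)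

theorem norm_herglotz_sub {L κ τ : ℂ} (hκ : ‖κ‖ = 1) (hτ : τ ∈ unitDisk) :
    ‖herglotz L κ τ - L‖ = ‖τ‖ * ‖herglotz L κ τ + (starRingEnd ℂ) L‖ := by
  rw [herglotz_sub (one_sub_mul_ne_zero hκ.le hτ), norm_mul, norm_mul, hκ, one_mul]

/-- A function with nonnegative real part that is extremal in the Schwarz lemma is determined by its
values at `0` and `τ`. -/
theorem eqOn_of_extremal {f g : ℂ → ℂ} (hf : DifferentiableOn ℂ f unitDisk)
    (hfre : ∀ z ∈ unitDisk, 0 ≤ (f z).re) (hg : DifferentiableOn ℂ g unitDisk)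
    (hgre : ∀ z ∈ unitDisk, 0 ≤ (g z).re) (hτ : τ ∈ unitDisk) (hτ0 : τ ≠ 0) (h0 : f 0 = g 0)
    (h1 : f τ = g τ) (heq : ‖f τ - f 0‖ = ‖τ‖ * ‖f τ + (starRingEnd ℂ) (f 0)‖) :
    EqOn f g unitDisk := by
  have hz : (0 : ℂ) ∈ unitDisk := by simp
  rcases (hfre 0 hz).eq_or_lt with hre | hre
  · intro z hz'
    rw [eqOn_const_of_re_eq_zero hf hfre hz hre.symm z hz',
      eqOn_const_of_re_eq_zero hg hgre hz (h0 ▸ hre.symm) z hz', h0]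
  · obtain ⟨κ, hκ, hfκ⟩ := exists_eqOn_herglotz hf hfre hτ hτ0 hre heq
    obtain ⟨κ', hκ', hgκ⟩ := exists_eqOn_herglotz hg hgre hτ hτ0 (h0 ▸ hre)
      (by rw [← h0, ← h1]; exact heq)
    have h2 := hfκ hτ
    rw [h1, hgκ hτ, ← h0] at h2
    have := herglotz_inj hre hκ'.le hκ.le hτ hτ0 h2
    intro z hz'
    rw [hfκ hz', hgκ hz', this, h0]

theorem IsAdmissible.isExtremalBdry_iff (h : IsAdmissible τ σ lam) {G f : ℂ → ℂ}
    (hf : DifferentiableOn ℂ f unitDisk) (hre : ∀ z ∈ unitDisk, 0 ≤ (f z).re)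
    (hrep : ∀ z ∈ unitDisk, G z = (τ - z) * (1 - (starRingEnd ℂ) τ * z) / (f z + p₀ τ σ lam z))
    (hne : G 0 ≠ 0) (hell : ell τ σ lam (G 0) = f 0) :
    IsExtremalBdry τ σ lam G ↔ (f 0).re = 0 := by
  constructor
  · rintro ⟨ζ, hζ, hζ0, hE⟩
    have hre0 : (ell τ σ lam ζ).re = 0 :=
      (((mem_frontier_regionZ_iff h.ne_zero h.sumAlpha_pos).mp hζ).resolve_left hζ0).2
    rw [extremalBdry_eq hre0 0] at hE
    obtain ⟨-, h0, -⟩ := h.kernel_data hre0.ge (by simp) hE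
    rw [← hell, h0, hre0]
  · intro h0
    refine ⟨G 0, (mem_frontier_regionZ_iff h.ne_zero h.sumAlpha_pos).mpr
      (Or.inr ⟨hne, hell ▸ h0⟩), hne, fun z hz => ?_⟩
    rw [hrep z hz, extremalBdry, hell, eqOn_const_of_re_eq_zero hf hre (by simp) h0 z hz]
    congr 2
    apply Complex.ext <;> simp [h0]

/-- Since |conj s| = 1, the kernel is extremal in the Schwarz lemma, so agreement at 0 and τ already
forces agreement on the disk. -/
theorem IsAdmissible.isExtremalInt_iff (h : IsAdmissible τ σ lam) {G f : ℂ → ℂ}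
    (hf : DifferentiableOn ℂ f unitDisk) (hre : ∀ z ∈ unitDisk, 0 ≤ (f z).re)
    (hrep : ∀ z ∈ unitDisk, G z = (τ - z) * (1 - (starRingEnd ℂ) τ * z) / (f z + p₀ τ σ lam z))
    (hne : G 0 ≠ 0) (hell : ell τ σ lam (G 0) = f 0) {s : ℂ} (hs : ‖s‖ = 1) :
    IsExtremalInt τ σ lam s G ↔
      0 < (f 0).re ∧ f τ = herglotz (f 0) ((starRingEnd ℂ) s) τ := by
  have hs' : ‖(starRingEnd ℂ) s‖ = 1 := by rw [RCLike.norm_conj, hs]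
  constructor
  · rintro ⟨ζ, hζ, hE⟩
    obtain ⟨hζ0, hpos⟩ := (mem_interior_regionZ_iff h.ne_zero h.sumAlpha_pos).mp hζ
    rw [extremalInt_eq hs] at hE
    obtain ⟨-, h0, hw⟩ := h.kernel_data hpos.le hs'.le hE
    obtain ⟨-, hw', -⟩ := exists_generator_of_repr h.pos h.mem h.norm_eq h.neg hf hre hrep
    rw [← hell, h0]
    refine ⟨hpos, ?_⟩
    have h1 := (hw' _).mp ((hw _).mpr rfl)
    have hD : ((1 - ‖τ‖ ^ 2 : ℝ) : ℂ) ≠ 0 := by exact_mod_cast h.one_sub_pos.ne'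
    have h2 := congrArg (fun x => ((1 - ‖τ‖ ^ 2 : ℝ) : ℂ) / x) h1
    simp only [div_div_cancel₀ hD] at h2
    exact (add_right_cancel h2).symm
  · rintro ⟨hpos, hv⟩
    refine ⟨G 0, (mem_interior_regionZ_iff h.ne_zero h.sumAlpha_pos).mpr
      ⟨hne, hell ▸ hpos⟩, fun z hz => ?_⟩
    have hE : EqOn f (herglotz (f 0) ((starRingEnd ℂ) s)) unitDisk :=
      eqOn_of_extremal hf hre (differentiableOn_herglotz _ hs'.le)
        (fun z hz => herglotz_re_nonneg hpos.le hs'.le hz) h.mem h.ne_zero (by simp) hv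
        (by rw [hv]; exact norm_herglotz_sub hs' h.mem)
    rw [hrep z hz, extremalInt_eq hs, kernelGen, hell, hE hz]

/-- If equality holds in the Schwarz lemma, the generator is one of the explicit functions. -/
theorem IsAdmissible.isExtremal_of_eq (h : IsAdmissible τ σ lam) {G f : ℂ → ℂ}
    (hf : DifferentiableOn ℂ f unitDisk) (hre : ∀ z ∈ unitDisk, 0 ≤ (f z).re)
    (hrep : ∀ z ∈ unitDisk, G z = (τ - z) * (1 - (starRingEnd ℂ) τ * z) / (f z + p₀ τ σ lam z))
    (hne : G 0 ≠ 0) (hell : ell τ σ lam (G 0) = f 0)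
    (heq : ‖f τ - f 0‖ = ‖τ‖ * ‖f τ + (starRingEnd ℂ) (f 0)‖) : IsExtremal τ σ lam G := by
  rcases (hre 0 (by simp)).eq_or_lt with h0 | h0
  · exact Or.inr (Or.inl ((h.isExtremalBdry_iff hf hre hrep hne hell).mpr h0.symm))
  · obtain ⟨κ, hκ, hE⟩ := exists_eqOn_herglotz hf hre h.mem h.ne_zero h0 heq
    have hs : ‖(starRingEnd ℂ) κ‖ = 1 := by rw [RCLike.norm_conj, hκ]
    refine Or.inl ⟨_, hs, (h.isExtremalInt_iff hf hre hrep hne hell hs).mpr ⟨h0, ?_⟩⟩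
    rw [Complex.conj_conj]
    exact hE h.mem

/-! ### The boundary of the value region -/

theorem IsAdmissible.isClosed_valueRegion (h : IsAdmissible τ σ lam) :
    IsClosed (valueRegion τ σ lam) := by
  have hτ1 := mem_unitDisk.mp h.mem
  have hτp := norm_pos_iff.mpr h.ne_zero
  have hDp := h.one_sub_pos
  have hD : ((1 - ‖τ‖ ^ 2 : ℝ) : ℂ) ≠ 0 := by exact_mod_cast h.one_sub_pos.ne'
  -- Clearing denominators turns both sides of the Schwarz inequality into continuous functions of
  -- (ζ, ω), also where ζ or ω vanishes.
  have hmul : ∀ ζ ω : ℂ, ζ ≠ 0 → ω ≠ 0 →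
      (‖((1 - ‖τ‖ ^ 2 : ℝ) : ℂ) * ζ - (p₀ τ σ lam τ - sumAlpha τ σ lam) * ζ * ω - τ * ω‖ =
        ‖ζ‖ * ‖ω‖ * ‖((1 - ‖τ‖ ^ 2 : ℝ) : ℂ) / ω - p₀ τ σ lam τ - ell τ σ lam ζ‖) ∧
      (‖((1 - ‖τ‖ ^ 2 : ℝ) : ℂ) * (starRingEnd ℂ) ζ
          - (p₀ τ σ lam τ + sumAlpha τ σ lam) * (starRingEnd ℂ) ζ * ω + (starRingEnd ℂ) τ * ω‖ =
        ‖ζ‖ * ‖ω‖ * ‖((1 - ‖τ‖ ^ 2 : ℝ) : ℂ) / ω - p₀ τ σ lam τ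
          + (starRingEnd ℂ) (ell τ σ lam ζ)‖) := by
    intro ζ ω hζ hω
    have hζ' : (starRingEnd ℂ) ζ ≠ 0 := (map_ne_zero _).mpr hζ
    constructor
    · rw [← norm_mul, ← norm_mul]
      congr 1
      rw [ell]
      field_simp
      ring
    · rw [← RCLike.norm_conj ζ, ← norm_mul, ← norm_mul]
      congr 1
      rw [ell, map_sub, map_div₀, conj_ofReal]
      field_simp
      ring
  have hV : valueRegion τ σ lam = {P : ℂ × ℂ | P.1 ∈ regionZ τ σ lam} ∩
      ({P : ℂ × ℂ | ‖((1 - ‖τ‖ ^ 2 : ℝ) : ℂ) * P.1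
          - (p₀ τ σ lam τ - sumAlpha τ σ lam) * P.1 * P.2 - τ * P.2‖ ≤
        ‖τ‖ * ‖((1 - ‖τ‖ ^ 2 : ℝ) : ℂ) * (starRingEnd ℂ) P.1
          - (p₀ τ σ lam τ + sumAlpha τ σ lam) * (starRingEnd ℂ) P.1 * P.2
          + (starRingEnd ℂ) τ * P.2‖} ∩
      {P : ℂ × ℂ | (1 - ‖τ‖) * ‖τ‖ * ‖P.2‖ ≤ (1 + ‖τ‖) * (1 - ‖τ‖ ^ 2) * ‖P.1‖}) := by
    apply Subset.antisymm
    · intro P hP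
      have hP' := hP
      rw [h.valueRegion_eq] at hP'
      obtain ⟨hζ, hω⟩ := hP'
      refine ⟨hζ, ?_⟩
      by_cases hζ0 : P.1 = 0
      · have h2 : P.2 = 0 := by simpa [regionΩ, hζ0] using hω
        constructor <;> simp [hζ0, h2]
      · have hre := (mem_regionZ_iff h.ne_zero h.sumAlpha_pos hζ0).mp hζ
        obtain ⟨hω0, hle⟩ := (mem_regionΩ_iff h.mem hζ0 hre _).mp hω
        refine ⟨?_, ?_⟩
        · rw [mem_ofPred_eq, (hmul _ _ hζ0 hω0).1, (hmul _ _ hζ0 hω0).2, mul_left_comm]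
          gcongr
        · obtain ⟨G, hG, h1, h2⟩ := hP
          have hG0 : ¬ EqOn G 0 unitDisk := fun hc => hζ0 (h1 ▸ hc (by simp))
          obtain ⟨f, hf, hfre, -, hne, hell, hw⟩ := h.exists_data hG hG0
          obtain ⟨-, hq⟩ := (hw _).mp h2
          -- The Schwarz lemma for f + p₀, whose values at 0 and τ are τ/ζ and (1 - |τ|²)/ω, bounds
          -- |ω| by a multiple of |ζ|. This bound later forces ω = 0 at ζ = 0.
          have hsp := norm_sub_zero_le (hf.add (differentiableOn_p₀ (lam := lam) (τ := τ) h.norm_eq))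
            (fun z hz => (add_p₀_re_pos h.pos h.mem h.norm_eq h.neg hfre hz).le) h.mem
          simp only [Pi.add_apply] at hsp
          rw [← hq, p₀_zero h.norm_eq, ← hell, ell_add, h1] at hsp
          have n1 : ‖τ / P.1‖ ≤ ‖((1 - ‖τ‖ ^ 2 : ℝ) : ℂ) / P.2 - τ / P.1‖
              + ‖((1 - ‖τ‖ ^ 2 : ℝ) : ℂ) / P.2‖ := by
            rw [norm_sub_rev]; exact norm_le_norm_sub_add _ _
          have n2 : ‖((1 - ‖τ‖ ^ 2 : ℝ) : ℂ) / P.2 + (starRingEnd ℂ) (τ / P.1)‖ ≤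
              ‖((1 - ‖τ‖ ^ 2 : ℝ) : ℂ) / P.2‖ + ‖τ / P.1‖ := by
            have := norm_add_le (((1 - ‖τ‖ ^ 2 : ℝ) : ℂ) / P.2) ((starRingEnd ℂ) (τ / P.1))
            rwa [RCLike.norm_conj] at this
          have n3 : (1 - ‖τ‖) * ‖τ / P.1‖ ≤ (1 + ‖τ‖) * ‖((1 - ‖τ‖ ^ 2 : ℝ) : ℂ) / P.2‖ := by
            nlinarith
          rw [norm_div, norm_div, Complex.norm_of_nonneg hDp.le, mul_div_assoc', mul_div_assoc',
            div_le_div_iff₀ (norm_pos_iff.mpr hζ0) (norm_pos_iff.mpr hω0)] at n3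
          exact n3
    · rintro P ⟨hζ, hle, hb⟩
      rw [mem_ofPred_eq] at hζ hle hb
      rw [h.valueRegion_eq]
      refine ⟨hζ, ?_⟩
      by_cases hζ0 : P.1 = 0
      · rw [hζ0, norm_zero, mul_zero] at hb
        have h1 : 0 < (1 - ‖τ‖) * ‖τ‖ := mul_pos (by linarith) hτp
        have h2 : P.2 = 0 := by
          by_contra hc
          nlinarith [mul_pos h1 (norm_pos_iff.mpr hc)]
        rw [hζ0, h2]
        simp [regionΩ]
      · have hre := (mem_regionZ_iff h.ne_zero h.sumAlpha_pos hζ0).mp hζ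
        have hζp := norm_pos_iff.mpr hζ0
        -- At ω = 0 the cleared inequality would read (1 - |τ|²)|ζ| ≤ |τ|(1 - |τ|²)|ζ|.
        have hω0 : P.2 ≠ 0 := by
          intro hc
          simp only [hc, mul_zero, sub_zero, add_zero, norm_mul, RCLike.norm_conj,
            Complex.norm_of_nonneg hDp.le] at hle
          nlinarith [mul_pos hDp hζp]
        refine (mem_regionΩ_iff h.mem hζ0 hre _).mpr ⟨hω0, ?_⟩
        rw [(hmul _ _ hζ0 hω0).1, (hmul _ _ hζ0 hω0).2, mul_left_comm] at hle
        exact le_of_mul_le_mul_left hle (mul_pos hζp (norm_pos_iff.mpr hω0))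
  rw [hV]
  refine (isClosed_regionZ.preimage continuous_fst).inter (IsClosed.inter ?_ ?_)
  · exact isClosed_le (by fun_prop) (by fun_prop)
  · exact isClosed_le (by fun_prop) (by fun_prop)

theorem IsAdmissible.mem_interior_valueRegion (h : IsAdmissible τ σ lam) {P : ℂ × ℂ}
    (hζ0 : P.1 ≠ 0) (hpos : 0 < (ell τ σ lam P.1).re) (hω0 : P.2 ≠ 0)
    (hlt : ‖((1 - ‖τ‖ ^ 2 : ℝ) : ℂ) / P.2 - p₀ τ σ lam τ - ell τ σ lam P.1‖ <
        ‖τ‖ * ‖((1 - ‖τ‖ ^ 2 : ℝ) : ℂ) / P.2 - p₀ τ σ lam τ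
          + (starRingEnd ℂ) (ell τ σ lam P.1)‖) :
    P ∈ interior (valueRegion τ σ lam) := by
  have c1 : ContinuousAt (fun Q : ℂ × ℂ => ell τ σ lam Q.1) P :=
    (continuousAt_const.div continuousAt_fst hζ0).sub continuousAt_const
  have c2 : ContinuousAt (fun Q : ℂ × ℂ => ((1 - ‖τ‖ ^ 2 : ℝ) : ℂ) / Q.2 - p₀ τ σ lam τ) P :=
    (continuousAt_const.div continuousAt_snd hω0).sub continuousAt_const
  have c3 : ContinuousAt (fun Q : ℂ × ℂ => (starRingEnd ℂ) (ell τ σ lam Q.1)) P :=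
    Complex.continuous_conj.continuousAt.comp c1
  have c4 : ContinuousAt (fun Q : ℂ × ℂ => (ell τ σ lam Q.1).re) P :=
    Complex.continuous_re.continuousAt.comp c1
  rw [mem_interior_iff_mem_nhds, h.valueRegion_eq]
  filter_upwards [continuousAt_fst.eventually_ne hζ0, continuousAt_snd.eventually_ne hω0,
    c4.eventually (lt_mem_nhds hpos),
    (c2.sub c1).norm.eventually_lt (continuousAt_const.mul (c2.add c3).norm) hlt] with Q q1 q2 q3 q4
  exact ⟨(mem_regionZ_iff h.ne_zero h.sumAlpha_pos q1).mpr q3.le,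
    (mem_regionΩ_iff h.mem q1 q3.le _).mpr ⟨q2, q4.le⟩⟩

/-- Equality in the Schwarz lemma only occurs at boundary points of the value region. -/
theorem IsAdmissible.notMem_interior_of_eq (h : IsAdmissible τ σ lam) {P : ℂ × ℂ} {v : ℂ}
    (hζ0 : P.1 ≠ 0) (hpos : 0 < (ell τ σ lam P.1).re)
    (hq : v + p₀ τ σ lam τ ≠ 0) (hω : P.2 = ((1 - ‖τ‖ ^ 2 : ℝ) : ℂ) / (v + p₀ τ σ lam τ))
    (heq : ‖v - ell τ σ lam P.1‖ = ‖τ‖ * ‖v + (starRingEnd ℂ) (ell τ σ lam P.1)‖) :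
    P ∉ interior (valueRegion τ σ lam) := by
  intro hP
  have hτ1 := mem_unitDisk.mp h.mem
  have hτp := norm_pos_iff.mpr h.ne_zero
  have hD : ((1 - ‖τ‖ ^ 2 : ℝ) : ℂ) ≠ 0 := by exact_mod_cast h.one_sub_pos.ne'
  have hDp := h.one_sub_pos
  have hdisk := fun u : ℂ =>
    norm_sub_le_iff_disk (norm_nonneg τ) hτ1 hpos.le (ell τ σ lam P.1) u rfl rfl
  -- With ζ fixed, an interior P would make v an interior point of the disk of admissible values
  -- f(τ); but equality places v on its circle, whose radius is positive.
  have hc : ContinuousAt (fun u : ℂ => (P.1, ((1 - ‖τ‖ ^ 2 : ℝ) : ℂ) / (u + p₀ τ σ lam τ))) v :=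
    continuousAt_const.prodMk
      (continuousAt_const.div (continuousAt_id.add continuousAt_const) hq)
  have hPv : P = (P.1, ((1 - ‖τ‖ ^ 2 : ℝ) : ℂ) / (v + p₀ τ σ lam τ)) := by rw [← hω]
  rw [hPv] at hP
  have hev := hc.eventually (isOpen_interior.mem_nhds hP)
  have hint : v ∈ interior (Metric.closedBall
      ((((1 + ‖τ‖ ^ 2) / (1 - ‖τ‖ ^ 2) * (ell τ σ lam P.1).re : ℝ) : ℂ)
        + I * ((ell τ σ lam P.1).im : ℂ))
      (2 * ‖τ‖ / (1 - ‖τ‖ ^ 2) * (ell τ σ lam P.1).re)) := by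
    rw [mem_interior_iff_mem_nhds]
    filter_upwards [hev] with u hu
    have hu' := interior_subset hu
    rw [h.valueRegion_eq] at hu'
    have h1 := ((mem_regionΩ_iff h.mem hζ0 hpos.le _).mp hu'.2).2
    rw [div_div_cancel₀ hD, add_sub_cancel_right] at h1
    rw [mem_closedBall_iff_norm]
    exact (hdisk u).1.mp h1
  rw [interior_closedBall _ (by positivity), mem_ball_iff_norm, (hdisk v).2.mp heq] at hint
  exact lt_irrefl _ hint

/-- The first projection is open and maps the value region into Z. -/
theorem IsAdmissible.notMem_interior_of_mem_frontier (h : IsAdmissible τ σ lam) {P : ℂ × ℂ}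
    (hP : P.1 ∈ frontier (regionZ τ σ lam)) : P ∉ interior (valueRegion τ σ lam) := by
  intro hint
  refine hP.2 (interior_maximal ?_ (isOpenMap_fst _ isOpen_interior) (mem_image_of_mem _ hint))
  rintro _ ⟨Q, hQ, rfl⟩
  have := interior_subset hQ
  rw [h.valueRegion_eq] at this
  exact this.1

/-- For ζ = 0 only the trivial generator remains. Otherwise f is extremal in the Schwarz lemma: a
strict inequality with Re f(0) > 0 would make P interior, and for Re f(0) = 0 equality is automatic.
Rigidity then determines f. -/
theorem IsAdmissible.frontier_valueRegion (h : IsAdmissible τ σ lam) :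
    ∀ P ∈ frontier (valueRegion τ σ lam), ∃ G ∈ Gen τ σ lam,
      IsExtremal τ σ lam G ∧ Delivers τ G P ∧
      ∀ G' ∈ Gen τ σ lam, Delivers τ G' P → EqOn G' G unitDisk := by
  intro P hP
  rw [h.isClosed_valueRegion.frontier_eq] at hP
  obtain ⟨⟨G, hG, hGP⟩, hPint⟩ := hP
  by_cases hζ0 : P.1 = 0
  · have hzero : ∀ G' ∈ Gen τ σ lam, Delivers τ G' P → EqOn G' 0 unitDisk := by
      intro G' hG' hGP'
      by_contra hc
      obtain ⟨f, -, -, -, hne, -, -⟩ := h.exists_data hG' hc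
      exact hne (hGP'.1.trans hζ0)
    refine ⟨G, hG, Or.inr (Or.inr (hzero G hG hGP)), hGP, fun G' hG' hGP' => ?_⟩
    exact (hzero G' hG' hGP').trans (hzero G hG hGP).symm
  · have hnz : ∀ G', Delivers τ G' P → ¬ EqOn G' 0 unitDisk := fun G' hGP' hc =>
      hζ0 (hGP'.1 ▸ hc (by simp))
    obtain ⟨f, hf, hre, hrep, hne, hell, hw⟩ := h.exists_data hG (hnz G hGP)
    obtain ⟨hω0, hq⟩ := (hw _).mp hGP.2
    have hfτ : ((1 - ‖τ‖ ^ 2 : ℝ) : ℂ) / P.2 - p₀ τ σ lam τ = f τ := by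
      rw [hq, add_sub_cancel_right]
    have hLP : ell τ σ lam P.1 = f 0 := by rw [← hGP.1, hell]
    have heq : ‖f τ - f 0‖ = ‖τ‖ * ‖f τ + (starRingEnd ℂ) (f 0)‖ := by
      rcases (hre 0 (by simp)).eq_or_lt with h0 | h0
      · have h1 := eqOn_const_of_re_eq_zero hf hre (by simp) h0.symm τ h.mem
        have h2 : (starRingEnd ℂ) (f 0) = -f 0 := by apply Complex.ext <;> simp [← h0]
        rw [h1, h2]
        simp
      · refine le_antisymm (norm_sub_zero_le hf hre h.mem) (not_lt.mp fun hc => hPint ?_)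
        refine h.mem_interior_valueRegion hζ0 (hLP ▸ h0) hω0 ?_
        rw [hfτ, hLP]
        exact hc
    refine ⟨G, hG, h.isExtremal_of_eq hf hre hrep hne hell heq, hGP, fun G' hG' hGP' => ?_⟩
    obtain ⟨f', hf', hre', hrep', hne', hell', hw'⟩ := h.exists_data hG' (hnz G' hGP')
    obtain ⟨-, hq'⟩ := (hw' _).mp hGP'.2
    have hE : EqOn f f' unitDisk := eqOn_of_extremal hf hre hf' hre' h.mem h.ne_zero
      (by rw [← hLP, ← hell', hGP'.1]) (add_right_cancel (hq.symm.trans hq')) heq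
    intro z hz
    rw [hrep' z hz, hrep z hz, hE hz]

theorem IsAdmissible.mem_gen_of_isExtremal (h : IsAdmissible τ σ lam) {G : ℂ → ℂ}
    (hG : IsExtremal τ σ lam G) :
    G ∈ Gen τ σ lam ∧ ∀ P, Delivers τ G P → P ∈ frontier (valueRegion τ σ lam) := by
  suffices hs : G ∈ Gen τ σ lam ∧ ∀ P, Delivers τ G P → P ∉ interior (valueRegion τ σ lam) by
    refine ⟨hs.1, fun P hP => ?_⟩
    rw [h.isClosed_valueRegion.frontier_eq]
    exact ⟨⟨G, hs.1, hP⟩, hs.2 P hP⟩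
  rcases hG with ⟨s, hs, ζ, hζ, hE⟩ | ⟨ζ, hζ, hζ0, hE⟩ | hE
  · obtain ⟨hζ0, hpos⟩ := (mem_interior_regionZ_iff h.ne_zero h.sumAlpha_pos).mp hζ
    have hs' : ‖(starRingEnd ℂ) s‖ = 1 := by rw [RCLike.norm_conj, hs]
    rw [extremalInt_eq hs] at hE
    obtain ⟨hG, h0, hw⟩ := h.kernel_data hpos.le hs'.le hE
    refine ⟨hG, fun P hP => ?_⟩
    have hP1 : P.1 = ζ := hP.1.symm.trans h0
    refine h.notMem_interior_of_eq (hP1 ▸ hζ0) (hP1 ▸ hpos)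
      (v := herglotz (ell τ σ lam ζ) ((starRingEnd ℂ) s) τ) ?_ ((hw _).mp hP.2) ?_
    · exact ne_zero_of_re_pos (add_p₀_re_pos h.pos h.mem h.norm_eq h.neg
        (fun z hz => herglotz_re_nonneg hpos.le hs'.le hz) h.mem)
    · rw [hP1]
      exact norm_herglotz_sub hs' h.mem
  · have hre0 : (ell τ σ lam ζ).re = 0 :=
      (((mem_frontier_regionZ_iff h.ne_zero h.sumAlpha_pos).mp hζ).resolve_left hζ0).2
    rw [extremalBdry_eq hre0 0] at hE
    obtain ⟨hG, h0, -⟩ := h.kernel_data hre0.ge (by simp) hE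
    refine ⟨hG, fun P hP => h.notMem_interior_of_mem_frontier ?_⟩
    rwa [← hP.1, h0]
  · refine ⟨(zero_mem_gen h.mem h.norm_eq h.neg hE).1,
      fun P hP => h.notMem_interior_of_mem_frontier ?_⟩
    have h0 : G 0 = 0 := hE (by simp)
    rw [← hP.1, h0]
    exact (mem_frontier_regionZ_iff h.ne_zero h.sumAlpha_pos).mpr (Or.inl rfl)

theorem IsAdmissible.mem_genExact_of_isExtremalBdry (h : IsAdmissible τ σ lam) {G : ℂ → ℂ}
    (hG : IsExtremalBdry τ σ lam G) : G ∈ GenExact τ σ lam := by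
  obtain ⟨ζ, hζ, hζ0, hE⟩ := hG
  have hre0 : (ell τ σ lam ζ).re = 0 :=
    (((mem_frontier_regionZ_iff h.ne_zero h.sumAlpha_pos).mp hζ).resolve_left hζ0).2
  rw [extremalBdry_eq hre0 0] at hE
  exact mem_genExact_of_herglotz h.pos h.mem h.norm_eq h.inj h.neg hre0.ge (by simp)
    (fun k => Or.inr hre0) hE

theorem IsAdmissible.mem_genExact_of_isExtremalInt (h : IsAdmissible τ σ lam) {G : ℂ → ℂ} {s : ℂ}
    (hs : ‖s‖ = 1) (hsσ : s ∉ Set.range σ) (hG : IsExtremalInt τ σ lam s G) :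
    G ∈ GenExact τ σ lam := by
  obtain ⟨ζ, hζ, hE⟩ := hG
  obtain ⟨hζ0, hpos⟩ := (mem_interior_regionZ_iff h.ne_zero h.sumAlpha_pos).mp hζ
  have hs' : ‖(starRingEnd ℂ) s‖ = 1 := by rw [RCLike.norm_conj, hs]
  rw [extremalInt_eq hs] at hE
  refine mem_genExact_of_herglotz h.pos h.mem h.norm_eq h.inj h.neg hpos.le hs'.le
    (fun k => Or.inl fun hk => hsσ ⟨k, ?_⟩) hE
  have h1 := conj_mul_self_of_norm_one hs
  exact mul_left_cancel₀ (left_ne_zero_of_mul_eq_one h1) (hk.trans h1.symm)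

theorem IsAdmissible.existsUnique_spectralValue (h : IsAdmissible τ σ lam) {G : ℂ → ℂ}
    (hG : G ∈ Gen τ σ lam) : ∃! w : ℂ, HasSpectralValue G τ w := by
  obtain ⟨φ, hg, hdw, -⟩ := hG
  have h0 := hg.apply_eq_zero h.mem fun t ht => hdw.fix h.mem ht
  exact ⟨_, (hasSpectralValue_iff hg h.mem h0 _).mpr rfl,
    fun w hw => (hasSpectralValue_iff hg h.mem h0 w).mp hw⟩

/-! ### The sharp inequalities -/

theorem re_im_of_mem_disk {v : ℂ} {X Y c R : ℝ}
    (hv : ‖v - (((c * X : ℝ) : ℂ) + I * (Y : ℂ))‖ ≤ R * X) :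
    (v.re - c * X) ^ 2 + (v.im - Y) ^ 2 ≤ (R * X) ^ 2 := by
  have h := pow_le_pow_left₀ (norm_nonneg _) hv 2
  rw [← Complex.normSq_eq_norm_sq, Complex.normSq_apply] at h
  simp only [sub_re, sub_im, add_re, add_im, ofReal_re, ofReal_im, mul_re, mul_im, I_re, I_im] at h
  nlinarith

/-- The disk has centre cX + iY and radius RX. A support line parallel to an axis meets it in a
single point, so equality also fixes the other coordinate. -/
theorem disk_extreme_left {x y X Y c R : ℝ} (hRX : 0 ≤ R * X)
    (h : (x - c * X) ^ 2 + (y - Y) ^ 2 ≤ (R * X) ^ 2) :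
    (c - R) * X ≤ x ∧ ((c - R) * X = x ↔ x = (c - R) * X ∧ y = Y) := by
  have h1 : |x - c * X| ≤ R * X := abs_le_of_sq_le_sq (by nlinarith [sq_nonneg (y - Y)]) hRX
  rw [abs_le] at h1
  refine ⟨by linarith, fun hx => ⟨hx.symm, ?_⟩, fun hx => hx.1.symm⟩
  rw [← hx] at h
  have : (y - Y) ^ 2 ≤ 0 := by nlinarith
  exact sub_eq_zero.mp (pow_eq_zero_iff two_ne_zero |>.mp (le_antisymm this (sq_nonneg _)))

theorem disk_extreme_right {x y X Y c R : ℝ} (hRX : 0 ≤ R * X)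
    (h : (x - c * X) ^ 2 + (y - Y) ^ 2 ≤ (R * X) ^ 2) :
    x ≤ (c + R) * X ∧ (x = (c + R) * X ↔ x = (c + R) * X ∧ y = Y) := by
  have h1 : |x - c * X| ≤ R * X := abs_le_of_sq_le_sq (by nlinarith [sq_nonneg (y - Y)]) hRX
  rw [abs_le] at h1
  refine ⟨by linarith, fun hx => ⟨hx, ?_⟩, fun hx => hx.1⟩
  rw [hx] at h
  have : (y - Y) ^ 2 ≤ 0 := by nlinarith
  exact sub_eq_zero.mp (pow_eq_zero_iff two_ne_zero |>.mp (le_antisymm this (sq_nonneg _)))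

theorem disk_extreme_vertical {x y X Y c R : ℝ} (hRX : 0 ≤ R * X)
    (h : (x - c * X) ^ 2 + (y - Y) ^ 2 ≤ (R * X) ^ 2) :
    |y - Y| ≤ R * X ∧ (|y - Y| = R * X ↔
      (x = c * X ∧ y = Y - R * X) ∨ (x = c * X ∧ y = Y + R * X)) := by
  have h1 : |y - Y| ≤ R * X := abs_le_of_sq_le_sq (by nlinarith [sq_nonneg (x - c * X)]) hRX
  refine ⟨h1, fun hy => ?_, ?_⟩
  · have h2 : (y - Y) ^ 2 = (R * X) ^ 2 := by rw [← hy, sq_abs]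
    have h3 : (x - c * X) ^ 2 ≤ 0 := by linarith
    have h4 : x = c * X :=
      sub_eq_zero.mp (pow_eq_zero_iff two_ne_zero |>.mp (le_antisymm h3 (sq_nonneg _)))
    rcases (abs_eq hRX).mp hy with h5 | h5
    · exact Or.inr ⟨h4, by linarith⟩
    · exact Or.inl ⟨h4, by linarith⟩
  · rintro (⟨-, hy⟩ | ⟨-, hy⟩)
    · rw [hy, sub_sub_cancel_left, abs_neg, abs_of_nonneg hRX]
    · rw [hy, add_sub_cancel_left, abs_of_nonneg hRX]

theorem herglotz_eq_iff {L κ τ v : ℂ} {e₁ e₂ : ℝ}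
    (he : (1 + κ * τ) / (1 - κ * τ) = (e₁ : ℂ) + I * (e₂ : ℂ)) :
    v = herglotz L κ τ ↔ v.re = e₁ * L.re ∧ v.im = L.im + e₂ * L.re := by
  rw [herglotz, he, Complex.ext_iff]
  simp [add_comm]

/-- For Re f(0) = 0 both f and the kernel are the constant f(0), so one equation at τ covers both
extremal types. -/
theorem IsAdmissible.isExtremal_or_iff (h : IsAdmissible τ σ lam) {G f : ℂ → ℂ}
    (hf : DifferentiableOn ℂ f unitDisk) (hre : ∀ z ∈ unitDisk, 0 ≤ (f z).re)
    (hrep : ∀ z ∈ unitDisk, G z = (τ - z) * (1 - (starRingEnd ℂ) τ * z) / (f z + p₀ τ σ lam z))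
    (hne : G 0 ≠ 0) (hell : ell τ σ lam (G 0) = f 0) {s : ℂ} (hs : ‖s‖ = 1) :
    IsExtremalBdry τ σ lam G ∨ IsExtremalInt τ σ lam s G ↔
      f τ = herglotz (f 0) ((starRingEnd ℂ) s) τ := by
  rw [h.isExtremalBdry_iff hf hre hrep hne hell, h.isExtremalInt_iff hf hre hrep hne hell hs]
  constructor
  · rintro (h0 | h0)
    · rw [eqOn_const_of_re_eq_zero hf hre (by simp) h0 τ h.mem, herglotz, h0]
      apply Complex.ext <;> simp [h0]
    · exact h0.2
  · intro hv
    rcases (hre 0 (by simp)).eq_or_lt with h0 | h0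
    · exact Or.inl h0.symm
    · exact Or.inr ⟨h0, hv⟩

theorem conj_div_norm_mul (hτ0 : τ ≠ 0) : (starRingEnd ℂ) (τ / ‖τ‖) * τ = (‖τ‖ : ℂ) := by
  have h0 : (‖τ‖ : ℂ) ≠ 0 := by exact_mod_cast norm_ne_zero_iff.mpr hτ0
  rw [map_div₀, conj_ofReal, div_mul_eq_mul_div, mul_comm, Complex.mul_conj,
    Complex.normSq_eq_norm_sq, ofReal_pow, sq, mul_div_assoc, div_self h0, mul_one]

theorem norm_div_norm (hτ0 : τ ≠ 0) : ‖τ / (‖τ‖ : ℂ)‖ = 1 := by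
  rw [norm_div, Complex.norm_real, norm_norm, div_self (norm_ne_zero_iff.mpr hτ0)]

/-- The parameters of the generators that are extremal for the imaginary part. -/
theorem norm_vertical_param {r ε : ℝ} (hε : ε ^ 2 = 1) :
    ‖((2 * r + I * (ε * (1 - r ^ 2))) / (1 + r ^ 2) : ℂ)‖ = 1 := by
  have h0 : 0 < 1 + r ^ 2 := by positivity
  have h1 : ((1 : ℂ) + r ^ 2) = ((1 + r ^ 2 : ℝ) : ℂ) := by push_cast; ring
  have h2 : (2 * r + I * (ε * (1 - r ^ 2)) : ℂ) = ⟨2 * r, ε * (1 - r ^ 2)⟩ := by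
    apply Complex.ext <;> simp [← ofReal_pow]
  rw [norm_div, h1, Complex.norm_of_nonneg h0.le, div_eq_one_iff_eq h0.ne',
    ← pow_left_inj₀ (norm_nonneg _) h0.le two_ne_zero, h2, ← Complex.normSq_eq_norm_sq,
    Complex.normSq_mk]
  linear_combination (1 - r ^ 2) ^ 2 * hε

/-- The Cayley transform maps |u| = r to the circle with centre (1 + r²)/(1 - r²) and radius 2r/(1 -
r²); these parameters hit its lowest and highest points. Because κ is the conjugate of s, ε = 1
gives the lowest. -/
theorem cayley_vertical_param {r ε : ℝ} (hr : r ^ 2 < 1) (hε : ε ^ 2 = 1) :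
    (1 + (r : ℂ) * (starRingEnd ℂ) ((2 * r + I * (ε * (1 - r ^ 2))) / (1 + r ^ 2))) /
      (1 - (r : ℂ) * (starRingEnd ℂ) ((2 * r + I * (ε * (1 - r ^ 2))) / (1 + r ^ 2))) =
    (((1 + r ^ 2) / (1 - r ^ 2) : ℝ) : ℂ) + I * ((-ε * (2 * r / (1 - r ^ 2)) : ℝ) : ℂ) := by
  have e1 : (1 + (r : ℂ) ^ 2) ≠ 0 := by
    exact_mod_cast (by positivity : 1 + r ^ 2 ≠ 0)
  have e2 : (1 - (r : ℂ) ^ 2) ≠ 0 := by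
    exact_mod_cast (by linarith : 1 - r ^ 2 ≠ 0)
  have hε' : (ε : ℂ) ^ 2 = 1 := by exact_mod_cast hε
  have hconj : (starRingEnd ℂ) ((2 * r + I * (ε * (1 - r ^ 2))) / (1 + r ^ 2)) =
      ((2 * r - I * (ε * (1 - r ^ 2))) / (1 + r ^ 2) : ℂ) := by
    simp [map_ofNat, sub_eq_add_neg]
  rw [hconj]
  have e3 : 1 - (r : ℂ) * ((2 * r - I * (ε * (1 - r ^ 2))) / (1 + r ^ 2)) =
      (1 - (r : ℂ) ^ 2) * (1 + I * (ε * r)) / (1 + r ^ 2) := by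
    field_simp
    ring
  have e4 : 1 + I * ((ε : ℂ) * r) ≠ 0 := by
    intro h
    have := congrArg Complex.re h
    simp at this
  rw [e3, div_eq_iff (div_ne_zero (mul_ne_zero e2 e4) e1)]
  push_cast
  field_simp
  linear_combination (2 * (r : ℂ) ^ 2 * (ε : ℂ) ^ 2) * I_sq - 2 * (r : ℂ) ^ 2 * hε'

theorem IsAdmissible.inequalities (h : IsAdmissible τ σ lam) {G : ℂ → ℂ} (hG : G ∈ Gen τ σ lam)
    (hG0 : ¬ EqOn G 0 unitDisk) {w : ℂ} (hw : HasSpectralValue G τ w) :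
    G 0 ≠ 0 ∧ w ≠ 0 ∧
      (sumAlpha τ σ lam ≤ (τ / G 0).re ∧
        ((τ / G 0).re = sumAlpha τ σ lam ↔ IsExtremalBdry τ σ lam G)) ∧
      ((1 - ‖τ‖) / (1 + ‖τ‖) * ((τ / G 0).re - sumAlpha τ σ lam)
          ≤ (((1 - ‖τ‖ ^ 2 : ℝ) : ℂ) / w).re - (1 - ‖τ‖ ^ 2) / 2 * ∑ k, 1 / |lam k| ∧
        ((1 - ‖τ‖) / (1 + ‖τ‖) * ((τ / G 0).re - sumAlpha τ σ lam)
          = (((1 - ‖τ‖ ^ 2 : ℝ) : ℂ) / w).re - (1 - ‖τ‖ ^ 2) / 2 * ∑ k, 1 / |lam k| ↔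
          IsExtremalBdry τ σ lam G ∨ IsExtremalInt τ σ lam (-(τ / ‖τ‖)) G)) ∧
      ((((1 - ‖τ‖ ^ 2 : ℝ) : ℂ) / w).re - (1 - ‖τ‖ ^ 2) / 2 * ∑ k, 1 / |lam k|
          ≤ (1 + ‖τ‖) / (1 - ‖τ‖) * ((τ / G 0).re - sumAlpha τ σ lam) ∧
        ((((1 - ‖τ‖ ^ 2 : ℝ) : ℂ) / w).re - (1 - ‖τ‖ ^ 2) / 2 * ∑ k, 1 / |lam k|
          = (1 + ‖τ‖) / (1 - ‖τ‖) * ((τ / G 0).re - sumAlpha τ σ lam) ↔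
          IsExtremalBdry τ σ lam G ∨ IsExtremalInt τ σ lam (τ / ‖τ‖) G)) ∧
      (|(((1 - ‖τ‖ ^ 2 : ℝ) : ℂ) / w - τ / G 0).im - sumB τ σ lam|
          ≤ 2 * ‖τ‖ / (1 - ‖τ‖ ^ 2) * ((τ / G 0).re - sumAlpha τ σ lam) ∧
        (|(((1 - ‖τ‖ ^ 2 : ℝ) : ℂ) / w - τ / G 0).im - sumB τ σ lam|
          = 2 * ‖τ‖ / (1 - ‖τ‖ ^ 2) * ((τ / G 0).re - sumAlpha τ σ lam) ↔
          IsExtremalBdry τ σ lam G ∨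
          IsExtremalInt τ σ lam
            (τ / ‖τ‖ * ((2 * ‖τ‖ + I * (1 - ‖τ‖ ^ 2)) / (1 + ‖τ‖ ^ 2))) G ∨
          IsExtremalInt τ σ lam
            (τ / ‖τ‖ * ((2 * ‖τ‖ - I * (1 - ‖τ‖ ^ 2)) / (1 + ‖τ‖ ^ 2))) G)) := by
  have hτ1 := mem_unitDisk.mp h.mem
  have hτp := norm_pos_iff.mpr h.ne_zero
  have hD := h.one_sub_pos
  obtain ⟨f, hf, hre, hrep, hne, hell, hdata⟩ := h.exists_data hG hG0
  obtain ⟨hw0, hq⟩ := (hdata w).mp hw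
  have hX : 0 ≤ (f 0).re := hre 0 (by simp)
  -- The quantities in the inequalities reduce to Re f(0), Re f(τ) and Im f(τ) - Im f(0): the sums
  -- over λ_k are the real and imaginary parts of p₀(τ), and A is p₀(0).
  have hdiff : τ / G 0 = f 0 + sumAlpha τ σ lam := by rw [← hell, ell_add]
  have hre1 : (τ / G 0).re - sumAlpha τ σ lam = (f 0).re := by
    rw [hdiff, add_re, ofReal_re, add_sub_cancel_right]
  have hre2 : (((1 - ‖τ‖ ^ 2 : ℝ) : ℂ) / w).re - (1 - ‖τ‖ ^ 2) / 2 * ∑ k, 1 / |lam k|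
      = (f τ).re := by
    rw [hq, add_re, p₀_re h.mem h.norm_eq, add_sub_cancel_right]
  have him : (((1 - ‖τ‖ ^ 2 : ℝ) : ℂ) / w - τ / G 0).im - sumB τ σ lam = (f τ).im - (f 0).im := by
    rw [hq, hdiff, sub_im, add_im, add_im, p₀_im h.mem h.norm_eq, ofReal_im]
    ring
  have hdisk := re_im_of_mem_disk ((norm_sub_le_iff_disk (norm_nonneg τ) hτ1 hX (f 0) (f τ) rfl
    rfl).1.mp (norm_sub_zero_le hf hre h.mem))
  have hRX : 0 ≤ 2 * ‖τ‖ / (1 - ‖τ‖ ^ 2) * (f 0).re := by positivity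
  -- Centre minus radius and centre plus radius, per unit of Re f(0), are the Harnack constants.
  have hl : (1 + ‖τ‖ ^ 2) / (1 - ‖τ‖ ^ 2) - 2 * ‖τ‖ / (1 - ‖τ‖ ^ 2) = (1 - ‖τ‖) / (1 + ‖τ‖) := by
    rw [← sub_div, div_eq_div_iff hD.ne' (by positivity)]
    ring
  have hr : (1 + ‖τ‖ ^ 2) / (1 - ‖τ‖ ^ 2) + 2 * ‖τ‖ / (1 - ‖τ‖ ^ 2) = (1 + ‖τ‖) / (1 - ‖τ‖) := by
    rw [← add_div, div_eq_div_iff hD.ne' (by linarith)]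
    ring
  have hor := fun {s : ℂ} (hs : ‖s‖ = 1) => h.isExtremal_or_iff hf hre hrep hne hell hs
  have hs1 := norm_div_norm h.ne_zero
  have hc1 := conj_div_norm_mul h.ne_zero
  have hvert : ∀ ε : ℝ, ε ^ 2 = 1 →
      (IsExtremalBdry τ σ lam G ∨ IsExtremalInt τ σ lam
        (τ / ‖τ‖ * ((2 * ‖τ‖ + I * (ε * (1 - ‖τ‖ ^ 2))) / (1 + ‖τ‖ ^ 2))) G ↔
      (f τ).re = (1 + ‖τ‖ ^ 2) / (1 - ‖τ‖ ^ 2) * (f 0).re ∧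
        (f τ).im = (f 0).im + -ε * (2 * ‖τ‖ / (1 - ‖τ‖ ^ 2)) * (f 0).re) := by
    intro ε hε
    rw [hor (by rw [norm_mul, hs1, norm_vertical_param hε, one_mul])]
    refine herglotz_eq_iff ?_
    rw [map_mul, mul_right_comm, hc1]
    exact cayley_vertical_param (by linarith) hε
  have hplus := hvert 1 (by norm_num)
  have hminus := hvert (-1) (by norm_num)
  simp only [ofReal_one, ofReal_neg, one_mul, neg_mul, mul_neg, ← sub_eq_add_neg, neg_neg]
    at hplus hminus
  rw [hre1, hre2, him]
  refine ⟨hne, hw0, ⟨by linarith, ?_⟩, ?_, ?_, ?_⟩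
  · rw [h.isExtremalBdry_iff hf hre hrep hne hell, ← hre1, sub_eq_zero]
  -- For s = -τ/|τ| one has κτ = -|τ|, whose Cayley transform (1 - |τ|)/(1 + |τ|) is real: the
  -- leftmost point of the disk.
  · rw [hor (by rw [norm_neg, hs1]), herglotz_eq_iff (e₁ := (1 - ‖τ‖) / (1 + ‖τ‖)) (e₂ := 0), ← hl]
    · simpa using disk_extreme_left hRX hdisk
    · rw [map_neg, neg_mul, hc1]
      push_cast
      ring
  · rw [hor hs1, herglotz_eq_iff (e₁ := (1 + ‖τ‖) / (1 - ‖τ‖)) (e₂ := 0), ← hr]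
    · simpa using disk_extreme_right hRX hdisk
    · rw [hc1]
      push_cast
      ring
  · have := disk_extreme_vertical hRX hdisk
    rw [← hplus, ← hminus] at this
    exact ⟨this.1, this.2.trans or_or_distrib_left.symm⟩

end HolGen

open HolGen

theorem mainTheorem2 {n : ℕ} (hn : 0 < n) (τ : ℂ) (hτ : ‖τ‖ < 1) (hτ0 : τ ≠ 0)
    (σ : Fin n → ℂ) (hσ : ∀ k, ‖σ k‖ = 1) (hσinj : Function.Injective σ)
    (lam : Fin n → ℝ) (hlam : ∀ k, lam k < 0) :
    -- the spectral value at `τ` is well defined on the class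
    (∀ G ∈ Gen τ σ lam, ∃! w : ℂ, HasSpectralValue G τ w) ∧
    -- the value region
    valueRegion τ σ lam = {P | P.1 ∈ regionZ τ σ lam ∧ P.2 ∈ regionΩ τ σ lam P.1} ∧
    -- `Z` and `Ω_ζ` are closed disks, the latter degenerate exactly for boundary points `ζ`
    regionZ τ σ lam =
      Metric.closedBall (τ / (2 * sumAlpha τ σ lam : ℝ)) (‖τ‖ / (2 * sumAlpha τ σ lam)) ∧
    (∀ ζ ∈ interior (regionZ τ σ lam), ∃ c : ℂ, ∃ r : ℝ, 0 < r ∧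
      regionΩ τ σ lam ζ = Metric.closedBall c r) ∧
    (∀ ζ ∈ frontier (regionZ τ σ lam), ∃ c : ℂ, regionΩ τ σ lam ζ = {c}) ∧
    -- each boundary point is delivered by a unique generator, which is explicit
    (∀ P ∈ frontier (valueRegion τ σ lam), ∃ G ∈ Gen τ σ lam,
      IsExtremal τ σ lam G ∧ Delivers τ G P ∧
      ∀ G' ∈ Gen τ σ lam, Delivers τ G' P → EqOn G' G unitDisk) ∧
    -- conversely, all the explicit functions are in the class and deliver boundary points
    (∀ G, IsExtremal τ σ lam G → G ∈ Gen τ σ lam ∧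
      ∀ P, Delivers τ G P → P ∈ frontier (valueRegion τ σ lam)) ∧
    -- except when `s` is one of the `σ k`, their spectral values at the `σ k` equal `lam k`
    (∀ G, IsExtremalBdry τ σ lam G → G ∈ GenExact τ σ lam) ∧
    (∀ G s, ‖s‖ = 1 → s ∉ Set.range σ → IsExtremalInt τ σ lam s G → G ∈ GenExact τ σ lam) ∧
    -- the inequalities, with the generators for which equality occurs
    (∀ G ∈ Gen τ σ lam, ¬ EqOn G 0 unitDisk → ∀ w : ℂ, HasSpectralValue G τ w →
      G 0 ≠ 0 ∧ w ≠ 0 ∧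
      (sumAlpha τ σ lam ≤ (τ / G 0).re ∧
        ((τ / G 0).re = sumAlpha τ σ lam ↔ IsExtremalBdry τ σ lam G)) ∧
      ((1 - ‖τ‖) / (1 + ‖τ‖) * ((τ / G 0).re - sumAlpha τ σ lam)
          ≤ (((1 - ‖τ‖ ^ 2 : ℝ) : ℂ) / w).re - (1 - ‖τ‖ ^ 2) / 2 * ∑ k, 1 / |lam k| ∧
        ((1 - ‖τ‖) / (1 + ‖τ‖) * ((τ / G 0).re - sumAlpha τ σ lam)
          = (((1 - ‖τ‖ ^ 2 : ℝ) : ℂ) / w).re - (1 - ‖τ‖ ^ 2) / 2 * ∑ k, 1 / |lam k| ↔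
          IsExtremalBdry τ σ lam G ∨ IsExtremalInt τ σ lam (-(τ / ‖τ‖)) G)) ∧
      ((((1 - ‖τ‖ ^ 2 : ℝ) : ℂ) / w).re - (1 - ‖τ‖ ^ 2) / 2 * ∑ k, 1 / |lam k|
          ≤ (1 + ‖τ‖) / (1 - ‖τ‖) * ((τ / G 0).re - sumAlpha τ σ lam) ∧
        ((((1 - ‖τ‖ ^ 2 : ℝ) : ℂ) / w).re - (1 - ‖τ‖ ^ 2) / 2 * ∑ k, 1 / |lam k|
          = (1 + ‖τ‖) / (1 - ‖τ‖) * ((τ / G 0).re - sumAlpha τ σ lam) ↔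
          IsExtremalBdry τ σ lam G ∨ IsExtremalInt τ σ lam (τ / ‖τ‖) G)) ∧
      (|(((1 - ‖τ‖ ^ 2 : ℝ) : ℂ) / w - τ / G 0).im - sumB τ σ lam|
          ≤ 2 * ‖τ‖ / (1 - ‖τ‖ ^ 2) * ((τ / G 0).re - sumAlpha τ σ lam) ∧
        (|(((1 - ‖τ‖ ^ 2 : ℝ) : ℂ) / w - τ / G 0).im - sumB τ σ lam|
          = 2 * ‖τ‖ / (1 - ‖τ‖ ^ 2) * ((τ / G 0).re - sumAlpha τ σ lam) ↔
          IsExtremalBdry τ σ lam G ∨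
          IsExtremalInt τ σ lam
            (τ / ‖τ‖ * ((2 * ‖τ‖ + I * (1 - ‖τ‖ ^ 2)) / (1 + ‖τ‖ ^ 2))) G ∨
          IsExtremalInt τ σ lam
            (τ / ‖τ‖ * ((2 * ‖τ‖ - I * (1 - ‖τ‖ ^ 2)) / (1 + ‖τ‖ ^ 2))) G))) := by
  have h : IsAdmissible τ σ lam := ⟨hn, mem_unitDisk.mpr hτ, hτ0, hσ, hσinj, hlam⟩
  refine ⟨fun G hG => h.existsUnique_spectralValue hG, h.valueRegion_eq,
    regionZ_eq_closedBall hτ0 h.sumAlpha_pos, fun ζ hζ => ?_, fun ζ hζ => ?_,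
    h.frontier_valueRegion, fun G hG => h.mem_gen_of_isExtremal hG,
    fun G hG => h.mem_genExact_of_isExtremalBdry hG,
    fun G s hs hsσ hG => h.mem_genExact_of_isExtremalInt hs hsσ hG,
    fun G hG hG0 w hw => h.inequalities hG hG0 hw⟩
  · obtain ⟨hζ0, hpos⟩ := (mem_interior_regionZ_iff hτ0 h.sumAlpha_pos).mp hζ
    obtain ⟨c, t, ht, hE⟩ := regionΩ_eq hn h.mem hσ hlam hζ0 hpos.le
    have hD := h.one_sub_pos
    have hτp := norm_pos_iff.mpr hτ0
    exact ⟨c, _, by positivity, hE⟩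
  · rcases (mem_frontier_regionZ_iff hτ0 h.sumAlpha_pos).mp hζ with rfl | ⟨hζ0, hre⟩
    · exact ⟨0, by simp [regionΩ]⟩
    · obtain ⟨c, t, -, hE⟩ := regionΩ_eq hn h.mem hσ hlam hζ0 hre.ge
      refine ⟨c, ?_⟩
      rw [hE, hre, mul_zero, mul_zero, Metric.closedBall_zero]
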